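/- Let $-\infty\le a<b\le+\infty$ and $a=c_0<c_1<\dots<c_{d+1}=b$ ($d\ge 0$). For $0\le k\le d$ put $I_k=(c_k,c_{k+1})$, let $f_k:I_k\to(a,b)$ be continuous and strictly monotone with sign of monotonicity $s_k\in\{\pm1\}$, and let $g_k\ge 0$ be a real weight. Write $f=f_k$ on $I_k$. *Operator.* Let $\mathcal S$ be the space of functions $\phi:(a,b)\to\mathbb C$ for which there is a finite set $C\subset(a,b)$ such that $\phi$ is constant on each component of $(a,b)\setminus C$, with the norm $\|\phi\|=\operatorname{var}\phi+|\phi(a^+)+\phi(b^-)|$, and let $X$ be its completion. Let $L$ be the bounded operator on $X$ that is given on $\mathcal S$ by $L\phi(y)=\sum_{k=0}^d g_k\,\phi(f_k^{-1}(y))\,\mathbf 1_{f_k(I_k)}(y)$, and let $\rho_{\rm sp}(L)$ be its spectral radius. *Germs.* The point germs are the symbols $x^+$ ($a\le x<b$) and $x^-$ ($a<x\le b$), ordered together with the base points by $x<x^+<y^-<y$ for $x<y$. Each germ $\hat x=x^\epsilon$ lies in exactly one $[c_k^+,c_{k+1}^-]$; then $s(\hat x)=s_k$, $g(\hat x)=g_k$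 and $\hat f(x^\epsilon)=(f_k(x^\epsilon))^{s_k\epsilon}$, where $f_k(x^\epsilon)$ is the one-sided limit. Put $g^{(n)}(\hat x)=\prod_{i<n}g(\hat f^i\hat x)$, $(sg)^{(n)}(\hat x)=\prod_{i<n}(sg)(\hat f^i\hat x)$ and $\rho_\infty=\lim_n\|g^{(n)}\|_\infty^{1/n}$ (supremum over all germs). *Determinant.* Let $\sigma_{c_k}(\hat x)=\frac12$ if $\hat x>c_k$ and $-\frac12$ if $\hat x<c_k$. For $t\in\mathbb C$ with $|t|\rho_\infty<1$ let $\Theta_k(\hat x,t)=\sum_{n\ge0}t^n(sg)^{(n)}(\hat x)\,\sigma_{c_k}(\hat f^n\hat x)$, and for $0\le j,k\le d$ let $M_{0k}(t)=\Theta_k(a^+,t)+\Theta_k(b^-,t)$ and $M_{jk}(t)=\Theta_k(c_j^+,t)-\Theta_k(c_j^-,t)$ for $j\ge1$. Put $d_{\rm MT}(t)=\det M(t)$. *Partition function.* Let $Z_n$ be the collection of monotonicity intervals (cylinder sets) of $f^n$, i.e. of the non-empty sets $\{x: x\in I_{k_0},f(x)\in I_{k_1},\dots,f^{n-1}(x)\in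 I_{k_{n-1}}\}$, let $\Omega_n=\sum_{\alpha\in Z_n}g^{(n)}|_\alpha$ with $g^{(n)}|_\alpha=g_{k_0}\cdots g_{k_{n-1}}$, and let $h_{\rm top}=\log\lim_n(\#Z_n)^{1/n}$ be the topological entropy. **Theorem.** The limit defining $\rho_\infty$ exists, the series $\Theta_k(\hat x,t)$ converge for $|t|\rho_\infty<1$, and the following limits exist and satisfy $$\lim_n\Omega_n^{1/n}=\lim_n\|L^n\mathbf 1\|_\infty^{1/n}=\rho_{\rm sp}(L).$$ If $g_k=1$ for all $k$, then the limit defining $h_{\rm top}$ exists and $\rho_{\rm sp}(L)=\exp(h_{\rm top})$. If moreover (for general $g_k\ge0$) $\rho_{\rm sp}(L)>\rho_\infty$, then $\rho_{\rm sp}(L)$ is an isolated point of the spectrum of $L$ and an eigenvalue of finite algebraic multiplicity, and $t_*=1/\rho_{\rm sp}(L)>0$ satisfies $t_*\rho_\infty<1$ and is a zero of $d_{\rm MT}$ of smallest absolute value: $d_{\rm MT}(t_*)=0$, and $|t|\ge t_*$ for every $t\in\mathbb C$ with $|t|\rho_\infty<1$ and $d_{\rm MT}(t)=0$. -/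

import Mathlib

open Set Filter Topology

noncomputable section

namespace Kneading

/-! ### Simple step functions on `(a,b)` and the Banach space `SBV(a,b)`

The endpoints are extended reals; `Ioo a b : Set EReal` consists of real numbers only. -/

/-- Simple step functions on `(a,b)`: there is a finite set `C ⊆ (a,b)` such that `φ` is constant
on each connected component of `(a,b) \ C` (two points lie in the same component iff no point of
`C` lies in the closed interval between them). The values at the points of `C` are free. -/
def stepSubmodule (a b : EReal) : Submodule ℂ (Ioo a b → ℂ) where
  carrier := {φ | ∃ C : Set (Ioo a b), C.Finite ∧ ∀ x y, Disjoint (uIcc x y) C → φ x = φ y}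
  zero_mem' := ⟨∅, finite_empty, fun _ _ _ => rfl⟩
  add_mem' := by
    rintro φ ψ ⟨C, hC, h⟩ ⟨D, hD, h'⟩
    refine ⟨C ∪ D, hC.union hD, fun x y hxy => ?_⟩
    rw [disjoint_union_right] at hxy
    simp [h x y hxy.1, h' x y hxy.2]
  smul_mem' := by
    rintro r φ ⟨C, hC, h⟩
    exact ⟨C, hC, fun x y hxy => by simp [h x y hxy]⟩

/-- The space `S(a,b)` of simple step functions, as a type of its own (it carries the
bounded-variation norm below and not the topology of pointwise convergence). -/
def Step (a b : EReal) : Type := stepSubmodule a b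

instance (a b : EReal) : AddCommGroup (Step a b) := inferInstanceAs (AddCommGroup (stepSubmodule a b))
instance (a b : EReal) : Module ℂ (Step a b) := inferInstanceAs (Module ℂ (stepSubmodule a b))

/-- The function underlying a simple step function. -/
def Step.toFun {a b : EReal} (φ : Step a b) : Ioo a b → ℂ := φ.1

instance (a b : EReal) : CoeFun (Step a b) (fun _ => Ioo a b → ℂ) := ⟨Step.toFun⟩

/-- The constant step function `1`. -/
def Step.one (a b : EReal) : Step a b :=
  ⟨fun _ => 1, ∅, finite_empty, fun _ _ _ => rfl⟩

/-- `φ(a⁺)`. -/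
def leftValue {a b : EReal} (φ : Ioo a b → ℂ) : ℂ :=
  limUnder (comap (Subtype.val : Ioo a b → EReal) (𝓝[>] a)) φ

/-- `φ(b⁻)`. -/
def rightValue {a b : EReal} (φ : Ioo a b → ℂ) : ℂ :=
  limUnder (comap (Subtype.val : Ioo a b → EReal) (𝓝[<] b)) φ

/-- The boundary value `∂φ = φ(a⁺) + φ(b⁻)`. -/
def boundary {a b : EReal} (φ : Ioo a b → ℂ) : ℂ := leftValue φ + rightValue φ

/-- The norm `var φ + |∂φ|`. -/
instance (a b : EReal) : Norm (Step a b) :=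
  ⟨fun φ => (eVariationOn φ.toFun univ).toReal + ‖boundary φ.toFun‖⟩

theorem Step.norm_def {a b : EReal} (φ : Step a b) :
    ‖φ‖ = (eVariationOn φ.toFun univ).toReal + ‖boundary φ.toFun‖ := rfl

theorem Step.ext {a b : EReal} {φ ψ : Step a b} (h : ∀ x, φ x = ψ x) : φ = ψ :=
  Subtype.ext (funext h)

theorem Step.add_apply {a b : EReal} (φ ψ : Step a b) (x : Ioo a b) :
    (φ + ψ).toFun x = φ x + ψ x := rfl

theorem Step.smul_apply {a b : EReal} (r : ℂ) (φ : Step a b) (x : Ioo a b) :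
    (r • φ).toFun x = r * φ x := rfl

theorem Step.zero_apply {a b : EReal} (x : Ioo a b) : (0 : Step a b).toFun x = 0 := rfl

section Norm

variable {a b : EReal}

theorem Step.exists_eq_left [h : Fact (a < b)] (φ : Step a b) :
    ∃ l, ∀ᶠ x in atBot, φ x = l := by
  obtain ⟨C, hC, hφ⟩ := φ.2
  have : Nonempty (Ioo a b) := nonempty_Ioo_subtype h.1
  obtain ⟨m, hm⟩ := hC.bddBelow
  obtain ⟨x₀, hx₀⟩ := exists_lt m
  refine ⟨φ x₀, ?_⟩
  filter_upwards [eventually_le_atBot x₀] with x hx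
  refine hφ x x₀ (disjoint_left.2 fun z hz hzC => ?_)
  rw [uIcc_of_le hx] at hz
  exact absurd (hm hzC) (not_le.2 (hz.2.trans_lt hx₀))

theorem Step.exists_eq_right [h : Fact (a < b)] (φ : Step a b) :
    ∃ l, ∀ᶠ x in atTop, φ x = l := by
  obtain ⟨C, hC, hφ⟩ := φ.2
  have : Nonempty (Ioo a b) := nonempty_Ioo_subtype h.1
  obtain ⟨m, hm⟩ := hC.bddAbove
  obtain ⟨x₀, hx₀⟩ := exists_gt m
  refine ⟨φ x₀, ?_⟩
  filter_upwards [eventually_ge_atTop x₀] with x hx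
  refine hφ x x₀ (disjoint_left.2 fun z hz hzC => ?_)
  rw [uIcc_of_ge hx] at hz
  exact absurd (hm hzC) (not_le.2 (hx₀.trans_le hz.1))

theorem leftValue_eq [h : Fact (a < b)] {φ : Ioo a b → ℂ} {l : ℂ}
    (hl : ∀ᶠ x in atBot, φ x = l) : leftValue φ = l := by
  have : Nonempty (Ioo a b) := nonempty_Ioo_subtype h.1
  rw [leftValue, comap_coe_Ioo_nhdsGT]
  exact (tendsto_const_nhds.congr' (hl.mono fun _ hx => hx.symm)).limUnder_eq

theorem rightValue_eq [h : Fact (a < b)] {φ : Ioo a b → ℂ} {l : ℂ}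
    (hl : ∀ᶠ x in atTop, φ x = l) : rightValue φ = l := by
  have : Nonempty (Ioo a b) := nonempty_Ioo_subtype h.1
  rw [rightValue, comap_coe_Ioo_nhdsLT]
  exact (tendsto_const_nhds.congr' (hl.mono fun _ hx => hx.symm)).limUnder_eq

theorem boundary_add [Fact (a < b)] (φ ψ : Step a b) :
    boundary (φ + ψ).toFun = boundary φ.toFun + boundary ψ.toFun := by
  obtain ⟨l, hl⟩ := φ.exists_eq_left
  obtain ⟨r, hr⟩ := φ.exists_eq_right
  obtain ⟨l', hl'⟩ := ψ.exists_eq_left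
  obtain ⟨r', hr'⟩ := ψ.exists_eq_right
  have h1 : ∀ᶠ x in atBot, (φ + ψ).toFun x = l + l' := by
    filter_upwards [hl, hl'] with x h h'
    rw [Step.add_apply, h, h']
  have h2 : ∀ᶠ x in atTop, (φ + ψ).toFun x = r + r' := by
    filter_upwards [hr, hr'] with x h h'
    rw [Step.add_apply, h, h']
  simp only [boundary, leftValue_eq hl, leftValue_eq hl', leftValue_eq h1, rightValue_eq hr,
    rightValue_eq hr', rightValue_eq h2]
  ring

theorem boundary_smul [Fact (a < b)] (c : ℂ) (φ : Step a b) :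
    boundary (c • φ).toFun = c * boundary φ.toFun := by
  obtain ⟨l, hl⟩ := φ.exists_eq_left
  obtain ⟨r, hr⟩ := φ.exists_eq_right
  have h1 : ∀ᶠ x in atBot, (c • φ).toFun x = c * l := by
    filter_upwards [hl] with x h
    rw [Step.smul_apply, h]
  have h2 : ∀ᶠ x in atTop, (c • φ).toFun x = c * r := by
    filter_upwards [hr] with x h
    rw [Step.smul_apply, h]
  simp only [boundary, leftValue_eq hl, leftValue_eq h1, rightValue_eq hr, rightValue_eq h2]
  ring

open Classical in
theorem Step.boundedVariation (φ : Step a b) : BoundedVariationOn φ.toFun univ := by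
  obtain ⟨C, hC, hφ⟩ := φ.2
  lift C to Finset (Ioo a b) using hC
  let r : Ioo a b → ℕ := fun x => (C.filter (· < x)).card + (C.filter (· ≤ x)).card
  have r1 : ∀ x y, x ≤ y → C.filter (· < x) ⊆ C.filter (· < y) := fun x y h =>
    Finset.monotone_filter_right C fun z _ hz => lt_of_lt_of_le hz h
  have r2 : ∀ x y, x ≤ y → C.filter (· ≤ x) ⊆ C.filter (· ≤ y) := fun x y h =>
    Finset.monotone_filter_right C fun z _ hz => le_trans hz h
  have hr : ∀ x y, x ≤ y → r x ≤ r y := fun x y h =>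
    add_le_add (Finset.card_le_card (r1 x y h)) (Finset.card_le_card (r2 x y h))
  have key : ∀ x y, x ≤ y → r x = r y → φ.toFun x = φ.toFun y := by
    intro x y h hxy
    rcases h.eq_or_lt with rfl | hlt
    · rfl
    have c1 := Finset.card_le_card (r1 x y h)
    have c2 := Finset.card_le_card (r2 x y h)
    simp only [r] at hxy
    have e1 := Finset.eq_of_subset_of_card_le (r1 x y h) (by omega)
    have e2 := Finset.eq_of_subset_of_card_le (r2 x y h) (by omega)
    refine hφ x y (disjoint_left.2 fun z hz hzC => ?_)
    rw [uIcc_of_le h] at hz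
    rcases hz.2.eq_or_lt with rfl | hzy
    · have : z ∈ C.filter (· ≤ x) := e2 ▸ Finset.mem_filter.2 ⟨hzC, le_rfl⟩
      exact absurd (Finset.mem_filter.1 this).2 (not_le.2 hlt)
    · have : z ∈ C.filter (· < x) := e1 ▸ Finset.mem_filter.2 ⟨hzC, hzy⟩
      exact absurd (Finset.mem_filter.1 this).2 (not_lt.2 hz.1)
  have rb : ∀ x, r x ≤ 2 * C.card := fun x => by
    have := Finset.card_filter_le C (· < x)
    have := Finset.card_filter_le C (· ≤ x)
    simp only [r]
    omega
  have hfin : (range φ.toFun).Finite := by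
    have : (range r).Finite := (finite_Iic (2 * C.card)).subset (by rintro _ ⟨x, rfl⟩; exact rb x)
    have e : range φ.toFun ⊆ (fun k => if h : ∃ x, r x = k then φ.toFun h.choose else 0) '' range r := by
      rintro _ ⟨x, rfl⟩
      refine ⟨r x, ⟨x, rfl⟩, ?_⟩
      have h : ∃ y, r y = r x := ⟨x, rfl⟩
      simp only [dif_pos h]
      rcases le_total h.choose x with h' | h'
      · exact key _ _ h' h.choose_spec
      · exact (key _ _ h' h.choose_spec.symm).symm
    exact (this.image _).subset e
  have hK : Metric.ediam (range φ.toFun) ≠ ⊤ := hfin.isBounded.ediam_ne_top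
  set K := Metric.ediam (range φ.toFun)
  have hterm : ∀ x y, x ≤ y → edist (φ.toFun y) (φ.toFun x) ≤ K * ((r y - r x : ℕ) : ENNReal) := by
    intro x y h
    rcases (hr x y h).eq_or_lt with e | e
    · simp [key x y h e]
    · calc edist (φ.toFun y) (φ.toFun x) ≤ K * 1 := by
            rw [mul_one]; exact Metric.edist_le_ediam_of_mem (mem_range_self _) (mem_range_self _)
        _ ≤ _ := by
            gcongr
            exact_mod_cast (show 1 ≤ r y - r x by omega)
  have : eVariationOn φ.toFun univ ≤ K * ((2 * C.card : ℕ) : ENNReal) := by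
    refine iSup_le ?_
    rintro ⟨n, u, hu, -⟩
    calc ∑ i ∈ Finset.range n, edist (φ.toFun (u (i + 1))) (φ.toFun (u i))
        ≤ ∑ i ∈ Finset.range n, K * ((r (u (i + 1)) - r (u i) : ℕ) : ENNReal) :=
          Finset.sum_le_sum fun i _ => hterm _ _ (hu (Nat.le_succ i))
      _ = K * ((∑ i ∈ Finset.range n, (r (u (i + 1)) - r (u i)) : ℕ) : ENNReal) := by
          rw [← Finset.mul_sum]; push_cast; rfl
      _ ≤ _ := by
          gcongr
          rw [Finset.sum_range_tsub (fun i j hij => hr _ _ (hu hij))]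
          exact (Nat.sub_le _ _).trans (rb _)
  exact ne_top_of_le_ne_top (ENNReal.mul_ne_top hK (ENNReal.natCast_ne_top _)) this

theorem eVariationOn_add_le {α : Type*} [LinearOrder α] (f g : α → ℂ) (s : Set α) :
    eVariationOn (fun x => f x + g x) s ≤ eVariationOn f s + eVariationOn g s := by
  refine iSup_le ?_
  rintro ⟨n, u, hu, us⟩
  calc ∑ i ∈ Finset.range n, edist (f (u (i + 1)) + g (u (i + 1))) (f (u i) + g (u i))
      ≤ ∑ i ∈ Finset.range n, (edist (f (u (i + 1))) (f (u i)) + edist (g (u (i + 1))) (g (u i))) :=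
        Finset.sum_le_sum fun i _ => edist_add_add_le _ _ _ _
    _ ≤ _ := by
        rw [Finset.sum_add_distrib]
        exact add_le_add (eVariationOn.sum_le hu us) (eVariationOn.sum_le hu us)

theorem eVariationOn_mul {α : Type*} [LinearOrder α] (c : ℂ) (f : α → ℂ) (s : Set α) :
    eVariationOn (fun x => c * f x) s = ‖c‖ₑ * eVariationOn f s := by
  have h : ∀ x y, edist (c * f x) (c * f y) = ‖c‖ₑ * edist (f x) (f y) := fun x y => by
    simp only [edist_eq_enorm_sub, ← mul_sub, enorm_mul]
  simp only [eVariationOn, h, ← Finset.mul_sum, ENNReal.mul_iSup]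

theorem Step.norm_apply_le [h : Fact (a < b)] (φ : Step a b) (x : Ioo a b) : ‖φ x‖ ≤ ‖φ‖ := by
  have : Nonempty (Ioo a b) := nonempty_Ioo_subtype h.1
  obtain ⟨l, hl⟩ := φ.exists_eq_left
  obtain ⟨r, hr⟩ := φ.exists_eq_right
  obtain ⟨y, hy⟩ := hl.exists
  obtain ⟨z, hz⟩ := hr.exists
  have d1 : ‖φ x - l‖ ≤ (eVariationOn φ.toFun univ).toReal := by
    rw [← hy, ← dist_eq_norm]
    exact φ.boundedVariation.dist_le (mem_univ _) (mem_univ _)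
  have d2 : ‖φ x - r‖ ≤ (eVariationOn φ.toFun univ).toReal := by
    rw [← hz, ← dist_eq_norm]
    exact φ.boundedVariation.dist_le (mem_univ _) (mem_univ _)
  have e : boundary φ.toFun = l + r := by rw [boundary, leftValue_eq hl, rightValue_eq hr]
  have e2 : (2 : ℂ) * φ x = (φ x - l) + (φ x - r) + boundary φ.toFun := by rw [e]; ring
  have h3 : 2 * ‖φ x‖ ≤ ‖φ x - l‖ + ‖φ x - r‖ + ‖boundary φ.toFun‖ := by
    calc 2 * ‖φ x‖ = ‖(2 : ℂ) * φ x‖ := by simp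
      _ ≤ _ := by rw [e2]; exact norm_add₃_le
  rw [Step.norm_def]
  have := norm_nonneg (boundary φ.toFun)
  linarith

theorem Step.normCore [Fact (a < b)] : NormedSpace.Core ℂ (Step a b) where
  norm_nonneg φ := add_nonneg ENNReal.toReal_nonneg (norm_nonneg _)
  norm_smul c φ := by
    have : eVariationOn (c • φ).toFun univ = ‖c‖ₑ * eVariationOn φ.toFun univ :=
      eVariationOn_mul c φ.toFun univ
    rw [Step.norm_def, Step.norm_def, this, boundary_smul, norm_mul, ENNReal.toReal_mul, toReal_enorm]
    ring
  norm_triangle φ ψ := by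
    have h1 : (eVariationOn (φ + ψ).toFun univ).toReal ≤
        (eVariationOn φ.toFun univ).toReal + (eVariationOn ψ.toFun univ).toReal := by
      rw [← ENNReal.toReal_add φ.boundedVariation ψ.boundedVariation]
      exact ENNReal.toReal_mono (ENNReal.add_ne_top.2 ⟨φ.boundedVariation, ψ.boundedVariation⟩)
        (eVariationOn_add_le φ.toFun ψ.toFun univ)
    have h2 := norm_add_le (boundary φ.toFun) (boundary ψ.toFun)
    rw [Step.norm_def, Step.norm_def, Step.norm_def, boundary_add]
    linarith
  norm_eq_zero_iff φ := by
    constructor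
    · intro h
      refine Step.ext fun x => ?_
      have := φ.norm_apply_le x
      rw [h] at this
      simpa [Step.zero_apply] using this
    · rintro rfl
      have h1 : eVariationOn (0 : Step a b).toFun univ = 0 :=
        eVariationOn.constant_on (by rintro _ ⟨x, -, rfl⟩ _ ⟨y, -, rfl⟩; rfl)
      have h2 : boundary (0 : Step a b).toFun = 0 := by
        have := boundary_smul (0 : ℂ) (0 : Step a b)
        rwa [zero_smul, zero_mul] at this
      rw [Step.norm_def, h1, h2]
      simp

instance [Fact (a < b)] : NormedAddCommGroup (Step a b) := NormedAddCommGroup.ofCore Step.normCore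
instance [Fact (a < b)] : NormedSpace ℂ (Step a b) := NormedSpace.ofCore Step.normCore

end Norm

/-- `SBV(a,b)`, the completion of the space of simple step functions on `(a,b)`
for the norm `var φ + |∂φ|`. -/
abbrev SBV (a b : EReal) [Fact (a < b)] : Type := UniformSpace.Completion (Step a b)

/-! ### Point germs -/

/-- Point germs `x⁺` (`a ≤ x < b`) and `x⁻` (`a < x ≤ b`). -/
inductive Germ (a b : EReal) : Type
  | plus (x : EReal) (h : x ∈ Ico a b) : Germ a b
  | minus (x : EReal) (h : x ∈ Ioc a b) : Germ a b

/-- `c < x̂` for a base point `c` and a germ `x̂`, in the order with `x < x⁺ < y⁻ < y`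
whenever `x < y`. -/
def Germ.Above {a b : EReal} (c : EReal) : Germ a b → Prop
  | .plus x _ => c ≤ x
  | .minus x _ => c < x

theorem limUnder_right_mem_of_monotoneOn {a b x y : EReal} {f : EReal → EReal} (hxy : x < y)
    (hf : MonotoneOn f (Ioo x y)) (hm : MapsTo f (Ioo x y) (Ioo a b)) :
    limUnder (𝓝[>] x) f ∈ Ico a b := by
  have : (𝓝[>] x).NeBot := nhdsGT_neBot_of_exists_gt ⟨y, hxy⟩
  rw [(hf.tendsto_nhdsWithin_Ioo_right (nonempty_Ioo.2 hxy) (OrderBot.bddBelow _)).limUnder_eq]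
  obtain ⟨z, hz⟩ := nonempty_Ioo.2 hxy
  refine ⟨le_sInf ?_, lt_of_le_of_lt (sInf_le (mem_image_of_mem f hz)) (hm hz).2⟩
  rintro _ ⟨w, hw, rfl⟩
  exact (hm hw).1.le

theorem limUnder_right_mem_of_antitoneOn {a b x y : EReal} {f : EReal → EReal} (hxy : x < y)
    (hf : AntitoneOn f (Ioo x y)) (hm : MapsTo f (Ioo x y) (Ioo a b)) :
    limUnder (𝓝[>] x) f ∈ Ioc a b := by
  have : (𝓝[>] x).NeBot := nhdsGT_neBot_of_exists_gt ⟨y, hxy⟩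
  rw [(hf.tendsto_nhdsWithin_Ioo_right (nonempty_Ioo.2 hxy) (OrderTop.bddAbove _)).limUnder_eq]
  obtain ⟨z, hz⟩ := nonempty_Ioo.2 hxy
  refine ⟨(hm hz).1.trans_le (le_sSup ⟨z, hz, rfl⟩), sSup_le ?_⟩
  rintro _ ⟨w, hw, rfl⟩
  exact (hm hw).2.le

theorem limUnder_left_mem_of_monotoneOn {a b x y : EReal} {f : EReal → EReal} (hxy : x < y)
    (hf : MonotoneOn f (Ioo x y)) (hm : MapsTo f (Ioo x y) (Ioo a b)) :
    limUnder (𝓝[<] y) f ∈ Ioc a b := by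
  have : (𝓝[<] y).NeBot := nhdsLT_neBot_of_exists_lt ⟨_, hxy⟩
  rw [(hf.tendsto_nhdsWithin_Ioo_left (nonempty_Ioo.2 hxy) (OrderTop.bddAbove _)).limUnder_eq]
  obtain ⟨z, hz⟩ := nonempty_Ioo.2 hxy
  refine ⟨(hm hz).1.trans_le (le_sSup ⟨z, hz, rfl⟩), sSup_le ?_⟩
  rintro _ ⟨w, hw, rfl⟩
  exact (hm hw).2.le

theorem limUnder_left_mem_of_antitoneOn {a b x y : EReal} {f : EReal → EReal} (hxy : x < y)
    (hf : AntitoneOn f (Ioo x y)) (hm : MapsTo f (Ioo x y) (Ioo a b)) :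
    limUnder (𝓝[<] y) f ∈ Ico a b := by
  have : (𝓝[<] y).NeBot := nhdsLT_neBot_of_exists_lt ⟨_, hxy⟩
  rw [(hf.tendsto_nhdsWithin_Ioo_left (nonempty_Ioo.2 hxy) (OrderBot.bddBelow _)).limUnder_eq]
  obtain ⟨z, hz⟩ := nonempty_Ioo.2 hxy
  refine ⟨le_sInf ?_, lt_of_le_of_lt (sInf_le (mem_image_of_mem f hz)) (hm hz).2⟩
  rintro _ ⟨w, hw, rfl⟩
  exact (hm hw).1.le

/-! ### Isolated eigenvalues of finite multiplicity -/

/-- `z` is an isolated point of the spectrum of `A`, an eigenvalue, and of finite algebraic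
multiplicity: the generalized eigenspace is finite-dimensional and has a closed complement `R`
which `A - z` maps bijectively onto itself (so that the generalized eigenspace is the range of the
spectral projection at `z`). -/
def IsIsolatedEigenvalueOfFiniteMultiplicity {E : Type*} [NormedAddCommGroup E] [NormedSpace ℂ E]
    (A : E →L[ℂ] E) (z : ℂ) : Prop :=
  (∀ᶠ w in 𝓝[≠] z, w ∉ spectrum ℂ A) ∧
  Module.End.HasEigenvalue (A : Module.End ℂ E) z ∧
  FiniteDimensional ℂ (Module.End.maxGenEigenspace (A : Module.End ℂ E) z) ∧
  ∃ R : Submodule ℂ E, IsClosed (R : Set E) ∧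
    IsCompl (Module.End.maxGenEigenspace (A : Module.End ℂ E) z) R ∧
    BijOn (fun v => A v - z • v) R R

/-! ### Piecewise monotone systems -/

/-- Cutting points `a = c₀ < c₁ < ⋯ < c_{d+1} = b`, on each open interval
`I_k = (c_k, c_{k+1})`, `0 ≤ k ≤ d`, a continuous strictly monotone map `f_k : I_k → (a,b)`,
and a real weight `g_k`. (Only the restriction of `f k` to `I_k` is ever used.) -/
structure System (d : ℕ) where
  c : Fin (d + 2) → EReal
  c_strictMono : StrictMono c
  f : Fin (d + 1) → EReal → EReal
  g : Fin (d + 1) → ℝ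
  f_mapsTo : ∀ k, MapsTo (f k) (Ioo (c k.castSucc) (c k.succ)) (Ioo (c 0) (c (Fin.last (d + 1))))
  f_continuousOn : ∀ k, ContinuousOn (f k) (Ioo (c k.castSucc) (c k.succ))
  f_monotone : ∀ k, StrictMonoOn (f k) (Ioo (c k.castSucc) (c k.succ)) ∨
    StrictAntiOn (f k) (Ioo (c k.castSucc) (c k.succ))

namespace System

variable {d : ℕ} (T : System d)

/-- Left endpoint `a = c₀`. -/
def a : EReal := T.c 0

/-- Right endpoint `b = c_{d+1}`. -/
def b : EReal := T.c (Fin.last (d + 1))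

instance : Fact (T.a < T.b) := ⟨T.c_strictMono (Fin.last_pos)⟩

/-- `I_k = (c_k, c_{k+1})`. -/
def I (k : Fin (d + 1)) : Set EReal := Ioo (T.c k.castSucc) (T.c k.succ)

theorem a_le (j : Fin (d + 2)) : T.a ≤ T.c j := T.c_strictMono.monotone (Fin.zero_le j)

theorem le_b (j : Fin (d + 2)) : T.c j ≤ T.b := T.c_strictMono.monotone (Fin.le_last j)

theorem I_subset (k : Fin (d + 1)) : T.I k ⊆ Ioo T.a T.b :=
  Ioo_subset_Ioo (T.a_le _) (T.le_b _)

theorem f_mem {k : Fin (d + 1)} {x : EReal} (hx : x ∈ T.I k) : T.f k x ∈ Ioo T.a T.b :=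
  T.f_mapsTo k hx

theorem f_injOn (k : Fin (d + 1)) : InjOn (T.f k) (T.I k) := by
  rcases T.f_monotone k with h | h
  · exact h.injOn
  · exact h.injOn

open Classical in
/-- The sign of monotonicity `s_k` of `f_k`. -/
def s (k : Fin (d + 1)) : ℝ := if StrictMonoOn (T.f k) (T.I k) then 1 else -1

/-! ### The transfer operator -/

open Classical in
/-- `L_k φ (y) = g_k φ(f_k⁻¹ y)` if `y ∈ f_k(I_k)`, and `0` otherwise. -/
def branchFun (k : Fin (d + 1)) (φ : Ioo T.a T.b → ℂ) (y : Ioo T.a T.b) : ℂ :=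
  if h : ∃ x : Ioo T.a T.b, (x : EReal) ∈ T.I k ∧ T.f k x = y then T.g k * φ h.choose else 0

/-- The image `f_k(I_k)` as a subset of `(a,b)`. -/
def J (k : Fin (d + 1)) : Set (Ioo T.a T.b) :=
  {y | ∃ x : Ioo T.a T.b, (x : EReal) ∈ T.I k ∧ T.f k x = y}

theorem branchFun_of_notMem {k : Fin (d + 1)} {y : Ioo T.a T.b} (φ : Ioo T.a T.b → ℂ)
    (hy : y ∉ T.J k) : T.branchFun k φ y = 0 := dif_neg hy

theorem branchFun_eq {k : Fin (d + 1)} {x y : Ioo T.a T.b} (φ : Ioo T.a T.b → ℂ)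
    (hx : (x : EReal) ∈ T.I k) (hxy : T.f k x = y) : T.branchFun k φ y = T.g k * φ x := by
  have h : ∃ x : Ioo T.a T.b, (x : EReal) ∈ T.I k ∧ T.f k x = y := ⟨x, hx, hxy⟩
  rw [branchFun, dif_pos h]
  have : h.choose = x :=
    Subtype.ext (T.f_injOn k h.choose_spec.1 hx (h.choose_spec.2.trans hxy.symm))
  rw [this]

theorem J_ordConnected (k : Fin (d + 1)) : (T.J k).OrdConnected := by
  refine ⟨fun y₁ h₁ y₂ h₂ y hy => ?_⟩
  obtain ⟨x₁, hx₁, e₁⟩ := h₁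
  obtain ⟨x₂, hx₂, e₂⟩ := h₂
  have hp : (T.f k '' T.I k).OrdConnected :=
    (isPreconnected_Ioo.image _ (T.f_continuousOn k)).ordConnected
  obtain ⟨x, hx, e⟩ := hp.out (x := y₁) (y := y₂) ⟨x₁, hx₁, e₁⟩ ⟨x₂, hx₂, e₂⟩
    (show (y : EReal) ∈ Icc (y₁ : EReal) y₂ from hy)
  exact ⟨⟨x, T.I_subset k hx⟩, hx, e⟩

/-- A point of `(a,b)` which is a preimage of `y ∈ J k`. -/
theorem exists_preimage (k : Fin (d + 1)) : ∃ r : Ioo T.a T.b → Ioo T.a T.b,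
    (∀ y ∈ T.J k, (r y : EReal) ∈ T.I k ∧ T.f k (r y) = y) ∧
    (MonotoneOn r (T.J k) ∨ AntitoneOn r (T.J k)) := by
  classical
  refine ⟨fun y => if h : y ∈ T.J k then Exists.choose h else y, fun y hy => ?_, ?_⟩
  · simp only [dif_pos hy]
    exact Exists.choose_spec hy
  · rcases T.f_monotone k with h | h
    · left
      intro y hy z hz hyz
      simp only [dif_pos hy, dif_pos hz]
      have s1 := Exists.choose_spec hy
      have s2 := Exists.choose_spec hz
      refine (h.le_iff_le s1.1 s2.1).1 ?_
      rw [s1.2, s2.2]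
      exact hyz
    · right
      intro y hy z hz hyz
      simp only [dif_pos hy, dif_pos hz]
      have s1 := Exists.choose_spec hy
      have s2 := Exists.choose_spec hz
      refine (h.le_iff_ge s1.1 s2.1).1 ?_
      rw [s1.2, s2.2]
      exact hyz

theorem branchFun_step_aux (k : Fin (d + 1)) (φ : Ioo T.a T.b → ℂ) (C : Set (Ioo T.a T.b))
    (hφ : ∀ x y, Disjoint (uIcc x y) C → φ x = φ y) (y₁ y₂ : Ioo T.a T.b) (h : y₁ ≤ y₂)
    (hd : Disjoint (Icc y₁ y₂) (Subtype.val ⁻¹' ({sInf (Subtype.val '' T.J k),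
      sSup (Subtype.val '' T.J k)} ∪ T.f k '' (Subtype.val '' C)))) :
    T.branchFun k φ y₁ = T.branchFun k φ y₂ := by
  rw [disjoint_left] at hd
  by_cases h₁ : y₁ ∈ T.J k <;> by_cases h₂ : y₂ ∈ T.J k
  · obtain ⟨x₁, hx₁, e₁⟩ := h₁
    obtain ⟨x₂, hx₂, e₂⟩ := h₂
    rw [T.branchFun_eq φ hx₁ e₁, T.branchFun_eq φ hx₂ e₂, hφ x₁ x₂ (disjoint_left.2 ?_)]
    intro z hz hzC
    have hzI : (z : EReal) ∈ T.I k := by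
      have : OrdConnected (T.I k) := ordConnected_Ioo
      refine this.uIcc_subset hx₁ hx₂ ?_
      rcases le_total x₁ x₂ with g | g
      · rw [uIcc_of_le g] at hz
        rw [uIcc_of_le (show (x₁ : EReal) ≤ x₂ from g)]
        exact hz
      · rw [uIcc_of_ge g] at hz
        rw [uIcc_of_ge (show (x₂ : EReal) ≤ x₁ from g)]
        exact hz
    have hfz := T.f_mem hzI
    refine hd (a := ⟨T.f k z, hfz⟩) ?_ (Or.inr ⟨z, ⟨z, hzC, rfl⟩, rfl⟩)
    have h' : (y₁ : EReal) ≤ y₂ := h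
    change (y₁ : EReal) ≤ T.f k z ∧ T.f k z ≤ (y₂ : EReal)
    rw [← e₁, ← e₂] at h' ⊢
    rcases T.f_monotone k with m | m
    · have g : x₁ ≤ x₂ := (m.le_iff_le hx₁ hx₂).1 h'
      rw [uIcc_of_le g] at hz
      exact ⟨(m.le_iff_le hx₁ hzI).2 hz.1, (m.le_iff_le hzI hx₂).2 hz.2⟩
    · have g : x₂ ≤ x₁ := (m.le_iff_ge hx₁ hx₂).1 h'
      rw [uIcc_of_ge g] at hz
      exact ⟨(m.le_iff_ge hx₁ hzI).2 hz.2, (m.le_iff_ge hzI hx₂).2 hz.1⟩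
  · exfalso
    have hB : sSup (Subtype.val '' T.J k) ≤ (y₂ : EReal) := by
      refine sSup_le ?_
      rintro _ ⟨y, hy, rfl⟩
      by_contra hlt
      exact h₂ ((T.J_ordConnected k).out h₁ hy ⟨h, (not_le.1 hlt).le⟩)
    have hA : (y₁ : EReal) ≤ sSup (Subtype.val '' T.J k) := le_sSup ⟨y₁, h₁, rfl⟩
    exact hd (a := ⟨_, y₁.2.1.trans_le hA, hB.trans_lt y₂.2.2⟩) ⟨hA, hB⟩ (Or.inl (Or.inr rfl))
  · exfalso
    have hB : (y₁ : EReal) ≤ sInf (Subtype.val '' T.J k) := by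
      refine le_sInf ?_
      rintro _ ⟨y, hy, rfl⟩
      by_contra hlt
      exact h₁ ((T.J_ordConnected k).out hy h₂ ⟨(not_le.1 hlt).le, h⟩)
    have hA : sInf (Subtype.val '' T.J k) ≤ (y₂ : EReal) := sInf_le ⟨y₂, h₂, rfl⟩
    exact hd (a := ⟨_, y₁.2.1.trans_le hB, hA.trans_lt y₂.2.2⟩) ⟨hB, hA⟩ (Or.inl (Or.inl rfl))
  · rw [T.branchFun_of_notMem φ h₁, T.branchFun_of_notMem φ h₂]

theorem branchFun_mem (k : Fin (d + 1)) (φ : Step T.a T.b) :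
    T.branchFun k φ.toFun ∈ stepSubmodule T.a T.b := by
  obtain ⟨C, hC, hφ⟩ := φ.2
  refine ⟨Subtype.val ⁻¹' ({sInf (Subtype.val '' T.J k),
      sSup (Subtype.val '' T.J k)} ∪ T.f k '' (Subtype.val '' C)), ?_, fun y₁ y₂ hd => ?_⟩
  · exact Finite.preimage Subtype.val_injective.injOn
      ((toFinite _).union ((hC.image _).image _))
  · rcases le_total y₁ y₂ with h | h
    · rw [uIcc_of_le h] at hd
      exact T.branchFun_step_aux k φ.toFun C hφ y₁ y₂ h hd
    · rw [uIcc_of_ge h] at hd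
      exact (T.branchFun_step_aux k φ.toFun C hφ y₂ y₁ h hd).symm

/-- The operator `L_k` on simple step functions. -/
def branchStep (k : Fin (d + 1)) : Step T.a T.b →ₗ[ℂ] Step T.a T.b where
  toFun φ := ⟨T.branchFun k φ.toFun, T.branchFun_mem k φ⟩
  map_add' φ ψ := by
    refine Step.ext fun y => ?_
    change T.branchFun k (φ + ψ).toFun y = T.branchFun k φ.toFun y + T.branchFun k ψ.toFun y
    unfold branchFun
    split_ifs
    · rw [Step.add_apply]; ring
    · simp
  map_smul' c φ := by
    refine Step.ext fun y => ?_
    change T.branchFun k (c • φ).toFun y = c * T.branchFun k φ.toFun y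
    unfold branchFun
    split_ifs
    · rw [Step.smul_apply]; ring
    · simp

theorem branchStep_apply (k : Fin (d + 1)) (φ : Step T.a T.b) (y : Ioo T.a T.b) :
    (T.branchStep k φ).toFun y = T.branchFun k φ.toFun y := rfl

/-- The Ruelle transfer operator `L = ∑ L_k` on simple step functions. -/
def ruelleStep : Step T.a T.b →ₗ[ℂ] Step T.a T.b := ∑ k, T.branchStep k

open Classical in
theorem eVariationOn_le_of_zero {α : Type*} [LinearOrder α] (ψ : α → ℂ) (J : Set α)
    (hJ : J.OrdConnected) (h0 : ∀ y, y ∉ J → ψ y = 0) (M : ENNReal) (hM : ∀ y, ‖ψ y‖ₑ ≤ M) :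
    eVariationOn ψ univ ≤ eVariationOn ψ J + M * 2 := by
  let p : α → ℕ := fun y => (if ∃ z ∈ J, z ≤ y then 1 else 0) + (if (∃ z ∈ J, z ≤ y) ∧ y ∉ J then 1 else 0)
  have hp : ∀ x y, x ≤ y → p x ≤ p y := by
    intro x y hxy
    refine add_le_add ?_ ?_
    · by_cases h : ∃ z ∈ J, z ≤ x
      · have h' : ∃ z ∈ J, z ≤ y := h.imp fun z hz => ⟨hz.1, hz.2.trans hxy⟩
        simp [h, h']
      · simp [h]
    · by_cases h : (∃ z ∈ J, z ≤ x) ∧ x ∉ J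
      · obtain ⟨⟨z, hz, hzx⟩, hx⟩ := h
        have h' : (∃ z ∈ J, z ≤ y) ∧ y ∉ J :=
          ⟨⟨z, hz, hzx.trans hxy⟩, fun hy => hx (hJ.out hz hy ⟨hzx, hxy⟩)⟩
        rw [if_pos h']
        split_ifs <;> simp
      · simp [h]
  have p2 : ∀ x, p x ≤ 2 := fun x => by
    simp only [p]; split_ifs <;> omega
  have hterm : ∀ x y, x ≤ y → ¬ (x ∈ J ∧ y ∈ J) →
      edist (ψ y) (ψ x) ≤ M * ((p y - p x : ℕ) : ENNReal) := by
    intro x y hxy hn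
    by_cases hx : x ∈ J
    · have hy : y ∉ J := fun hy => hn ⟨hx, hy⟩
      have e1 : p x = 1 := by
        simp only [p, hx, not_true, and_false, if_false, add_zero]
        exact if_pos ⟨x, hx, le_rfl⟩
      have e2 : p y = 2 := by
        have : ∃ z ∈ J, z ≤ y := ⟨x, hx, hxy⟩
        simp [p, this, hy]
      rw [h0 y hy, e1, e2, edist_comm, edist_zero_right]
      simpa using hM x
    · by_cases hy : y ∈ J
      · have e2 : p y = 1 := by
          simp only [p, hy, not_true, and_false, if_false, add_zero]
          exact if_pos ⟨y, hy, le_rfl⟩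
        have e1 : p x = 0 := by
          have : ¬ ∃ z ∈ J, z ≤ x := fun ⟨z, hz, hzx⟩ => hx (hJ.out hz hy ⟨hzx, hxy⟩)
          simp [p, this]
        rw [h0 x hx, e1, e2, edist_zero_right]
        simpa using hM y
      · rw [h0 x hx, h0 y hy]
        simp
  refine iSup_le ?_
  rintro ⟨n, u, hu, -⟩
  let F := (Finset.range n).filter fun i => u i ∈ J ∧ u (i + 1) ∈ J
  have h1 : ∑ i ∈ F, edist (ψ (u (i + 1))) (ψ (u i)) ≤ eVariationOn ψ J := by
    rcases F.eq_empty_or_nonempty with e | e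
    · simp [e]
    · have m1 := (Finset.mem_filter.1 (F.min'_mem e)).2
      have m2 := (Finset.mem_filter.1 (F.max'_mem e)).2
      refine le_trans (Finset.sum_le_sum_of_subset (t := Finset.Ico (F.min' e) (F.max' e + 1)) ?_)
        (eVariationOn.sum_le_of_monotoneOn_Icc (hu.monotoneOn _) ?_)
      · intro i hi
        exact Finset.mem_Ico.2 ⟨F.min'_le i hi, Nat.lt_succ_of_le (F.le_max' i hi)⟩
      · intro i hi
        exact hJ.out m1.1 m2.2 ⟨hu hi.1, hu hi.2⟩
  have h2 : ∑ i ∈ (Finset.range n).filter (fun i => ¬ (u i ∈ J ∧ u (i + 1) ∈ J)),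
      edist (ψ (u (i + 1))) (ψ (u i)) ≤ M * 2 := by
    calc _ ≤ ∑ i ∈ (Finset.range n).filter (fun i => ¬ (u i ∈ J ∧ u (i + 1) ∈ J)),
          M * ((p (u (i + 1)) - p (u i) : ℕ) : ENNReal) :=
          Finset.sum_le_sum fun i hi => hterm _ _ (hu (Nat.le_succ i)) (Finset.mem_filter.1 hi).2
      _ ≤ ∑ i ∈ Finset.range n, M * ((p (u (i + 1)) - p (u i) : ℕ) : ENNReal) :=
          Finset.sum_le_sum_of_subset (Finset.filter_subset _ _)
      _ = M * ((∑ i ∈ Finset.range n, (p (u (i + 1)) - p (u i)) : ℕ) : ENNReal) := by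
          rw [← Finset.mul_sum]; push_cast; rfl
      _ ≤ _ := by
          gcongr
          rw [Finset.sum_range_tsub (fun i j hij => hp _ _ (hu hij))]
          exact_mod_cast (Nat.sub_le _ _).trans (p2 _)
  rw [← Finset.sum_filter_add_sum_filter_not (Finset.range n) (fun i => u i ∈ J ∧ u (i + 1) ∈ J)]
  exact add_le_add h1 h2

theorem norm_branchStep_le (k : Fin (d + 1)) (φ : Step T.a T.b) :
    ‖T.branchStep k φ‖ ≤ (5 * |T.g k|) * ‖φ‖ := by
  have hsup : ∀ y, ‖T.branchFun k φ.toFun y‖ ≤ |T.g k| * ‖φ‖ := by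
    intro y
    by_cases hy : y ∈ T.J k
    · obtain ⟨x, hx, e⟩ := hy
      rw [T.branchFun_eq _ hx e, norm_mul, Complex.norm_real, Real.norm_eq_abs]
      exact mul_le_mul_of_nonneg_left (φ.norm_apply_le x) (abs_nonneg _)
    · rw [T.branchFun_of_notMem _ hy, norm_zero]
      exact mul_nonneg (abs_nonneg _) (norm_nonneg _)
  set R := |T.g k| * ‖φ‖ with hR
  have hR0 : 0 ≤ R := mul_nonneg (abs_nonneg _) (norm_nonneg _)
  have hbd : ‖boundary (T.branchStep k φ).toFun‖ ≤ 2 * R := by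
    have : Nonempty (Ioo T.a T.b) := nonempty_Ioo_subtype (Fact.out : T.a < T.b)
    obtain ⟨l, hl⟩ := (T.branchStep k φ).exists_eq_left
    obtain ⟨r, hr⟩ := (T.branchStep k φ).exists_eq_right
    obtain ⟨y, hy⟩ := hl.exists
    obtain ⟨z, hz⟩ := hr.exists
    rw [boundary, leftValue_eq hl, rightValue_eq hr, ← hy, ← hz, two_mul]
    exact (norm_add_le _ _).trans (add_le_add (hsup y) (hsup z))
  obtain ⟨r, hr, hmono⟩ := T.exists_preimage k
  have hJv : eVariationOn (T.branchFun k φ.toFun) (T.J k) ≤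
      ‖(T.g k : ℂ)‖ₑ * eVariationOn φ.toFun univ := by
    have e : EqOn (T.branchFun k φ.toFun) ((fun x => (T.g k : ℂ) * φ.toFun x) ∘ r) (T.J k) :=
      fun y hy => T.branchFun_eq _ (hr y hy).1 (hr y hy).2
    rw [eVariationOn.eq_of_eqOn e, ← eVariationOn_mul]
    rcases hmono with m | m
    · exact eVariationOn.comp_le_of_monotoneOn _ _ m (mapsTo_univ _ _)
    · exact eVariationOn.comp_le_of_antitoneOn _ _ m (mapsTo_univ _ _)
  have hv : eVariationOn (T.branchStep k φ).toFun univ ≤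
      ‖(T.g k : ℂ)‖ₑ * eVariationOn φ.toFun univ + ENNReal.ofReal R * 2 := by
    refine (eVariationOn_le_of_zero _ (T.J k) (T.J_ordConnected k)
      (fun y hy => T.branchFun_of_notMem _ hy) (ENNReal.ofReal R) fun y => ?_).trans
      (add_le_add hJv le_rfl)
    rw [← ofReal_norm]
    exact ENNReal.ofReal_le_ofReal (hsup y)
  have hv' : (eVariationOn (T.branchStep k φ).toFun univ).toReal ≤
      |T.g k| * (eVariationOn φ.toFun univ).toReal + R * 2 := by
    have n1 : ‖(T.g k : ℂ)‖ₑ * eVariationOn φ.toFun univ ≠ ⊤ :=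
      ENNReal.mul_ne_top enorm_ne_top φ.boundedVariation
    have n2 : ENNReal.ofReal R * 2 ≠ ⊤ := ENNReal.mul_ne_top ENNReal.ofReal_ne_top (by simp)
    refine (ENNReal.toReal_mono (ENNReal.add_ne_top.2 ⟨n1, n2⟩) hv).trans (le_of_eq ?_)
    rw [ENNReal.toReal_add n1 n2, ENNReal.toReal_mul, ENNReal.toReal_mul, toReal_enorm,
      ENNReal.toReal_ofReal hR0, Complex.norm_real, Real.norm_eq_abs]
    simp
  have hvR : |T.g k| * (eVariationOn φ.toFun univ).toReal ≤ R := by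
    refine mul_le_mul_of_nonneg_left ?_ (abs_nonneg _)
    rw [Step.norm_def]
    linarith [norm_nonneg (boundary φ.toFun)]
  have : (5 * |T.g k|) * ‖φ‖ = 5 * R := by rw [hR]; ring
  rw [this, Step.norm_def]
  linarith

theorem exists_bound : ∃ C, ∀ φ, ‖T.ruelleStep φ‖ ≤ C * ‖φ‖ := by
  refine ⟨∑ k, 5 * |T.g k|, fun φ => ?_⟩
  rw [ruelleStep, LinearMap.sum_apply, Finset.sum_mul]
  exact (norm_sum_le _ _).trans (Finset.sum_le_sum fun k _ => T.norm_branchStep_le k φ)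

/-- The Ruelle transfer operator `L = ∑ L_k` acting on `SBV(a,b)`: the continuous extension of
its action on simple step functions. -/
def ruelle : SBV T.a T.b →L[ℂ] SBV T.a T.b :=
  (T.ruelleStep.mkContinuousOfExistsBound T.exists_bound).completion

theorem ruelle_coe (φ : Step T.a T.b) :
    T.ruelle (φ : SBV T.a T.b) = (T.ruelleStep φ : Step T.a T.b) :=
  ContinuousLinearMap.completion_apply_coe _ φ

/-- The spectral radius `ρ_sp(L)` of `L` acting on `SBV(a,b)`. -/
def spRadius : ℝ := (spectralRadius ℂ T.ruelle).toReal

/-- `‖Lⁿ 1‖_∞`, the supremum of the absolute value of the step function `Lⁿ 1` over `(a,b)`. -/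
def supNormIterOne (n : ℕ) : ℝ := ⨆ y : Ioo T.a T.b, ‖((T.ruelleStep ^ n) (Step.one T.a T.b)) y‖

/-! ### Dynamics on point germs -/

/-- `x̂ ∈ [c_k⁺, c_{k+1}⁻]`. -/
def GermMem (k : Fin (d + 1)) : Germ T.a T.b → Prop
  | .plus x _ => x ∈ Ico (T.c k.castSucc) (T.c k.succ)
  | .minus x _ => x ∈ Ioc (T.c k.castSucc) (T.c k.succ)

theorem exists_germMem (x : Germ T.a T.b) : ∃ k, T.GermMem k x := by
  rcases x with ⟨x, hx⟩ | ⟨x, hx⟩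
  · by_contra! h
    have : ∀ j, T.c j ≤ x := fun j =>
      Fin.induction hx.1 (fun k hk => not_lt.1 fun hlt => h k ⟨hk, hlt⟩) j
    exact absurd (this (Fin.last _)) (not_le.2 hx.2)
  · by_contra! h
    have : ∀ j, T.c j < x := fun j =>
      Fin.induction hx.1 (fun k hk => not_le.1 fun hlt => h k ⟨hk, hlt⟩) j
    exact absurd (this (Fin.last _)) (not_lt.2 hx.2)

/-- The (unique) index `k` with `x̂ ∈ [c_k⁺, c_{k+1}⁻]`. -/
def idx (x : Germ T.a T.b) : Fin (d + 1) := (T.exists_germMem x).choose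

theorem idx_spec (x : Germ T.a T.b) : T.GermMem (T.idx x) x := (T.exists_germMem x).choose_spec

theorem antiOn {k : Fin (d + 1)} (h : ¬ StrictMonoOn (T.f k) (T.I k)) :
    StrictAntiOn (T.f k) (T.I k) := (T.f_monotone k).resolve_left h

theorem Ioo_right {x : EReal} {hx : x ∈ Ico T.a T.b} :
    x < T.c (T.idx (.plus x hx)).succ ∧
      Ioo x (T.c (T.idx (.plus x hx)).succ) ⊆ T.I (T.idx (.plus x hx)) :=
  have h : x ∈ Ico _ _ := T.idx_spec (.plus x hx)
  ⟨h.2, Ioo_subset_Ioo_left h.1⟩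

theorem Ioo_left {x : EReal} {hx : x ∈ Ioc T.a T.b} :
    T.c (T.idx (.minus x hx)).castSucc < x ∧
      Ioo (T.c (T.idx (.minus x hx)).castSucc) x ⊆ T.I (T.idx (.minus x hx)) :=
  have h : x ∈ Ioc _ _ := T.idx_spec (.minus x hx)
  ⟨h.1, Ioo_subset_Ioo_right h.2⟩

open Classical in
/-- The map `f̂` on point germs: `f̂(u^ε) = (f_k(u^ε))^{s_k ε}` for `u^ε ∈ [c_k⁺, c_{k+1}⁻]`,
where `f_k(u^ε)` is the one-sided limit of `f_k` at `u`. -/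
def fHat : Germ T.a T.b → Germ T.a T.b
  | .plus x hx =>
    if h : StrictMonoOn (T.f (T.idx (.plus x hx))) (T.I (T.idx (.plus x hx))) then
      .plus (limUnder (𝓝[>] x) (T.f (T.idx (.plus x hx))))
        (limUnder_right_mem_of_monotoneOn T.Ioo_right.1 (h.monotoneOn.mono T.Ioo_right.2)
          fun _ hy => T.f_mem (T.Ioo_right.2 hy))
    else
      .minus (limUnder (𝓝[>] x) (T.f (T.idx (.plus x hx))))
        (limUnder_right_mem_of_antitoneOn T.Ioo_right.1 ((T.antiOn h).antitoneOn.mono T.Ioo_right.2)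
          fun _ hy => T.f_mem (T.Ioo_right.2 hy))
  | .minus x hx =>
    if h : StrictMonoOn (T.f (T.idx (.minus x hx))) (T.I (T.idx (.minus x hx))) then
      .minus (limUnder (𝓝[<] x) (T.f (T.idx (.minus x hx))))
        (limUnder_left_mem_of_monotoneOn T.Ioo_left.1 (h.monotoneOn.mono T.Ioo_left.2)
          fun _ hy => T.f_mem (T.Ioo_left.2 hy))
    else
      .plus (limUnder (𝓝[<] x) (T.f (T.idx (.minus x hx))))
        (limUnder_left_mem_of_antitoneOn T.Ioo_left.1 ((T.antiOn h).antitoneOn.mono T.Ioo_left.2)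
          fun _ hy => T.f_mem (T.Ioo_left.2 hy))

/-- `g^{(n)}(x̂) = g(f̂^{n-1} x̂) ⋯ g(x̂)`. -/
def gProd (n : ℕ) (x : Germ T.a T.b) : ℝ := ∏ i ∈ Finset.range n, T.g (T.idx (T.fHat^[i] x))

/-- `(s g)^{(n)}(x̂)`. -/
def sgProd (n : ℕ) (x : Germ T.a T.b) : ℝ :=
  ∏ i ∈ Finset.range n, T.s (T.idx (T.fHat^[i] x)) * T.g (T.idx (T.fHat^[i] x))

/-- `‖g^{(n)}‖_∞`, the supremum over all point germs. -/
def gSup (n : ℕ) : ℝ := ⨆ x : Germ T.a T.b, |T.gProd n x|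

/-- `ρ_∞ = lim_n ‖g^{(n)}‖_∞^{1/n}`. -/
def rhoInf : ℝ := limUnder atTop fun n : ℕ => T.gSup n ^ (1 / (n : ℝ))

/-! ### The Milnor–Thurston determinant -/

/-- The germ `c_k⁺`, left end of `I_k`. -/
def cPlus (k : Fin (d + 1)) : Germ T.a T.b :=
  .plus (T.c k.castSucc) ⟨T.a_le _, T.c_strictMono (Fin.castSucc_lt_last k)⟩

/-- The germ `c_{k+1}⁻`, right end of `I_k`. -/
def cMinus (k : Fin (d + 1)) : Germ T.a T.b :=
  .minus (T.c k.succ) ⟨T.c_strictMono (Fin.succ_pos k), T.le_b _⟩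

open Classical in
/-- `σ_{c_k}(x̂)`, equal to `1/2` if `c_k < x̂` and to `-1/2` otherwise. -/
def sigma (k : Fin (d + 1)) (x : Germ T.a T.b) : ℂ :=
  if x.Above (T.c k.castSucc) then 1 / 2 else -1 / 2

/-- The `n`-th term of the series of the kneading coordinate. -/
def thetaTerm (k : Fin (d + 1)) (x : Germ T.a T.b) (t : ℂ) (n : ℕ) : ℂ :=
  t ^ n * (T.sgProd n x : ℂ) * T.sigma k (T.fHat^[n] x)

/-- The kneading coordinate
`Θ_{c_k}(x̂, t) = ∑_{n ≥ 0} tⁿ (s g)^{(n)}(x̂) σ_{c_k}(f̂ⁿ x̂)`. -/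
def theta (k : Fin (d + 1)) (t : ℂ) (x : Germ T.a T.b) : ℂ := ∑' n, T.thetaTerm k x t n

/-- `Δ_{c_0} H = H(a⁺) + H(b⁻)` and `Δ_{c_j} H = H(c_j⁺) - H(c_j⁻)` for `1 ≤ j ≤ d`. -/
def delta (H : Germ T.a T.b → ℂ) : Fin (d + 1) → ℂ :=
  Fin.cases (H (T.cPlus 0) + H (T.cMinus (Fin.last d)))
    fun i : Fin d => H (T.cPlus i.succ) - H (T.cMinus i.castSucc)

/-- The kneading matrix `M_{jk}(t) = Δ_{c_j} Θ_{c_k}(·, t)`. -/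
def kneadingMatrix (t : ℂ) : Matrix (Fin (d + 1)) (Fin (d + 1)) ℂ :=
  Matrix.of fun j k => T.delta (T.theta k t) j

/-- The Milnor–Thurston determinant `d_MT(t) = det M(t)`. -/
def dMT (t : ℂ) : ℂ := (T.kneadingMatrix t).det

/-! ### Monotonicity intervals, partition function, topological entropy -/

/-- The cylinder set of a word `k₀ k₁ ⋯ k_{n-1}`: the set of all `x ∈ (a,b)` with
`x ∈ I_{k₀}`, `f_{k₀}(x) ∈ I_{k₁}`, and so on. -/
def cylinder : List (Fin (d + 1)) → Set EReal
  | [] => Ioo T.a T.b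
  | k :: w => T.I k ∩ T.f k ⁻¹' cylinder w

/-- The words of length `n` with a non-empty cylinder. As cylinders of distinct words of the
same length are disjoint, these words index the collection `Z_n` of monotonicity intervals
of `fⁿ`. -/
def Z (n : ℕ) : Set (Fin n → Fin (d + 1)) := {w | (T.cylinder (List.ofFn w)).Nonempty}

open Classical in
/-- The partition function `Ω_n = ∑_{α ∈ Z_n} g^{(n)}|_α`. -/
def Omega (n : ℕ) : ℝ := ∑ w : Fin n → Fin (d + 1) with w ∈ T.Z n, ∏ i, T.g (w i)

/-- The topological entropy `h_top = log lim_n (#Z_n)^{1/n}`. -/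
def topEntropy : ℝ :=
  Real.log (limUnder atTop fun n : ℕ => ((T.Z n).ncard : ℝ) ^ (1 / (n : ℝ)))

end System

end Kneading

end

noncomputable section

namespace Kneading

/-! ### Growth rates and Gelfand's formula -/

/-! The transfer operator is compared with a weighted shift on germs. A step function is determined
by its jumps at germs, its boundary value being counted as the jump at `a⁺`. So `jumps` embeds `SBV`
in `ℓ¹` of the germs, and its left inverse `synth` sends the unit vector of a germ to the `±1/2`
step at that germ. On `f_k(I_k)` the branch `f_k` carries the step at `x̂` to `s_k` times the step
at `f̂ x̂`. Hence `L` acts on jumps like the shift `N : δ_x ↦ (s g)(x) δ_{f̂ x}` (`shift`), up to a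
defect that depends only on the lap containing the germ. Since `‖Nⁿ‖ = ‖g^{(n)}‖_∞`, the spectral
radius of `N` is `ρ_∞`.

The defect vanishes where all `d + 1` functionals `σ_{c_k}` vanish (`ruelle_synth_eq`), and `L`
kills the steps built from the dual vectors `D_j` that represent the cuts at `c_j`
(`ruelle_synth_cut`). With the projection `P = ∑ σ_k ⊗ D_k` this gives `L = synth ∘ N (1 - P) ∘
jumps` (`factorization`). If `|t| ρ_∞ < 1` and `R = (1 - t N)⁻¹`, then `1 - t N (1 - P) = (1 - t
N)(1 + (R - 1) P)`. The last factor is a finite rank perturbation of `1` whose determinant is that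
of `σ_k (R D_j)`, and the Neumann series identifies this matrix with the kneading matrix
(`kneadingMatrix_eq`). So `d_MT(t) (1 - t L)⁻¹` is analytic on the disk: a zero `t` of `d_MT` yields
an isolated eigenvalue `1/t` of finite multiplicity, and elsewhere `1 - t L` is invertible.

For the growth rates, `Lⁿ 1 (y)` is the sum of `g^{(n)}` over the cylinders whose image contains
`y`, and `‖Lⁿ‖ ≤ 5 Ω_n`. Each image is an interval between two germs from the first `n` iterates of
the critical germs, so `O(n²)` points meet all images and `Ω_n ≤ O(n²) ‖Lⁿ 1‖_∞ ≤ O(n²) ‖Lⁿ‖`.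
Gelfand's formula then gives all the limits.

Finally `L` preserves positivity and `‖Lⁿ 1‖_∞` grows like `ρ_sp(L)ⁿ`, which forces `ρ_sp(L)` into
the spectrum (`spectralRadius_mem_spectrum`). If it exceeds `ρ_∞`, its inverse lies in the disk and
must be a zero of `d_MT`. A smaller zero would give an eigenvalue beyond the spectral radius. -/

theorem tendsto_norm_pow_rpow {A : Type*} [NormedRing A] [NormedAlgebra ℂ A] [CompleteSpace A]
    [NormOneClass A] (a : A) :
    Tendsto (fun n : ℕ => ‖a ^ n‖ ^ (1 / (n : ℝ))) atTop (𝓝 (spectralRadius ℂ a).toReal) := by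
  have h := spectrum.pow_norm_pow_one_div_tendsto_nhds_spectralRadius a
  have hne : spectralRadius ℂ a ≠ ⊤ :=
    ne_top_of_le_ne_top ENNReal.coe_ne_top (spectrum.spectralRadius_le_nnnorm a)
  refine ((ENNReal.tendsto_toReal hne).comp h).congr fun n => ?_
  exact ENNReal.toReal_ofReal (by positivity)

theorem tendsto_const_rpow_one_div {C : ℝ} (hC : 0 < C) :
    Tendsto (fun n : ℕ => C ^ (1 / (n : ℝ))) atTop (𝓝 1) := by
  have h : Tendsto (fun n : ℕ => 1 / (n : ℝ)) atTop (𝓝 0) := tendsto_one_div_atTop_nhds_zero_nat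
  have := (Real.continuousAt_const_rpow hC.ne' (b := 0)).tendsto.comp h
  rwa [Real.rpow_zero] at this

theorem tendsto_poly_rpow_one_div {C : ℝ} (hC : 0 < C) :
    Tendsto (fun n : ℕ => (C * ((n : ℝ) + 1) ^ 2) ^ (1 / (n : ℝ))) atTop (𝓝 1) := by
  have h1 : Tendsto (fun n : ℕ => ((n : ℝ)) ^ (1 / (n : ℝ))) atTop (𝓝 1) :=
    tendsto_rpow_div.comp tendsto_natCast_atTop_atTop
  -- The upper bound uses `(n + 1)² ≤ 4 n²` for `n ≥ 1`, which reduces the claim to `n^{1/n} → 1`.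
  have h2 := (tendsto_const_rpow_one_div (C := C * 4) (by positivity)).mul (h1.pow 2)
  simp only [one_pow, mul_one] at h2
  refine tendsto_of_tendsto_of_tendsto_of_le_of_le' (tendsto_const_rpow_one_div hC) h2 ?_ ?_
  · filter_upwards with n
    refine Real.rpow_le_rpow hC.le ?_ (by positivity)
    have : (0:ℝ) ≤ n := n.cast_nonneg
    nlinarith [mul_nonneg hC.le this, mul_nonneg hC.le (sq_nonneg (n:ℝ))]
  · filter_upwards [eventually_ge_atTop 1] with n hn
    have hn' : (1:ℝ) ≤ n := by exact_mod_cast hn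
    have e : ((n:ℝ) ^ (1 / (n:ℝ))) ^ 2 = ((n:ℝ) ^ 2) ^ (1 / (n:ℝ)) := by
      rw [← Real.rpow_natCast, ← Real.rpow_mul (by positivity), mul_comm, Real.rpow_mul (by positivity),
        Real.rpow_natCast]
    rw [e, ← Real.mul_rpow (by positivity) (by positivity)]
    refine Real.rpow_le_rpow (by positivity) ?_ (by positivity)
    have : ((n:ℝ) + 1) ^ 2 ≤ 4 * n ^ 2 := by nlinarith
    nlinarith

/-- Two nonnegative sequences that agree up to polynomial factors have the same growth rate. -/
theorem tendsto_rpow_of_comparable {u v : ℕ → ℝ} {ρ C : ℝ} (hC : 0 < C) (hu : ∀ n, 0 ≤ u n)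
    (hv : ∀ n, 0 ≤ v n) (h1 : ∀ n, v n ≤ C * ((n : ℝ) + 1) ^ 2 * u n)
    (h2 : ∀ n, u n ≤ C * ((n : ℝ) + 1) ^ 2 * v n)
    (h : Tendsto (fun n : ℕ => u n ^ (1 / (n : ℝ))) atTop (𝓝 ρ)) :
    Tendsto (fun n : ℕ => v n ^ (1 / (n : ℝ))) atTop (𝓝 ρ) := by
  have hp := tendsto_poly_rpow_one_div hC
  have a1 := h.div hp one_ne_zero
  have a2 := hp.mul h
  rw [div_one] at a1
  rw [one_mul] at a2
  refine tendsto_of_tendsto_of_tendsto_of_le_of_le a1 a2 (fun n => ?_) fun n => ?_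
  · have : 0 < C * ((n:ℝ) + 1) ^ 2 := by positivity
    change u n ^ (1 / (n:ℝ)) / _ ≤ _
    rw [div_le_iff₀ (Real.rpow_pos_of_pos this _), mul_comm, ← Real.mul_rpow this.le (hv n)]
    exact Real.rpow_le_rpow (hu n) (h2 n) (by positivity)
  · have : 0 < C * ((n:ℝ) + 1) ^ 2 := by positivity
    rw [← Real.mul_rpow this.le (hu n)]
    exact Real.rpow_le_rpow (hv n) (h1 n) (by positivity)

/-- The Neumann series of `t • a` converges absolutely inside the disk of radius `1 / ρ(a)`. -/
theorem summable_norm_smul_pow {A : Type*} [NormedRing A] [NormedAlgebra ℂ A] [CompleteSpace A]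
    [NormOneClass A] (a : A) {t : ℂ} (ht : ‖t‖ * (spectralRadius ℂ a).toReal < 1) :
    Summable fun n : ℕ => ‖(t • a) ^ n‖ := by
  obtain ⟨r, hr, hr1⟩ := exists_between ht
  have hr0 : 0 ≤ r := le_trans (by positivity) hr.le
  have h := (tendsto_norm_pow_rpow a).const_mul ‖t‖
  refine Summable.of_norm_bounded_eventually_nat (summable_geometric_of_lt_one hr0 hr1) ?_
  filter_upwards [h.eventually (gt_mem_nhds hr), eventually_gt_atTop 0] with n hn h0
  have h0' : (n:ℝ) ≠ 0 := by exact_mod_cast h0.ne'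
  rw [norm_norm, smul_pow, norm_smul, norm_pow]
  calc ‖t‖ ^ n * ‖a ^ n‖ = (‖t‖ * ‖a ^ n‖ ^ (1 / (n:ℝ))) ^ n := by
        rw [mul_pow, ← Real.rpow_natCast (‖a ^ n‖ ^ _), ← Real.rpow_mul (norm_nonneg _),
          one_div_mul_cancel h0', Real.rpow_one]
    _ ≤ r ^ n := pow_le_pow_left₀ (by positivity) hn.le n

/-- Convergence is governed by the spectral radius, not by the norm, so for the shift the domain is
exactly `|t| ρ_∞ < 1`. The series itself is needed too: it yields the kneading series and the
positivity of the resolvent. -/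
theorem isUnit_one_sub_smul {A : Type*} [NormedRing A] [NormedAlgebra ℂ A] [CompleteSpace A]
    [NormOneClass A] (a : A) {t : ℂ} (ht : ‖t‖ * (spectralRadius ℂ a).toReal < 1) :
    IsUnit (1 - t • a) ∧ HasSum (fun n : ℕ => (t • a) ^ n) (Ring.inverse (1 - t • a)) := by
  have hs := (summable_norm_smul_pow a ht).of_norm
  have l : (1 - t • a) * ∑' n : ℕ, (t • a) ^ n = 1 := by
    have e := hs.tsum_eq_zero_add
    rw [sub_mul, one_mul, ← hs.tsum_mul_left, e]
    simp [pow_succ']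
  have r : (∑' n : ℕ, (t • a) ^ n) * (1 - t • a) = 1 := by
    have e := hs.tsum_eq_zero_add
    rw [mul_sub, mul_one, ← hs.tsum_mul_right, e]
    simp [pow_succ]
  have hu : IsUnit (1 - t • a) := ⟨⟨_, _, l, r⟩, rfl⟩
  refine ⟨hu, ?_⟩
  have : Ring.inverse (1 - t • a) = ∑' n : ℕ, (t • a) ^ n := by
    have := congrArg (Ring.inverse (1 - t • a) * ·) l
    simp only [← mul_assoc, Ring.inverse_mul_cancel _ hu, one_mul, mul_one] at this
    exact this.symm
  rw [this]
  exact hs.hasSum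

/-! ### Isolated eigenvalues -/

section Isolated

variable {E : Type*} [NormedAddCommGroup E] [NormedSpace ℂ E]

/-- Coefficient extraction: if `((w - z) - A) G(w) = (w - z)^p - B` near `z`, with `G` analytic and
commuting with `A`, then suitable `V`, `Q` commuting with `A` satisfy `V - A Q = 1` and
`A^(m+p) V = 0`, when `A^m B = 0`. -/
theorem exists_coeff_of_analytic [CompleteSpace E] (A : E →L[ℂ] E) (z : ℂ) (p : ℕ) :
    ∀ (m : ℕ) (B : E →L[ℂ] E) (G : ℂ → E →L[ℂ] E), AnalyticAt ℂ G z →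
      (∀ᶠ w in 𝓝 z, Commute A (G w)) → A ^ m * B = 0 → Commute A B →
      (∀ᶠ w in 𝓝 z, ((w - z) • 1 - A) * G w = (w - z) ^ p • 1 - B) →
      ∃ V Q : E →L[ℂ] E, Commute A V ∧ Commute A Q ∧ V - A * Q = 1 ∧ A ^ (m + p) * V = 0 := by
  induction p with
  | zero =>
    intro m B G hG hc hB hcB h
    refine ⟨B, G z, hcB, hc.self_of_nhds, ?_, hB⟩
    have := h.self_of_nhds
    simp only [sub_self, zero_smul, zero_sub, neg_mul, pow_zero, one_smul] at this
    rw [eq_sub_iff_add_eq] at this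
    rwa [sub_eq_neg_add]
  | succ p ih =>
    intro m B G hG hc hB hcB h
    -- Setting `w = z` identifies `B`. Then `G - G(z)` can be divided by `w - z`, and the quotient
    -- `dslope G z` solves the same equation with exponent `p`, with `G(z)` in the role of `B`, and
    -- with `A^(m+1) G(z) = A^m B = 0`. At exponent zero the equation reads `B - A G(z) = 1`, which
    -- is the desired pair.
    have h0 : A * G z = B := by
      have := h.self_of_nhds
      simpa using this
    have hc0 : Commute A (G z) := hc.self_of_nhds
    have hG' : AnalyticAt ℂ (dslope G z) z := by
      obtain ⟨q, hq⟩ := hG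
      exact ⟨_, hq.has_fpower_series_dslope_fslope⟩
    have hcont : ContinuousAt (dslope G z) z := hG'.continuousAt
    have hpun : ∀ᶠ w in 𝓝[≠] z, Commute A (dslope G z w) ∧
        ((w - z) • 1 - A) * dslope G z w = (w - z) ^ p • 1 - G z := by
      filter_upwards [hc.filter_mono nhdsWithin_le_nhds, h.filter_mono nhdsWithin_le_nhds,
        self_mem_nhdsWithin] with w hw1 hw2 hw3
      have hne : w - z ≠ 0 := sub_ne_zero.2 hw3
      rw [dslope_of_ne _ hw3, slope_def_module]
      refine ⟨(hw1.sub_right hc0).smul_right _, ?_⟩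
      have e : ((w - z) • (1 : E →L[ℂ] E) - A) * (G w - G z) =
          (w - z) • ((w - z) ^ p • 1 - G z) := by
        rw [mul_sub, hw2, sub_mul, h0, smul_mul_assoc, one_mul, smul_sub, smul_smul, ← pow_succ']
        abel
      rw [mul_smul_comm, e, smul_smul, inv_mul_cancel₀ hne, one_smul]
    -- At `w = z` itself division is impossible; commutation and the equation extend there by
    -- continuity.
    have hcomm : Commute A (dslope G z z) := by
      have l1 : Tendsto (fun w => A * dslope G z w) (𝓝[≠] z) (𝓝 (A * dslope G z z)) :=
        (hcont.tendsto.mono_left nhdsWithin_le_nhds).const_mul A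
      have l2 : Tendsto (fun w => dslope G z w * A) (𝓝[≠] z) (𝓝 (dslope G z z * A)) :=
        (hcont.tendsto.mono_left nhdsWithin_le_nhds).mul_const A
      exact tendsto_nhds_unique (l1.congr' (hpun.mono fun w hw => hw.1.eq)) l2
    have heq : ((z - z) • 1 - A) * dslope G z z = (z - z) ^ p • 1 - G z := by
      have l1 : Tendsto (fun w => ((w - z) • 1 - A) * dslope G z w) (𝓝[≠] z)
          (𝓝 (((z - z) • 1 - A) * dslope G z z)) := by
        have : ContinuousAt (fun w => ((w - z) • 1 - A) * dslope G z w) z := by fun_prop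
        exact this.tendsto.mono_left nhdsWithin_le_nhds
      have l2 : Tendsto (fun w => (w - z) ^ p • (1 : E →L[ℂ] E) - G z) (𝓝[≠] z)
          (𝓝 ((z - z) ^ p • 1 - G z)) := by
        have : ContinuousAt (fun w => (w - z) ^ p • (1 : E →L[ℂ] E) - G z) z := by fun_prop
        exact this.tendsto.mono_left nhdsWithin_le_nhds
      exact tendsto_nhds_unique (l1.congr' (hpun.mono fun w hw => hw.2)) l2
    rw [eventually_nhdsWithin_iff] at hpun
    obtain ⟨V, Q, c1, c2, e1, e2⟩ := ih (m + 1) (G z) (dslope G z) hG'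
      (hpun.mono fun w hw => by
        rcases eq_or_ne w z with rfl | hne
        · exact hcomm
        · exact (hw hne).1)
      (by rw [pow_succ, mul_assoc, h0, hB]) hc0
      (hpun.mono fun w hw => by
        rcases eq_or_ne w z with rfl | hne
        · exact heq
        · exact (hw hne).2)
    exact ⟨V, Q, c1, c2, e1, by rw [show m + (p + 1) = m + 1 + p by ring]; exact e2⟩

/-- `A` maps `ker A^(n+1)` into `ker A^n`, with kernel inside `ker A`, so dimensions add up to
something finite. -/
theorem finiteDimensional_ker_pow {E : Type*} [AddCommGroup E] [Module ℂ E] (A : Module.End ℂ E)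
    (h : FiniteDimensional ℂ (LinearMap.ker A)) (n : ℕ) :
    FiniteDimensional ℂ (LinearMap.ker (A ^ n)) := by
  induction n with
  | zero => rw [pow_zero, Module.End.one_eq_id, LinearMap.ker_id]; infer_instance
  | succ n ih =>
    let φ : LinearMap.ker (A ^ (n + 1)) →ₗ[ℂ] LinearMap.ker (A ^ n) :=
      A.restrict fun x hx => by
        rw [LinearMap.mem_ker] at hx ⊢
        rw [pow_succ] at hx; exact hx
    have h1 : FiniteDimensional ℂ (LinearMap.range φ) := inferInstance
    have h2 : FiniteDimensional ℂ (LinearMap.ker φ) := by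
      let ψ : LinearMap.ker φ →ₗ[ℂ] LinearMap.ker A :=
        { toFun := fun x => ⟨x.1.1, congrArg Subtype.val x.2⟩
          map_add' := fun _ _ => rfl
          map_smul' := fun _ _ => rfl }
      exact FiniteDimensional.of_injective ψ fun x y hxy =>
        Subtype.ext (Subtype.ext (congrArg (fun v : LinearMap.ker A => v.1) hxy))
    refine Module.Finite.of_exact (f := (LinearMap.ker φ).subtype) (g := φ.rangeRestrict)
      (fun x => ?_) φ.surjective_rangeRestrict
    rw [Subtype.ext_iff]
    exact ⟨fun h => ⟨⟨x, h⟩, rfl⟩, by rintro ⟨y, rfl⟩; exact y.2⟩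

/-- The hypotheses say that the resolvent is `G(w) / (w - z)^p` near `z`. The relations `V - A Q =
1` and `A^p V = 0` extracted from `G` act as a Bézout identity and split `E` into `ker A^p` and `ran
A^p`. -/
theorem isIsolatedEigenvalue_of_meromorphic [CompleteSpace E] (L : E →L[ℂ] E) (z : ℂ) (p : ℕ)
    (G : ℂ → E →L[ℂ] E) (hG : AnalyticAt ℂ G z)
    (hr : ∀ᶠ w in 𝓝 z, (w • 1 - L) * G w = (w - z) ^ p • 1)
    (hl : ∀ᶠ w in 𝓝 z, G w * (w • 1 - L) = (w - z) ^ p • 1)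
    (hfin : FiniteDimensional ℂ (LinearMap.ker ((L - z • 1 : E →L[ℂ] E) : Module.End ℂ E)))
    (hev : Module.End.HasEigenvalue (L : Module.End ℂ E) z) :
    IsIsolatedEigenvalueOfFiniteMultiplicity L z := by
  set A : E →L[ℂ] E := L - z • 1 with hA
  have key : ∀ w : ℂ, w • 1 - L = (w - z) • 1 - A := fun w => by rw [hA, sub_smul]; abel
  have hcomm : ∀ᶠ w in 𝓝 z, Commute A (G w) := by
    filter_upwards [hr, hl] with w h1 h2
    have : (w • 1 - L) * G w = G w * (w • 1 - L) := h1.trans h2.symm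
    rw [key w, sub_mul, mul_sub, smul_mul_assoc, mul_smul_comm, one_mul, mul_one] at this
    exact sub_right_injective this
  obtain ⟨V, Q, cV, cQ, e1, e2⟩ := exists_coeff_of_analytic A z p 0 0 G hG hcomm (by simp)
    (Commute.zero_right A) (by filter_upwards [hr] with w hw; rw [← key w, hw, sub_zero])
  rw [zero_add] at e2
  have id1 : ∀ x, V x - A (Q x) = x := fun x => DFunLike.congr_fun e1 x
  have hAV : ∀ x, (A ^ p) (V x) = 0 := fun x => DFunLike.congr_fun e2 x
  have hAQ : ∀ x, A (Q x) = Q (A x) := fun x => DFunLike.congr_fun cQ.eq x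
  -- Applying `A^p` to `x = V x - A Q x` leaves `A^p x = -Q A^p A x`, so the kernels of the powers
  -- of `A` stop growing at exponent `p`.
  have kstep : ∀ x, (A ^ p) (A x) = 0 → (A ^ p) x = 0 := by
    intro x hx
    rw [← id1 x, map_sub, hAV, hAQ, zero_sub, neg_eq_zero]
    have : (A ^ p) (Q (A x)) = Q ((A ^ p) (A x)) :=
      DFunLike.congr_fun (cQ.pow_left p).eq (A x)
    rw [this, hx, map_zero]
  have kpow : ∀ n x, (A ^ (n + p)) x = 0 → (A ^ p) x = 0 := by
    intro n
    induction n with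
    | zero => intro x hx; rwa [zero_add] at hx
    | succ n ih =>
      intro x hx
      refine kstep x (ih (A x) ?_)
      rw [show n + 1 + p = n + p + 1 by ring, pow_succ] at hx
      exact hx
  have hgen : Module.End.maxGenEigenspace (L : Module.End ℂ E) z =
      LinearMap.ker ((A ^ p : E →L[ℂ] E) : Module.End ℂ E) := by
    have hc : ∀ n : ℕ, ((L : Module.End ℂ E) - z • 1) ^ n = ((A ^ n : E →L[ℂ] E) : Module.End ℂ E) :=
      fun n => by
        induction n with
        | zero => rfl
        | succ n ih => rw [pow_succ, pow_succ, ih]; rfl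
    ext x
    rw [Module.End.mem_maxGenEigenspace, LinearMap.mem_ker]
    constructor
    · rintro ⟨k, hk⟩
      rw [hc] at hk
      refine kpow k x ?_
      rw [add_comm, pow_add]
      change (A ^ p) ((A ^ k) x) = 0
      rw [show (A ^ k) x = 0 from hk, map_zero]
    · intro hx
      exact ⟨p, by rw [hc]; exact hx⟩
  -- the complementary projection
  set S : E →L[ℂ] E := (-(A * Q)) ^ p with hS
  have hS1 : S = A ^ p * (-Q) ^ p := by
    rw [hS, ← mul_neg, (cQ.neg_right).mul_pow]
  -- A geometric sum: since `V = 1 - (-(A Q))`, the operator `1 - S` factors through `V` and lands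
  -- in `ker A^p`, while `S` lands in `ran A^p`. Consequently `ran A^p = ker (1 - S)` is closed.
  have hVS : 1 - S = V * ∑ i ∈ Finset.range p, (-(A * Q)) ^ i := by
    have : V = 1 - (-(A * Q)) := by rw [← e1]; abel
    rw [this, hS, mul_neg_geom_sum]
  have hker : ∀ x, (A ^ p) (x - S x) = 0 := by
    intro x
    have : x - S x = V ((∑ i ∈ Finset.range p, (-(A * Q)) ^ i) x) := DFunLike.congr_fun hVS x
    rw [this, hAV]
  have disj : ∀ x y, x = (A ^ p) y → (A ^ p) x = 0 → x = 0 := by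
    rintro x y rfl h
    refine kpow p y ?_
    rw [pow_add]
    exact h
  have hSr : ∀ x, ∃ y, S x = (A ^ p) y := fun x => ⟨((-Q) ^ p) x, by rw [hS1]; rfl⟩
  have hran : ∀ x, x - S x = 0 ↔ ∃ y, x = (A ^ p) y := by
    intro x
    constructor
    · intro h
      obtain ⟨y, hy⟩ := hSr x
      exact ⟨y, (sub_eq_zero.1 h).trans hy⟩
    · rintro ⟨y, hy⟩
      obtain ⟨y', hy'⟩ := hSr x
      exact disj _ (y - y') (by rw [map_sub, ← hy, ← hy']) (hker x)
  refine ⟨?_, hev, ?_, LinearMap.ker ((1 - S : E →L[ℂ] E) : Module.End ℂ E), ?_, ?_, ?_⟩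
  · filter_upwards [hr.filter_mono nhdsWithin_le_nhds, hl.filter_mono nhdsWithin_le_nhds,
      self_mem_nhdsWithin] with w h1 h2 hne
    rw [spectrum.mem_iff, not_not, Algebra.algebraMap_eq_smul_one]
    have hne' : (w - z) ^ p ≠ 0 := pow_ne_zero _ (sub_ne_zero.2 hne)
    exact ⟨⟨_, ((w - z) ^ p)⁻¹ • G w, by rw [mul_smul_comm, h1, smul_smul, inv_mul_cancel₀ hne', one_smul],
      by rw [smul_mul_assoc, h2, smul_smul, inv_mul_cancel₀ hne', one_smul]⟩, rfl⟩
  · rw [hgen]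
    have e : ∀ n : ℕ, ((A ^ n : E →L[ℂ] E) : Module.End ℂ E) = (A : Module.End ℂ E) ^ n := fun n => by
      induction n with
      | zero => rfl
      | succ n ih => rw [pow_succ, pow_succ, ← ih]; rfl
    rw [e]
    exact finiteDimensional_ker_pow _ hfin p
  · exact (1 - S).isClosed_ker
  · rw [hgen]
    constructor
    · rw [Submodule.disjoint_def]
      intro x hx hx'
      obtain ⟨y, hy⟩ := (hran x).1 hx'
      exact disj x y hy hx
    · rw [codisjoint_iff, Submodule.eq_top_iff']
      intro x
      rw [Submodule.mem_sup]
      refine ⟨x - S x, hker x, S x, ?_, sub_add_cancel _ _⟩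
      exact (hran _).2 (hSr x)
  · have hmem : ∀ x, x ∈ ((LinearMap.ker ((1 - S : E →L[ℂ] E) : Module.End ℂ E) : Submodule ℂ E) : Set E) ↔
        ∃ y, x = (A ^ p) y := hran
    have hcA : ∀ y, A ((A ^ p) y) = (A ^ p) (A y) := fun y =>
      DFunLike.congr_fun ((Commute.refl A).pow_right p).eq y
    refine ⟨fun x hx => ?_, fun x hx y hy hxy => ?_, fun x hx => ?_⟩
    · obtain ⟨y, rfl⟩ := (hmem x).1 hx
      exact (hmem _).2 ⟨A y, hcA y⟩
    · obtain ⟨x', hx'⟩ := (hmem x).1 hx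
      obtain ⟨y', hy'⟩ := (hmem y).1 hy
      have h0 : A (x - y) = 0 := by
        rw [map_sub, sub_eq_zero]; exact hxy
      refine sub_eq_zero.1 (disj (x - y) (x' - y') (by rw [map_sub, ← hx', ← hy']) (kstep _ ?_))
      rw [h0, map_zero]
    · obtain ⟨y, rfl⟩ := (hmem x).1 hx
      -- `y = (y - S y) + S y`
      obtain ⟨y', hy'⟩ := hSr y
      have h1 : (A ^ p) y = (A ^ p) ((A ^ p) y') := by
        have := hker y
        rw [map_sub, sub_eq_zero] at this
        rw [this, hy']
      -- If `p = 0` then `V = 0` and `-Q` inverts `A`. Otherwise `A^(p+1) y = A^(p+1) A^(p+1) y'`,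
      -- and removing one factor `A` still leaves an element of `ran A^(p+1)`.
      rcases p with _ | p
      · refine ⟨-(Q y), (hmem _).2 ⟨_, rfl⟩, ?_⟩
        change A (-(Q y)) = y
        have := hAV y
        have h2 := id1 y
        rw [show V y = 0 from this, zero_sub] at h2
        rw [map_neg, h2]
      · refine ⟨(A ^ p) ((A ^ (p + 1)) y'), (hmem _).2 ⟨(A ^ p) y', ?_⟩, ?_⟩
        · exact DFunLike.congr_fun ((Commute.refl A).pow_pow p (p + 1)).eq y'
        · change A ((A ^ p) ((A ^ (p + 1)) y')) = _
          rw [h1]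
          exact (DFunLike.congr_fun (pow_succ' A p) _).symm

end Isolated

/-! ### Operators on `ℓ¹` -/

section Lift

variable {ι : Type*} {E : Type*} [NormedAddCommGroup E] [NormedSpace ℂ E]

/-- The space `ℓ¹(ι)`. -/
abbrev L1 (ι : Type*) : Type _ := lp (fun _ : ι => ℂ) 1

open Classical in
/-- The unit vector at `i`. -/
def unitVec (i : ι) : L1 ι := lp.single 1 i 1

open Classical in
theorem norm_unitVec (i : ι) : ‖unitVec i‖ = 1 := by
  rw [unitVec, lp.norm_single zero_lt_one, norm_one]

open Classical in
theorem hasSum_smul_unitVec (y : L1 ι) : HasSum (fun i => y i • unitVec i) y := by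
  have := lp.hasSum_single (E := fun _ : ι => ℂ) (p := 1) ENNReal.one_ne_top y
  have e : ∀ i, lp.single (E := fun _ : ι => ℂ) 1 i (y i) = y i • unitVec i := fun i => by
    rw [unitVec, ← lp.single_smul, smul_eq_mul, mul_one]
  simpa only [e] using this

theorem hasSum_norm_L1 (y : L1 ι) : HasSum (fun i => ‖y i‖) ‖y‖ := by
  have := lp.hasSum_norm (E := fun _ : ι => ℂ) (p := 1) (by simp) y
  simpa using this

theorem L1.ext_unitVec {A B : L1 ι →L[ℂ] E} (h : ∀ i, A (unitVec i) = B (unitVec i)) : A = B := by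
  ext y
  have h1 := (hasSum_smul_unitVec y).mapL A
  have h2 := (hasSum_smul_unitVec y).mapL B
  simp only [map_smul, h] at h1 h2
  exact h1.unique h2

theorem summable_lift {u : ι → E} {C : ℝ} (h : ∀ i, ‖u i‖ ≤ C) (y : L1 ι) :
    Summable fun i => ‖y i • u i‖ := by
  refine Summable.of_nonneg_of_le (fun _ => norm_nonneg _) (fun i => ?_)
    ((hasSum_norm_L1 y).summable.mul_right C)
  rw [norm_smul]
  exact mul_le_mul_of_nonneg_left (h i) (norm_nonneg _)

/-- The bounded operator on `ℓ¹` with prescribed bounded values at the unit vectors. -/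
def L1.lift [CompleteSpace E] (u : ι → E) (h : ∃ C, ∀ i, ‖u i‖ ≤ C) : L1 ι →L[ℂ] E :=
  LinearMap.mkContinuousOfExistsBound
    { toFun := fun y => ∑' i, y i • u i
      map_add' := fun x y => by
        obtain ⟨C, hC⟩ := h
        rw [← (summable_lift hC x).of_norm.tsum_add (summable_lift hC y).of_norm]
        simp [add_smul]
      map_smul' := fun c x => by
        obtain ⟨C, hC⟩ := h
        rw [RingHom.id_apply, ← (summable_lift hC x).of_norm.tsum_const_smul]
        simp [mul_smul] } <| by
    obtain ⟨C, hC⟩ := h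
    refine ⟨C, fun y => ?_⟩
    refine (norm_tsum_le_tsum_norm (summable_lift hC y)).trans ?_
    rw [mul_comm]
    refine ((summable_lift hC y).tsum_le_tsum (fun i => ?_)
      ((hasSum_norm_L1 y).summable.mul_right C)).trans_eq ((hasSum_norm_L1 y).mul_right C).tsum_eq
    rw [norm_smul]
    exact mul_le_mul_of_nonneg_left (hC i) (norm_nonneg _)

open Classical in
theorem L1.lift_unitVec [CompleteSpace E] (u : ι → E) (h : ∃ C, ∀ i, ‖u i‖ ≤ C) (i : ι) :
    L1.lift u h (unitVec i) = u i := by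
  change ∑' j, (unitVec i : L1 ι) j • u j = u i
  rw [tsum_eq_single i]
  · simp [unitVec]
  · intro j hj
    rw [unitVec, lp.single_apply_ne _ _ _ hj, zero_smul]

/-- On `ℓ¹` the operator norm is attained as a supremum over unit vectors. This makes `‖Nⁿ‖` equal
to `‖g^{(n)}‖_∞` and not merely comparable to it. -/
theorem L1.norm_le_of_unitVec (A : L1 ι →L[ℂ] E) {C : ℝ} (hC : 0 ≤ C)
    (h : ∀ i, ‖A (unitVec i)‖ ≤ C) : ‖A‖ ≤ C := by
  refine A.opNorm_le_bound hC fun y => ?_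
  have h1 := (hasSum_smul_unitVec y).mapL A
  have hs := ((hasSum_norm_L1 y).mul_right C)
  have hle : ∀ i, ‖A (y i • unitVec i)‖ ≤ ‖y i‖ * C := fun i => by
    rw [map_smul, norm_smul]
    exact mul_le_mul_of_nonneg_left (h i) (norm_nonneg _)
  have hsn : Summable fun i => ‖A (y i • unitVec i)‖ :=
    Summable.of_nonneg_of_le (fun _ => norm_nonneg _) hle hs.summable
  rw [← h1.tsum_eq, mul_comm]
  exact (norm_tsum_le_tsum_norm hsn).trans ((hsn.tsum_le_tsum hle hs.summable).trans_eq hs.tsum_eq)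

end Lift

/-! ### Finite rank perturbations and determinants -/

section FiniteRank

variable {X Y : Type*} [NormedAddCommGroup X] [NormedSpace ℂ X] [NormedAddCommGroup Y]
  [NormedSpace ℂ Y] {n : ℕ}

open Matrix in
/-- The finite rank operator `y ↦ ∑ σ_k(y) a_{kj} D_j`. -/
def rankOp (a : Matrix (Fin n) (Fin n) ℂ) (D : Fin n → Y) (σ : Fin n → Y →L[ℂ] ℂ) : Y →L[ℂ] Y :=
  ∑ j, ∑ k, a k j • (σ k).smulRight (D j)

open Matrix in
theorem rankOp_apply (a : Matrix (Fin n) (Fin n) ℂ) (D : Fin n → Y) (σ : Fin n → Y →L[ℂ] ℂ)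
    (y : Y) : rankOp a D σ y = ∑ j, ((fun k => σ k y) ᵥ* a) j • D j := by
  simp only [rankOp, Matrix.vecMul, dotProduct, Finset.sum_smul, _root_.sum_apply,
    _root_.smul_apply, ContinuousLinearMap.smulRight_apply, smul_smul, mul_comm]

open Matrix in
theorem map_sum_smul (D : Fin n → Y) (σ : Fin n → Y →L[ℂ] ℂ) (R : Y →L[ℂ] Y) (v : Fin n → ℂ) :
    (fun k => σ k (R (∑ j, v j • D j))) = v ᵥ* (Matrix.of fun j k => σ k (R (D j))) := by
  ext k
  simp [Matrix.vecMul, dotProduct]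

/-- These finite rank operators compose like matrices in reverse order, with the matrix `σ_k (R
D_j)` inserted. For `R = 1` and a dual system that matrix is `1`, so `rankOp 1` is a projection; for
the resolvent, identities with the adjugate become operator identities. -/
theorem rankOp_mul (a b : Matrix (Fin n) (Fin n) ℂ) (D : Fin n → Y) (σ : Fin n → Y →L[ℂ] ℂ)
    (R : Y →L[ℂ] Y) :
    rankOp a D σ * R * rankOp b D σ = rankOp (b * (Matrix.of fun j k => σ k (R (D j))) * a) D σ := by
  ext y
  change rankOp a D σ (R (rankOp b D σ y)) = _
  rw [rankOp_apply b, rankOp_apply a, map_sum_smul, rankOp_apply, Matrix.vecMul_vecMul,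
    Matrix.vecMul_vecMul, Matrix.mul_assoc]

theorem rankOp_smul (c : ℂ) (a : Matrix (Fin n) (Fin n) ℂ) (D : Fin n → Y) (σ : Fin n → Y →L[ℂ] ℂ) :
    rankOp (c • a) D σ = c • rankOp a D σ := by
  simp [rankOp, Finset.smul_sum, mul_smul]

/-- If `P` is idempotent, `P W = W = W P`, `P R W = d P = W R P`, and `R` is a two-sided inverse of
`1 - t N`, then `(d - (R - 1) W) R` is `d` times a two-sided inverse of `1 - t N (1 - P)`. -/
theorem perturbed_inverse {A : Type*} [Ring A] [Algebra ℂ A] {N P R W : A} {t d : ℂ}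
    (hR : (1 - t • N) * R = 1) (hR' : R * (1 - t • N) = 1) (hPW : P * W = W) (hWP : W * P = W)
    (h1 : P * R * W = d • P) (h2 : W * R * P = d • P) :
    (1 - t • (N * (1 - P))) * ((d • 1 - (R - 1) * W) * R) = d • 1 ∧
    ((d • 1 - (R - 1) * W) * R) * (1 - t • (N * (1 - P))) = d • 1 := by
  -- The factorization rests on `(1 - t N)(R - 1) = t N`. It leaves `1 + (R - 1) P`, which `f2` and
  -- `f3` invert up to the scalar `d`.
  have f1 : 1 - t • (N * (1 - P)) = (1 - t • N) * (1 + (R - 1) * P) := by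
    have : (1 - t • N) * ((R - 1) * P) = t • (N * P) := by
      rw [← mul_assoc, mul_sub, hR, mul_one, sub_sub_cancel, smul_mul_assoc]
    rw [mul_add, this, mul_one, mul_sub, mul_one, smul_sub]
    abel
  have f2 : (1 + (R - 1) * P) * (d • 1 - (R - 1) * W) = d • 1 := by
    have : P * ((R - 1) * W) = d • P - W := by
      rw [← mul_assoc, mul_sub, mul_one, sub_mul, h1, hPW]
    rw [add_mul, one_mul, mul_sub, mul_assoc (R - 1) P, mul_assoc (R - 1) P, this, mul_smul_comm,
      mul_one, mul_sub]
    abel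
  have f3 : (d • 1 - (R - 1) * W) * (1 + (R - 1) * P) = d • 1 := by
    have : W * ((R - 1) * P) = d • P - W := by
      rw [← mul_assoc, mul_sub, mul_one, sub_mul, h2, hWP]
    rw [mul_add, mul_one, sub_mul (d • (1 : A)), mul_assoc (R - 1) W, this, smul_mul_assoc, one_mul,
      mul_sub, mul_smul_comm]
    abel
  rw [f1]
  constructor
  · rw [mul_assoc, ← mul_assoc (1 + (R - 1) * P), f2, smul_mul_assoc, one_mul, mul_smul_comm, hR]
  · rw [mul_assoc, ← mul_assoc R, hR', one_mul, f3]

theorem analyticAt_det {M : ℂ → Matrix (Fin n) (Fin n) ℂ} {t : ℂ}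
    (h : ∀ j k, AnalyticAt ℂ (fun s => M s j k) t) : AnalyticAt ℂ (fun s => (M s).det) t := by
  simp only [Matrix.det_apply]
  refine Finset.analyticAt_fun_sum _ fun σ _ => ?_
  simp only [Units.smul_def, zsmul_eq_mul]
  exact analyticAt_const.mul (Finset.analyticAt_fun_prod _ fun i _ => h _ _)

theorem analyticAt_adjugate {M : ℂ → Matrix (Fin n) (Fin n) ℂ} {t : ℂ}
    (h : ∀ j k, AnalyticAt ℂ (fun s => M s j k) t) (j k : Fin n) :
    AnalyticAt ℂ (fun s => (M s).adjugate j k) t := by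
  simp only [Matrix.adjugate_apply]
  refine analyticAt_det fun i l => ?_
  simp only [Matrix.updateRow_apply]
  split_ifs
  · exact analyticAt_const
  · exact h i l

/-- The data of a factorization `L = π N (1 - P) ι` with `P = ∑ σ_k ⊗ D_k` a finite rank projection
and `(1 - P) ι π = 1 - P`. -/
structure Factorization (L : X →L[ℂ] X) (N : Y →L[ℂ] Y) (D : Fin n → Y)
    (σ : Fin n → Y →L[ℂ] ℂ) where
  π : Y →L[ℂ] X
  ι : X →L[ℂ] Y
  dual : ∀ j k, σ k (D j) = (1 : Matrix (Fin n) (Fin n) ℂ) j k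
  factor : ∀ x, L x = π (N (ι x - rankOp 1 D σ (ι x)))
  lift : ∀ y, ι (π y) - rankOp 1 D σ (ι (π y)) = y - rankOp 1 D σ y

/-- The matrix `σ_k ((1 - t N)⁻¹ D_j)`. -/
def resolventMatrix (N : Y →L[ℂ] Y) (D : Fin n → Y) (σ : Fin n → Y →L[ℂ] ℂ) (t : ℂ) :
    Matrix (Fin n) (Fin n) ℂ :=
  Matrix.of fun j k => σ k (Ring.inverse (1 - t • N) (D j))

namespace Factorization

variable {L : X →L[ℂ] X} {N : Y →L[ℂ] Y} {D : Fin n → Y} {σ : Fin n → Y →L[ℂ] ℂ}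

theorem of_dual (F : Factorization L N D σ) :
    (Matrix.of fun j k => σ k ((1 : Y →L[ℂ] Y) (D j))) = 1 := by
  ext j k
  exact F.dual j k

/-- The numerator of the inverse of `1 - t N (1 - P)`. -/
def liftedInverse (N : Y →L[ℂ] Y) (D : Fin n → Y) (σ : Fin n → Y →L[ℂ] ℂ) (t : ℂ) : Y →L[ℂ] Y :=
  ((resolventMatrix N D σ t).det • 1 - (Ring.inverse (1 - t • N) - 1) *
    rankOp (resolventMatrix N D σ t).adjugate D σ) * Ring.inverse (1 - t • N)

/-- The numerator of the inverse of `1 - t L`. -/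
def inverse (F : Factorization L N D σ) (t : ℂ) : X →L[ℂ] X :=
  (resolventMatrix N D σ t).det • 1 +
    t • (F.π ∘L (liftedInverse N D σ t * (N * (1 - rankOp 1 D σ))) ∘L F.ι)

/-- Take `W` to be the finite rank operator of the adjugate of `M = σ_k (R D_j)`. Then `adj M * M =
M * adj M = det M` turns into the two relations required of `W`. No division by the determinant
occurs, so this also makes sense at its zeros. -/
theorem liftedInverse_spec (F : Factorization L N D σ) {t : ℂ} (ht : IsUnit (1 - t • N)) :
    (1 - t • (N * (1 - rankOp 1 D σ))) * liftedInverse N D σ t = (resolventMatrix N D σ t).det • 1 ∧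
    liftedInverse N D σ t * (1 - t • (N * (1 - rankOp 1 D σ))) =
      (resolventMatrix N D σ t).det • 1 := by
  refine perturbed_inverse (Ring.mul_inverse_cancel _ ht) (Ring.inverse_mul_cancel _ ht) ?_ ?_ ?_ ?_
  · have := rankOp_mul 1 (resolventMatrix N D σ t).adjugate D σ 1
    rwa [F.of_dual, mul_one, mul_one, mul_one] at this
  · have := rankOp_mul (resolventMatrix N D σ t).adjugate 1 D σ 1
    rwa [F.of_dual, mul_one, one_mul, one_mul] at this
  · rw [rankOp_mul, mul_one]
    change rankOp ((resolventMatrix N D σ t).adjugate * resolventMatrix N D σ t) D σ = _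
    rw [Matrix.adjugate_mul, rankOp_smul]
  · rw [rankOp_mul, one_mul]
    change rankOp (resolventMatrix N D σ t * (resolventMatrix N D σ t).adjugate) D σ = _
    rw [Matrix.mul_adjugate, rankOp_smul]

/-- With `B = N (1 - P)`, the operators `L = π B ι` and `B` are related as a product is to the
product in the other order, because `B ι π = B`. Hence an inverse `S` of `1 - t B`, up to the factor
`d`, transfers to `d + t π S B ι` for `1 - t L`. -/
theorem inverse_spec (F : Factorization L N D σ) {t : ℂ} (ht : IsUnit (1 - t • N)) :
    (1 - t • L) * F.inverse t = (resolventMatrix N D σ t).det • 1 ∧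
    F.inverse t * (1 - t • L) = (resolventMatrix N D σ t).det • 1 := by
  obtain ⟨h1, h2⟩ := F.liftedInverse_spec ht
  set d := (resolventMatrix N D σ t).det with hd
  set S := liftedInverse N D σ t
  set P := rankOp 1 D σ with hP
  have hlift : ∀ y, (N * (1 - P)) (F.ι (F.π y)) = (N * (1 - P)) y := fun y => congrArg N (F.lift y)
  have g1 : ∀ y, S y = d • y + t • (N * (1 - P)) (S y) := fun y => by
    have := DFunLike.congr_fun h1 y
    exact sub_eq_iff_eq_add.1 this
  have g2 : ∀ y, S y = d • y + t • S ((N * (1 - P)) y) := fun y => by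
    have := DFunLike.congr_fun h2 y
    change S (y - t • (N * (1 - P)) y) = d • y at this
    rw [map_sub, map_smul] at this
    exact sub_eq_iff_eq_add.1 this
  set B := N * (1 - P)
  have hi : ∀ x, F.inverse t x = d • x + t • F.π (S (B (F.ι x))) := fun x => rfl
  have hLx : ∀ x, L x = F.π (B (F.ι x)) := F.factor
  constructor <;> ext x
  · change F.inverse t x - t • L (F.inverse t x) = d • x
    have e := congrArg F.π (g1 (B (F.ι x)))
    rw [map_add, map_smul, map_smul] at e
    rw [hLx, hi]
    simp only [map_add, map_smul, hlift]
    rw [← e, add_sub_cancel_right]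
  · change F.inverse t (x - t • L x) = d • x
    have e := congrArg F.π (g2 (B (F.ι x)))
    rw [map_add, map_smul, map_smul] at e
    rw [map_sub, map_smul, hi, hi, hLx, hlift, ← e, add_sub_cancel_right]

/-- A zero of the determinant gives an eigenvector. -/
theorem exists_eigenvector (F : Factorization L N D σ) {t : ℂ} (ht : IsUnit (1 - t • N))
    (hd : (resolventMatrix N D σ t).det = 0) : ∃ x, x ≠ 0 ∧ t • L x = x := by
  -- A left null vector `c` gives `p = ∑ c_j D_j` in the range of `P`, and `y = R p` in the kernel
  -- of all `σ_k`. Applying `1 - P` to `t N y = y - p` gives `t (1 - P) N y = y`, so `π (N y)` is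
  -- the required vector.
  obtain ⟨c, hc, hcM⟩ := Matrix.exists_vecMul_eq_zero_iff.2 hd
  set R := Ring.inverse (1 - t • N) with hR
  set p := ∑ j, c j • D j with hp
  set y := R p with hy
  set P := rankOp 1 D σ with hP
  have h1 : y - t • N y = p := DFunLike.congr_fun (Ring.mul_inverse_cancel _ ht) p
  have hσ : (fun k => σ k y) = 0 := by
    rw [hy, hp, map_sum_smul]
    exact hcM
  have hPy : P y = 0 := by
    rw [hP, rankOp_apply, hσ]
    simp
  have hPp : P p = p := by
    have : (fun k => σ k p) = c := by
      have := map_sum_smul D σ 1 c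
      rw [F.of_dual, Matrix.vecMul_one] at this
      exact this
    rw [hP, rankOp_apply, this, Matrix.vecMul_one]
  have htN : t • (N y - P (N y)) = y := by
    have : t • N y = y - p := by rw [← h1]; abel
    rw [smul_sub, ← map_smul P, this, map_sub, hPy, hPp]
    abel
  -- If `N y = 0` then `y = p`, yet the coordinates `σ_k p = c_k` do not all vanish.
  have hN : N y ≠ 0 := by
    intro h
    rw [h, smul_zero, sub_zero] at h1
    rw [h1] at hPy
    rw [hPp] at hPy
    have : (fun k => σ k p) = c := by
      have := map_sum_smul D σ 1 c
      rw [F.of_dual, Matrix.vecMul_one] at this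
      exact this
    apply hc
    rw [← this, hPy]
    ext k
    simp
  have hNN : t • N (N y - P (N y)) = N y := by rw [← map_smul, htN]
  refine ⟨F.π (N y), fun h => hN ?_, ?_⟩
  · have := F.lift (N y)
    rw [h, map_zero, map_zero, sub_zero] at this
    rw [← hNN, ← this, map_zero, smul_zero]
  · rw [F.factor, F.lift, ← map_smul, hNN]

/-- A solution of `x = t L x` is `x = t π y` with `y = N (1 - P) ι x`. Moreover `(1 - t N) y = -t N
P y`, so `x` lies in the span of the finitely many vectors `π R N D_j`. -/
theorem finiteDimensional_ker (F : Factorization L N D σ) {t : ℂ} (ht : IsUnit (1 - t • N)) :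
    FiniteDimensional ℂ (LinearMap.ker ((1 - t • L : X →L[ℂ] X) : Module.End ℂ X)) := by
  set R := Ring.inverse (1 - t • N) with hR
  have : FiniteDimensional ℂ (Submodule.span ℂ (range fun j => F.π (R (N (D j))))) :=
    FiniteDimensional.span_of_finite ℂ (finite_range _)
  refine Submodule.finiteDimensional_of_le (S₂ := Submodule.span ℂ (range fun j => F.π (R (N (D j)))))
    fun x hx => ?_
  replace hx : x = t • L x := sub_eq_zero.1 hx
  set P := rankOp 1 D σ with hP
  set y := N (F.ι x - P (F.ι x)) with hy
  have e1 : x = t • F.π y := by rw [hy, ← F.factor]; exact hx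
  have e2 : y = t • N (y - P y) := by
    rw [← F.lift, ← map_smul, smul_sub, ← map_smul P, ← map_smul F.ι, ← e1]
  have e3 : (1 - t • N) y = -(t • N (P y)) := by
    change y - t • N y = _
    conv_lhs => enter [1]; rw [e2]
    rw [map_sub, smul_sub]; abel
  have e4 : y = -(t • R (N (P y))) := by
    have := DFunLike.congr_fun (Ring.inverse_mul_cancel _ ht) y
    change R ((1 - t • N) y) = y at this
    refine this.symm.trans ?_
    rw [e3, map_neg, map_smul]
  rw [e1, e4]
  rw [hP, rankOp_apply]
  simp only [map_sum, map_smul, map_neg]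
  refine Submodule.smul_mem _ _ (Submodule.neg_mem _ (Submodule.smul_mem _ _
    (Submodule.sum_mem _ fun j _ => Submodule.smul_mem _ _ (Submodule.subset_span ⟨j, rfl⟩))))

theorem analyticAt_ringInverse [CompleteSpace Y] {t : ℂ} (ht : IsUnit (1 - t • N)) :
    AnalyticAt ℂ (fun s : ℂ => Ring.inverse (1 - s • N)) t := by
  obtain ⟨u, hu⟩ := ht
  have h1 : AnalyticAt ℂ (Ring.inverse : (Y →L[ℂ] Y) → Y →L[ℂ] Y) (1 - t • N) := by
    rw [← hu]
    exact analyticAt_inverse u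
  exact h1.comp (f := fun s : ℂ => 1 - s • N)
    (analyticAt_const.sub (analyticAt_id.smul analyticAt_const))

theorem analyticAt_resolventMatrix [CompleteSpace Y] {t : ℂ} (ht : IsUnit (1 - t • N))
    (j k : Fin n) : AnalyticAt ℂ (fun s => resolventMatrix N D σ s j k) t := by
  have := analyticAt_ringInverse ht
  let e : (Y →L[ℂ] Y) →L[ℂ] ℂ := (σ k) ∘L (ContinuousLinearMap.apply ℂ Y (D j))
  exact (e.analyticAt _).comp this

theorem analyticAt_inverse (F : Factorization L N D σ) [CompleteSpace Y] {t : ℂ}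
    (ht : IsUnit (1 - t • N)) :
    AnalyticAt ℂ F.inverse t := by
  have hR := analyticAt_ringInverse ht
  have hM := fun j k => analyticAt_resolventMatrix (D := D) (σ := σ) ht j k
  have hd := analyticAt_det hM
  have hW : AnalyticAt ℂ (fun s => rankOp (resolventMatrix N D σ s).adjugate D σ) t := by
    unfold rankOp
    exact Finset.analyticAt_fun_sum _ fun j _ => Finset.analyticAt_fun_sum _ fun k _ =>
      (analyticAt_adjugate hM k j).smul analyticAt_const
  have hS : AnalyticAt ℂ (fun s => liftedInverse N D σ s * (N * (1 - rankOp 1 D σ))) t :=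
    (((hd.smul analyticAt_const).sub ((hR.sub analyticAt_const).mul hW)).mul hR).mul
      analyticAt_const
  let e : (Y →L[ℂ] Y) →L[ℂ] (X →L[ℂ] X) :=
    (ContinuousLinearMap.compL ℂ X Y X F.π) ∘L ((ContinuousLinearMap.compL ℂ X Y Y).flip F.ι)
  have he : AnalyticAt ℂ
      (fun s => e (liftedInverse N D σ s * (N * (1 - rankOp 1 D σ)))) t := (e.analyticAt _).comp hS
  exact (hd.smul analyticAt_const).add (analyticAt_id.smul he)

theorem resolventMatrix_zero (F : Factorization L N D σ) : resolventMatrix N D σ 0 = 1 := by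
  ext j k
  simp [resolventMatrix, F.dual]

/-- Zeros of the determinant are isolated eigenvalues of finite multiplicity. -/
theorem isIsolatedEigenvalue (F : Factorization L N D σ) [CompleteSpace X] [CompleteSpace Y]
    [Nontrivial Y] {z : ℂ} (hz : z ≠ 0)
    (ht : ‖z⁻¹‖ * (spectralRadius ℂ N).toReal < 1)
    (hd : (resolventMatrix N D σ z⁻¹).det = 0) :
    IsIsolatedEigenvalueOfFiniteMultiplicity L z := by
  have hu := (isUnit_one_sub_smul N ht).1
  set U : Set ℂ := {t | ‖t‖ * (spectralRadius ℂ N).toReal < 1} with hU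
  have hUo : IsOpen U := isOpen_lt (by fun_prop) (by fun_prop)
  have hUc : IsPreconnected U := by
    have : Convex ℝ U := by
      have := (convexOn_univ_norm (E := ℂ)).smul (c := (spectralRadius ℂ N).toReal)
        ENNReal.toReal_nonneg
      have := this.convex_lt 1
      simpa [hU, mul_comm] using this
    exact this.isPreconnected
  have hdan : AnalyticOnNhd ℂ (fun s => (resolventMatrix N D σ s).det) U := fun s hs =>
    analyticAt_det fun j k => analyticAt_resolventMatrix (isUnit_one_sub_smul N hs).1 j k
  -- Identity theorem on the convex disk `U`: the determinant equals `1` at the origin, so its zeros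
  -- have finite order.
  have hnz : ¬ ∀ᶠ s in 𝓝 z⁻¹, (resolventMatrix N D σ s).det = 0 := by
    intro h
    have := hdan.eqOn_zero_of_preconnected_of_eventuallyEq_zero hUc (z₀ := z⁻¹) ht h
      (x := 0) (by simp [hU])
    simp only [F.resolventMatrix_zero, Matrix.det_one, Pi.zero_apply] at this
    exact one_ne_zero this
  have hinv : AnalyticAt ℂ (fun w : ℂ => w⁻¹) z := analyticAt_id.inv hz
  have hdw : AnalyticAt ℂ (fun w : ℂ => (resolventMatrix N D σ w⁻¹).det) z :=
    (hdan z⁻¹ ht).comp hinv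
  have hnz' : ¬ ∀ᶠ w in 𝓝 z, (resolventMatrix N D σ w⁻¹).det = 0 := by
    intro h
    apply hnz
    have hc : Tendsto (fun s : ℂ => s⁻¹) (𝓝 z⁻¹) (𝓝 z) := by
      have := (continuousAt_inv₀ (inv_ne_zero hz)).tendsto
      rwa [inv_inv] at this
    filter_upwards [hc.eventually h] with s hs
    rwa [inv_inv] at hs
  obtain ⟨p, k, hk, hk0, hkd⟩ := hdw.exists_eventuallyEq_pow_smul_nonzero_iff.2 hnz'
  have hUw : ∀ᶠ w in 𝓝 z, w⁻¹ ∈ U := hinv.continuousAt.eventually (hUo.mem_nhds ht)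
  have hne := hk.continuousAt.eventually_ne hk0
  have hz' := eventually_ne_nhds hz
  obtain ⟨x, hx0, hx⟩ := F.exists_eigenvector hu hd
  -- The determinant at `1/w` is `(w - z)^p k(w)` with `k(z) ≠ 0`. Dividing the numerator
  -- `F.inverse` by `w k(w)` therefore gives `(w - z)^p` times the resolvent of `L` at `w`, and this
  -- is analytic at `z`.
  refine isIsolatedEigenvalue_of_meromorphic L z p (fun w => (w⁻¹ * (k w)⁻¹) • F.inverse w⁻¹)
    ?_ ?_ ?_ ?_ ?_
  · exact (hinv.mul (hk.inv hk0)).smul ((F.analyticAt_inverse hu).comp hinv)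
  · filter_upwards [hkd, hUw, hne, hz'] with w h1 h2 h3 h4
    have := (F.inverse_spec (isUnit_one_sub_smul N h2).1).1
    rw [h1] at this
    have e : w • 1 - L = w • (1 - w⁻¹ • L) := by
      rw [smul_sub, smul_smul, mul_inv_cancel₀ h4, one_smul]
    rw [e, mul_smul_comm, smul_mul_assoc, this, smul_smul, smul_smul, smul_eq_mul]
    congr 1
    field_simp
  · filter_upwards [hkd, hUw, hne, hz'] with w h1 h2 h3 h4
    have := (F.inverse_spec (isUnit_one_sub_smul N h2).1).2
    rw [h1] at this
    have e : w • 1 - L = w • (1 - w⁻¹ • L) := by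
      rw [smul_sub, smul_smul, mul_inv_cancel₀ h4, one_smul]
    rw [e, smul_mul_assoc, mul_smul_comm, this, smul_smul, smul_smul, smul_eq_mul]
    congr 1
    field_simp
  · have := F.finiteDimensional_ker hu
    have e : LinearMap.ker ((L - z • 1 : X →L[ℂ] X) : Module.End ℂ X) =
        LinearMap.ker ((1 - z⁻¹ • L : X →L[ℂ] X) : Module.End ℂ X) := by
      ext v
      change L v - z • v = 0 ↔ v - z⁻¹ • L v = 0
      rw [sub_eq_zero, sub_eq_zero, eq_inv_smul_iff₀ hz, eq_comm]
    rw [e]; exact this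
  · refine Module.End.hasEigenvalue_of_hasEigenvector (x := x) ⟨?_, hx0⟩
    rw [Module.End.mem_eigenspace_iff]
    change L x = z • x
    rw [← hx, smul_smul, mul_inv_cancel₀ hz, one_smul, hx]

end Factorization

end FiniteRank

/-! ### The spectral radius of a positive operator -/

section Positive

variable {X : Type*} [NormedAddCommGroup X] [NormedSpace ℂ X] {ι : Type*}

/-- The cone of the vectors whose coordinates have nonnegative real parts. -/
def posCone (ev : ι → X →L[ℂ] ℂ) : Set X := {u | ∀ i, 0 ≤ (ev i u).re}

theorem posCone_add {ev : ι → X →L[ℂ] ℂ} {u v : X} (hu : u ∈ posCone ev) (hv : v ∈ posCone ev) :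
    u + v ∈ posCone ev := fun i => by
  rw [map_add, Complex.add_re]
  exact add_nonneg (hu i) (hv i)

theorem posCone_smul {ev : ι → X →L[ℂ] ℂ} {u : X} {r : ℝ} (hr : 0 ≤ r) (hu : u ∈ posCone ev) :
    (r : ℂ) • u ∈ posCone ev := fun i => by
  rw [map_smul, smul_eq_mul, Complex.re_ofReal_mul]
  exact mul_nonneg hr (hu i)

theorem posCone_hasSum {ev : ι → X →L[ℂ] ℂ} {f : ℕ → X →L[ℂ] X} {B : X →L[ℂ] X}
    (h : HasSum f B) (hf : ∀ n, MapsTo (f n) (posCone ev) (posCone ev)) :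
    MapsTo B (posCone ev) (posCone ev) := fun u hu i => by
  let e : (X →L[ℂ] X) →L[ℂ] ℂ := (ev i) ∘L (ContinuousLinearMap.apply ℂ X u)
  exact (Complex.hasSum_re (h.mapL e)).nonneg fun n => hf n hu i

theorem posCone_pow {ev : ι → X →L[ℂ] ℂ} {B : X →L[ℂ] X}
    (hB : MapsTo B (posCone ev) (posCone ev)) (n : ℕ) :
    MapsTo (B ^ n) (posCone ev) (posCone ev) := by
  induction n with
  | zero => exact fun u hu => hu
  | succ n ih => rw [pow_succ]; exact fun u hu => ih (hB hu)

theorem posCone_smul_map {ev : ι → X →L[ℂ] ℂ} {B : X →L[ℂ] X} {r : ℝ} (hr : 0 ≤ r)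
    (hB : MapsTo B (posCone ev) (posCone ev)) :
    MapsTo ((r : ℂ) • B) (posCone ev) (posCone ev) := fun _ hu => posCone_smul hr (hB hu)

/-- If the orbit of a positive vector grows, coordinatewise, like the powers of the spectral
radius, then the spectral radius of a positive operator is in its spectrum. -/
theorem spectralRadius_mem_spectrum [CompleteSpace X] [Nontrivial X] {L : X →L[ℂ] X}
    {ev : ι → X →L[ℂ] ℂ} (hev : ∀ i u, ‖ev i u‖ ≤ ‖u‖)
    (hL : MapsTo L (posCone ev) (posCone ev)) {e : X} (he : e ∈ posCone ev) {α : ℕ → ℝ}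
    (hα0 : ∀ n, 0 ≤ α n) (hα : ∀ n M, (∀ i, (ev i ((L ^ n) e)).re ≤ M) → α n ≤ M)
    (hlim : Tendsto (fun n : ℕ => α n ^ (1 / (n : ℝ))) atTop (𝓝 (spectralRadius ℂ L).toReal))
    (hpos : 0 < (spectralRadius ℂ L).toReal) :
    (((spectralRadius ℂ L).toReal : ℝ) : ℂ) ∈ spectrum ℂ L := by
  set ρ := (spectralRadius ℂ L).toReal with hρ
  by_contra hmem
  rw [spectrum.mem_iff, not_not, Algebra.algebraMap_eq_smul_one] at hmem
  have hcont : ContinuousAt (fun μ : ℝ => ((μ : ℂ) • (1 : X →L[ℂ] X) - L)) ρ := by fun_prop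
  have hRc : ContinuousAt (fun μ : ℝ => Ring.inverse ((μ : ℂ) • (1 : X →L[ℂ] X) - L)) ρ := by
    obtain ⟨u, hu⟩ := hmem
    have h1 := NormedRing.inverse_continuousAt u
    rw [hu] at h1
    exact ContinuousAt.comp (f := fun μ : ℝ => ((μ : ℂ) • (1 : X →L[ℂ] X) - L)) h1 hcont
  set C := ‖Ring.inverse ((ρ : ℂ) • (1 : X →L[ℂ] X) - L)‖ + 1 with hC
  have hC0 : 0 < C := by positivity
  have ev1 : ∀ᶠ μ : ℝ in 𝓝 ρ, IsUnit ((μ : ℂ) • (1 : X →L[ℂ] X) - L) :=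
    hcont.eventually (Units.isOpen.mem_nhds hmem)
  have ev2 : ∀ᶠ μ : ℝ in 𝓝 ρ, ‖Ring.inverse ((μ : ℂ) • (1 : X →L[ℂ] X) - L)‖ < C :=
    hRc.norm.eventually (gt_mem_nhds (lt_add_one _))
  obtain ⟨δ, hδ, hball⟩ := Metric.eventually_nhds_iff.1 (ev1.and ev2)
  -- If `ρ` were in the resolvent set, the resolvent would be bounded by `C` near `ρ`. At `μ = ρ +
  -- η` it is positive by its Neumann series in `L`. Since `2 η C < 1`, the expansion around `μ`
  -- reaches `μ' = ρ - η` with positive terms, so the resolvent is positive even below the spectral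
  -- radius.
  obtain ⟨η, hη0, hη⟩ : ∃ η : ℝ, 0 < η ∧ η < δ ∧ η < ρ ∧ 2 * η * C < 1 := by
    refine ⟨min (min (δ / 2) (ρ / 2)) (1 / (4 * C)), by positivity, ?_, ?_, ?_⟩
    · exact (min_le_left _ _).trans_lt ((min_le_left _ _).trans_lt (by linarith))
    · exact (min_le_left _ _).trans_lt ((min_le_right _ _).trans_lt (by linarith))
    · have : min (min (δ / 2) (ρ / 2)) (1 / (4 * C)) ≤ 1 / (4 * C) := min_le_right _ _
      calc _ ≤ 2 * (1 / (4 * C)) * C := by gcongr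
        _ < 1 := by field_simp; norm_num
  obtain ⟨hηδ, hηρ, hηC⟩ := hη
  set μ := ρ + η with hμ
  obtain ⟨hu, hn⟩ := hball (y := μ) (by simp [hμ, abs_of_pos hη0, hηδ])
  set R := Ring.inverse ((μ : ℂ) • (1 : X →L[ℂ] X) - L) with hR
  have hμ0 : 0 < μ := by positivity
  have hRpos : MapsTo R (posCone ev) (posCone ev) := by
    have hlt : ‖(μ : ℂ)⁻¹‖ * (spectralRadius ℂ L).toReal < 1 := by
      rw [norm_inv, Complex.norm_real, Real.norm_of_nonneg hμ0.le, ← hρ, inv_mul_lt_iff₀ hμ0]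
      linarith
    obtain ⟨hu', hs⟩ := isUnit_one_sub_smul L hlt
    have e1 : (μ : ℂ) • (1 : X →L[ℂ] X) - L = (μ : ℂ) • (1 - (μ : ℂ)⁻¹ • L) := by
      rw [smul_sub, smul_smul, mul_inv_cancel₀ (by exact_mod_cast hμ0.ne'), one_smul]
    have e2 : R = ((μ⁻¹ : ℝ) : ℂ) • Ring.inverse (1 - (μ : ℂ)⁻¹ • L) := by
      have h2 : ((μ : ℂ) • (1 : X →L[ℂ] X) - L) *
          (((μ⁻¹ : ℝ) : ℂ) • Ring.inverse (1 - (μ : ℂ)⁻¹ • L)) = 1 := by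
        rw [e1, mul_smul_comm, smul_mul_assoc, Ring.mul_inverse_cancel _ hu', smul_smul,
          ← Complex.ofReal_mul, inv_mul_cancel₀ hμ0.ne', Complex.ofReal_one, one_smul]
      have := congrArg (R * ·) h2
      simp only [← mul_assoc] at this
      rw [hR, Ring.inverse_mul_cancel _ hu, one_mul, mul_one] at this
      exact this.symm
    rw [e2]
    refine posCone_smul_map (inv_nonneg.2 hμ0.le) (posCone_hasSum hs fun n => posCone_pow ?_ n)
    rw [← Complex.ofReal_inv]
    exact posCone_smul_map (inv_nonneg.2 hμ0.le) hL
  set μ' := ρ - η with hμ'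
  have hμ'0 : 0 < μ' := by linarith
  set T := ((2 * η : ℝ) : ℂ) • R with hT
  have hTn : ‖T‖ < 1 := by
    rw [hT, norm_smul, Complex.norm_real, Real.norm_of_nonneg (by positivity)]
    exact lt_of_le_of_lt (mul_le_mul_of_nonneg_left hn.le (by positivity)) hηC
  have hTpos : MapsTo T (posCone ev) (posCone ev) := posCone_smul_map (by positivity) hRpos
  have hsum := (summable_geometric_of_norm_lt_one hTn).hasSum
  have hSpos := posCone_hasSum hsum fun n => posCone_pow hTpos n
  have hgeo : (1 - T) * ∑' n : ℕ, T ^ n = 1 := mul_neg_geom_series T hTn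
  set S := ∑' n : ℕ, T ^ n with hS
  have hLT : (μ' : ℂ) • (1 : X →L[ℂ] X) - L = (1 - T) * ((μ : ℂ) • (1 : X →L[ℂ] X) - L) := by
    rw [sub_mul, one_mul, hT, smul_mul_assoc, hR, Ring.inverse_mul_cancel _ hu, hμ, hμ']
    push_cast
    module
  have hcomm : Commute (1 - T) ((μ : ℂ) • (1 : X →L[ℂ] X) - L) := by
    refine (Commute.one_left _).sub_left ?_
    change T * _ = _ * T
    rw [hT, smul_mul_assoc, mul_smul_comm, hR, Ring.inverse_mul_cancel _ hu,
      Ring.mul_inverse_cancel _ hu]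
  set v := R (S e) with hv
  have hvpos : v ∈ posCone ev := hRpos (hSpos he)
  have hveq : (μ' : ℂ) • v = e + L v := by
    have h1 : (((μ' : ℂ) • (1 : X →L[ℂ] X) - L) * (R * S)) e = e := by
      rw [hLT, hcomm.eq, mul_assoc, ← mul_assoc (1 - T), (show Commute (1 - T) R from ?_).eq,
        mul_assoc R, hgeo, mul_one, hR, Ring.mul_inverse_cancel _ hu]
      · rfl
      · rw [hT]
        exact (Commute.one_left _).sub_left ((Commute.refl R).smul_left _)
    exact sub_eq_iff_eq_add.1 h1
  -- Iterating `μ' v = e + L v` with `e`, `v` and `L` positive bounds the orbit of `e` by `μ'^(n+1)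
  -- v`. Thus `α n` grows at rate at most `μ' < ρ`, a contradiction.
  have key : ∀ n : ℕ, ((μ' ^ (n + 1) : ℝ) : ℂ) • v - (L ^ n) e ∈ posCone ev := by
    intro n
    induction n with
    | zero =>
      rw [zero_add, pow_one, hveq, pow_zero]
      change e + L v - e ∈ _
      rw [add_sub_cancel_left]
      exact hL hvpos
    | succ n ih =>
      have : ((μ' ^ (n + 1 + 1) : ℝ) : ℂ) • v - (L ^ (n + 1)) e =
          ((μ' ^ (n + 1) : ℝ) : ℂ) • e + L (((μ' ^ (n + 1) : ℝ) : ℂ) • v - (L ^ n) e) := by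
        have h1 : (L ^ (n + 1)) e = L ((L ^ n) e) := by rw [pow_succ']; rfl
        rw [pow_succ μ' (n + 1), Complex.ofReal_mul, mul_smul, hveq, smul_add, map_sub, map_smul, h1]
        abel
      rw [this]
      exact posCone_add (posCone_smul (by positivity) he) (hL ih)
  have hbound : ∀ n, α n ≤ (‖v‖ * μ' + 1) * μ' ^ n := by
    intro n
    have h1 : α n ≤ μ' ^ (n + 1) * ‖v‖ := by
      refine hα n _ fun i => ?_
      have := key n i
      rw [map_sub, map_smul, smul_eq_mul, Complex.sub_re, Complex.re_ofReal_mul] at this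
      have h2 : (ev i v).re ≤ ‖v‖ := (Complex.re_le_norm _).trans (hev i v)
      have h3 : μ' ^ (n + 1) * (ev i v).re ≤ μ' ^ (n + 1) * ‖v‖ :=
        mul_le_mul_of_nonneg_left h2 (by positivity)
      linarith
    have : 0 < μ' ^ n := by positivity
    rw [pow_succ] at h1
    nlinarith
  have hlim2 : Tendsto (fun n : ℕ => (‖v‖ * μ' + 1) ^ (1 / (n : ℝ)) * μ') atTop (𝓝 (1 * μ')) :=
    (tendsto_const_rpow_one_div (by positivity)).mul_const μ'
  have : ρ ≤ 1 * μ' := by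
    refine le_of_tendsto_of_tendsto hlim hlim2 ?_
    filter_upwards [eventually_gt_atTop 0] with n hn
    have hn' : (n : ℝ) ≠ 0 := by exact_mod_cast hn.ne'
    calc α n ^ (1 / (n : ℝ)) ≤ ((‖v‖ * μ' + 1) * μ' ^ n) ^ (1 / (n : ℝ)) :=
          Real.rpow_le_rpow (hα0 n) (hbound n) (by positivity)
      _ = _ := by
          rw [Real.mul_rpow (by positivity) (by positivity), ← Real.rpow_natCast μ',
            ← Real.rpow_mul hμ'0.le, mul_one_div_cancel hn', Real.rpow_one]
  linarith

end Positive

/-! ### Germs as one-sided filters -/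

namespace Germ

variable {a b : EReal}

/-- The filter of one-sided neighbourhoods of the base point of a germ. -/
def filter : Germ a b → Filter EReal
  | .plus x _ => 𝓝[>] x
  | .minus x _ => 𝓝[<] x

/-- `x̂ < y` for a germ `x̂` and a point `y`. -/
def Below (y : EReal) : Germ a b → Prop
  | .plus x _ => x < y
  | .minus x _ => x ≤ y

instance filter_neBot (x : Germ a b) : x.filter.NeBot := by
  rcases x with ⟨x, hx⟩ | ⟨x, hx⟩
  · exact nhdsGT_neBot_of_exists_gt ⟨b, hx.2⟩
  · exact nhdsLT_neBot_of_exists_lt ⟨a, hx.1⟩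

/-- A germ never coincides with a point, so a whole one-sided neighbourhood lies strictly on one
side of `y`. This allows order statements about germs to be checked on nearby points. -/
theorem below_cases (x : Germ a b) (y : EReal) :
    (x.Below y ∧ ∀ᶠ w in x.filter, w < y) ∨ (¬ x.Below y ∧ ∀ᶠ w in x.filter, y < w) := by
  rcases x with ⟨x, hx⟩ | ⟨x, hx⟩
  · rcases lt_or_ge x y with h | h
    · exact Or.inl ⟨h, mem_nhdsWithin_of_mem_nhds (Iio_mem_nhds h)⟩
    · refine Or.inr ⟨not_lt.2 h, ?_⟩
      filter_upwards [self_mem_nhdsWithin] with w hw using h.trans_lt hw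
  · rcases lt_or_ge y x with h | h
    · exact Or.inr ⟨not_le.2 h, mem_nhdsWithin_of_mem_nhds (Ioi_mem_nhds h)⟩
    · refine Or.inl ⟨h, ?_⟩
      filter_upwards [self_mem_nhdsWithin] with w hw using lt_of_lt_of_le hw h

theorem below_of_eventually {x : Germ a b} {y : EReal} (h : ∀ᶠ w in x.filter, w < y) :
    x.Below y := by
  rcases x.below_cases y with h' | h'
  · exact h'.1
  · obtain ⟨w, h1, h2⟩ := (h.and h'.2).exists
    exact absurd h1 h2.asymm

theorem not_below_of_eventually {x : Germ a b} {y : EReal} (h : ∀ᶠ w in x.filter, y < w) :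
    ¬ x.Below y := by
  rcases x.below_cases y with h' | h'
  · obtain ⟨w, h1, h2⟩ := (h.and h'.2).exists
    exact absurd h1 h2.asymm
  · exact h'.1

theorem Below.mono {x : Germ a b} {y z : EReal} (h : x.Below y) (hyz : y ≤ z) : x.Below z := by
  rcases x with ⟨x, hx⟩ | ⟨x, hx⟩
  · exact lt_of_lt_of_le h hyz
  · exact le_trans h hyz

/-- The base point of a germ. -/
def base : Germ a b → EReal
  | .plus x _ => x
  | .minus x _ => x

theorem below_iff_of_disjoint (x : Germ a b) {u v : Ioo a b}
    (h : Disjoint (uIcc u v) {z : Ioo a b | (z : EReal) = x.base}) : x.Below u ↔ x.Below v := by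
  have aux : ∀ u v : Ioo a b, u ≤ v → Disjoint (uIcc u v) {z : Ioo a b | (z : EReal) = x.base} →
      (x.Below u ↔ x.Below v) := by
    intro u v huv h
    refine ⟨fun h => h.mono huv, fun hv => ?_⟩
    by_contra hu
    have : (u : EReal) ≤ x.base ∧ x.base ≤ v := by
      rcases x with ⟨x, hx⟩ | ⟨x, hx⟩
      · exact ⟨not_lt.1 hu, le_of_lt hv⟩
      · exact ⟨(not_le.1 hu).le, hv⟩
    rw [uIcc_of_le huv, disjoint_left] at h
    exact h (a := ⟨x.base, u.2.1.trans_le this.1, this.2.trans_lt v.2.2⟩)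
      (show _ ≤ _ ∧ _ ≤ _ from this) rfl
  rcases le_total u v with huv | huv
  · exact aux u v huv h
  · exact (aux v u huv (by rwa [uIcc_comm])).symm

open Classical in
/-- The step function `1/2` above the germ and `-1/2` below it. -/
def step (x : Germ a b) : Step a b :=
  ⟨fun y => if x.Below y then 1 / 2 else -1 / 2, {z | (z : EReal) = x.base},
    Set.Subsingleton.finite fun _ hu _ hv => Subtype.ext (hu.trans hv.symm),
    fun u v h => by simp only [x.below_iff_of_disjoint h]⟩

open Classical in
theorem step_apply (x : Germ a b) (y : Ioo a b) :
    x.step y = if x.Below y then 1 / 2 else -1 / 2 := rfl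

theorem step_congr {x x' : Germ a b} {y y' : Ioo a b} (h : x.Below y ↔ x'.Below y') :
    x.step y = x'.step y' := by
  classical
  simp only [step_apply, h]

end Germ

theorem Step.norm_boundary_le {a b : EReal} [h : Fact (a < b)] (φ : Step a b) {M : ℝ}
    (hM : ∀ y, ‖φ y‖ ≤ M) : ‖boundary φ.toFun‖ ≤ 2 * M := by
  have : Nonempty (Ioo a b) := nonempty_Ioo_subtype h.1
  obtain ⟨l, hl⟩ := φ.exists_eq_left
  obtain ⟨r, hr⟩ := φ.exists_eq_right
  obtain ⟨y, hy⟩ := hl.exists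
  obtain ⟨z, hz⟩ := hr.exists
  rw [boundary, leftValue_eq hl, rightValue_eq hr, ← hy, ← hz, two_mul]
  exact (norm_add_le _ _).trans (add_le_add (hM y) (hM z))

/-- Shifted by `1/2`, the step is the indicator of an upper set, so its variation is at most `2`;
the boundary value contributes at most `1`. Only uniformity in the germ matters: it makes `synth`
bounded. -/
theorem Germ.norm_step_le {a b : EReal} [Fact (a < b)] (x : Germ a b) : ‖x.step‖ ≤ 3 := by
  classical
  have h1 : ‖boundary x.step.toFun‖ ≤ 2 * (1 / 2) := x.step.norm_boundary_le fun y => by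
    rw [x.step_apply]; split_ifs <;> simp
  have h2 : eVariationOn x.step.toFun univ ≤ 2 := by
    have e : eVariationOn x.step.toFun univ =
        eVariationOn (fun y => x.step y + 1 / 2) univ := by
      simp only [eVariationOn, edist_add_right]
    have hval : ∀ y : Ioo a b, x.step y + 1 / 2 = if x.Below y then 1 else 0 := fun y => by
      rw [x.step_apply]; split_ifs <;> norm_num
    rw [e]
    have := System.eVariationOn_le_of_zero (fun y : Ioo a b => x.step y + 1 / 2)
      {y | x.Below y} ⟨fun u hu v _ w hw => hu.mono hw.1⟩
      (fun y hy => by rw [hval]; exact if_neg hy) 1 (fun y => by rw [hval]; split_ifs <;> simp)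
    refine this.trans ?_
    rw [eVariationOn.constant_on]
    · simp
    · rintro _ ⟨u, hu, rfl⟩ _ ⟨v, hv, rfl⟩
      exact (hval u).trans ((if_pos hu).trans ((hval v).trans (if_pos hv)).symm)
  have h3 : (eVariationOn x.step.toFun univ).toReal ≤ 2 := by
    have := ENNReal.toReal_mono (by simp) h2
    simpa using this
  rw [Step.norm_def]
  linarith

namespace System

variable {d : ℕ} (T : System d)

theorem castSucc_le_of_lt {i j : Fin (d + 1)} (h : i < j) : T.c i.succ ≤ T.c j.castSucc :=
  T.c_strictMono.monotone (by rw [Fin.le_def]; simpa using h)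

theorem GermMem.unique {T : System d} {i j : Fin (d + 1)} {x : Germ T.a T.b} (hi : T.GermMem i x)
    (hj : T.GermMem j x) : i = j := by
  have aux : ∀ i j : Fin (d + 1), T.GermMem i x → T.GermMem j x → ¬ i < j := by
    intro i j hi hj hij
    have := T.castSucc_le_of_lt hij
    rcases x with ⟨x, hx⟩ | ⟨x, hx⟩
    · exact absurd (this.trans hj.1) (not_le.2 hi.2)
    · exact absurd (lt_of_le_of_lt this hj.1) (not_lt.2 hi.2)
  exact le_antisymm (not_lt.1 (aux _ _ hj hi)) (not_lt.1 (aux _ _ hi hj))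

theorem GermMem.idx_eq {T : System d} {k : Fin (d + 1)} {x : Germ T.a T.b} (h : T.GermMem k x) :
    T.idx x = k := (T.idx_spec x).unique h

theorem GermMem.eventually {T : System d} {k : Fin (d + 1)} {x : Germ T.a T.b}
    (h : T.GermMem k x) : ∀ᶠ w in x.filter, w ∈ T.I k := by
  rcases x with ⟨x, hx⟩ | ⟨x, hx⟩
  · filter_upwards [Ioo_mem_nhdsGT h.2] with w hw using ⟨lt_of_le_of_lt h.1 hw.1, hw.2⟩
  · filter_upwards [Ioo_mem_nhdsLT h.1] with w hw using ⟨hw.1, lt_of_lt_of_le hw.2 h.2⟩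

theorem GermMem.not_below {T : System d} {j k : Fin (d + 1)} {x : Germ T.a T.b}
    (h : T.GermMem k x) (hjk : j < k) {y : EReal} (hy : y ∈ T.I j) : ¬ x.Below y := by
  refine Germ.not_below_of_eventually ?_
  filter_upwards [h.eventually] with w hw
  exact hy.2.trans ((T.castSucc_le_of_lt hjk).trans_lt hw.1)

theorem GermMem.below {T : System d} {j k : Fin (d + 1)} {x : Germ T.a T.b}
    (h : T.GermMem k x) (hjk : k < j) {y : EReal} (hy : y ∈ T.I j) : x.Below y := by
  refine Germ.below_of_eventually ?_
  filter_upwards [h.eventually] with w hw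
  exact hw.2.trans ((T.castSucc_le_of_lt hjk).trans_lt hy.1)

/-- Strict monotonicity makes `f_k` approach its one-sided limit from the side recorded in the sign
of `f̂ x̂`; an intermediate point `w'` supplies the strict inequality. Later order arguments use
this convergence in place of the definition of `fHat`. -/
theorem tendsto_fHat (x : Germ T.a T.b) : Tendsto (T.f (T.idx x)) x.filter (T.fHat x).filter := by
  rcases x with ⟨x, hx⟩ | ⟨x, hx⟩
  · have hlt := (T.Ioo_right (hx := hx)).1
    have hsub := (T.Ioo_right (hx := hx)).2
    set k := T.idx (.plus x hx) with hk
    have hne : (Ioo x (T.c k.succ)).Nonempty := nonempty_Ioo.2 hlt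
    have : (𝓝[>] x).NeBot := nhdsGT_neBot_of_exists_gt ⟨_, hlt⟩
    have hev : ∀ᶠ w in 𝓝[>] x, w ∈ Ioo x (T.c k.succ) := Ioo_mem_nhdsGT hlt
    rw [fHat]
    split_ifs with h
    · have ht := (h.monotoneOn.mono hsub).tendsto_nhdsWithin_Ioo_right hne (OrderBot.bddBelow _)
      refine tendsto_nhdsWithin_iff.2 ⟨by rw [ht.limUnder_eq]; exact ht, ?_⟩
      filter_upwards [hev] with w hw
      obtain ⟨w', hw'⟩ := exists_between hw.1
      have hw'I : w' ∈ Ioo x (T.c k.succ) := ⟨hw'.1, hw'.2.trans hw.2⟩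
      rw [mem_Ioi, ht.limUnder_eq]
      exact (sInf_le (mem_image_of_mem _ hw'I)).trans_lt (h (hsub hw'I) (hsub hw) hw'.2)
    · have h' := T.antiOn h
      have ht := (h'.antitoneOn.mono hsub).tendsto_nhdsWithin_Ioo_right hne (OrderTop.bddAbove _)
      refine tendsto_nhdsWithin_iff.2 ⟨by rw [ht.limUnder_eq]; exact ht, ?_⟩
      filter_upwards [hev] with w hw
      obtain ⟨w', hw'⟩ := exists_between hw.1
      have hw'I : w' ∈ Ioo x (T.c k.succ) := ⟨hw'.1, hw'.2.trans hw.2⟩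
      rw [mem_Iio, ht.limUnder_eq]
      exact (h' (hsub hw'I) (hsub hw) hw'.2).trans_le (le_sSup (mem_image_of_mem _ hw'I))
  · have hlt := (T.Ioo_left (hx := hx)).1
    have hsub := (T.Ioo_left (hx := hx)).2
    set k := T.idx (.minus x hx) with hk
    have hne : (Ioo (T.c k.castSucc) x).Nonempty := nonempty_Ioo.2 hlt
    have : (𝓝[<] x).NeBot := nhdsLT_neBot_of_exists_lt ⟨_, hlt⟩
    have hev : ∀ᶠ w in 𝓝[<] x, w ∈ Ioo (T.c k.castSucc) x := Ioo_mem_nhdsLT hlt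
    rw [fHat]
    split_ifs with h
    · have ht := (h.monotoneOn.mono hsub).tendsto_nhdsWithin_Ioo_left hne (OrderTop.bddAbove _)
      refine tendsto_nhdsWithin_iff.2 ⟨by rw [ht.limUnder_eq]; exact ht, ?_⟩
      filter_upwards [hev] with w hw
      obtain ⟨w', hw'⟩ := exists_between hw.2
      have hw'I : w' ∈ Ioo (T.c k.castSucc) x := ⟨hw.1.trans hw'.1, hw'.2⟩
      rw [mem_Iio, ht.limUnder_eq]
      exact (h (hsub hw) (hsub hw'I) hw'.1).trans_le (le_sSup (mem_image_of_mem _ hw'I))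
    · have h' := T.antiOn h
      have ht := (h'.antitoneOn.mono hsub).tendsto_nhdsWithin_Ioo_left hne (OrderBot.bddBelow _)
      refine tendsto_nhdsWithin_iff.2 ⟨by rw [ht.limUnder_eq]; exact ht, ?_⟩
      filter_upwards [hev] with w hw
      obtain ⟨w', hw'⟩ := exists_between hw.2
      have hw'I : w' ∈ Ioo (T.c k.castSucc) x := ⟨hw.1.trans hw'.1, hw'.2⟩
      rw [mem_Ioi, ht.limUnder_eq]
      exact (sInf_le (mem_image_of_mem _ hw'I)).trans_lt (h' (hsub hw) (hsub hw'I) hw'.1)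

theorem GermMem.tendsto {T : System d} {k : Fin (d + 1)} {x : Germ T.a T.b} (h : T.GermMem k x) :
    Tendsto (T.f k) x.filter (T.fHat x).filter := by
  have := T.tendsto_fHat x
  rwa [h.idx_eq] at this

/-- The branch preserves or reverses the position of nearby points relative to `y`. The equivalence
with `StrictMonoOn` is multiplication by `s_k` in propositional form. -/
theorem fHat_below_iff {k : Fin (d + 1)} {x : Germ T.a T.b} (h : T.GermMem k x) {y : EReal}
    (hy : y ∈ T.I k) :
    (T.fHat x).Below (T.f k y) ↔ (x.Below y ↔ StrictMonoOn (T.f k) (T.I k)) := by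
  have hlim := h.tendsto
  by_cases hm : StrictMonoOn (T.f k) (T.I k)
  · rcases (T.fHat x).below_cases (T.f k y) with h1 | h1
    · have : ∀ᶠ w in x.filter, w < y := by
        filter_upwards [hlim.eventually h1.2, h.eventually] with w hw hwI
        exact (hm.lt_iff_lt hwI hy).1 hw
      simp [h1.1, hm, Germ.below_of_eventually this]
    · have : ∀ᶠ w in x.filter, y < w := by
        filter_upwards [hlim.eventually h1.2, h.eventually] with w hw hwI
        exact (hm.lt_iff_lt hy hwI).1 hw
      simp [h1.1, hm, Germ.not_below_of_eventually this]
  · have ha := T.antiOn hm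
    rcases (T.fHat x).below_cases (T.f k y) with h1 | h1
    · have : ∀ᶠ w in x.filter, y < w := by
        filter_upwards [hlim.eventually h1.2, h.eventually] with w hw hwI
        exact (ha.lt_iff_gt hwI hy).1 hw
      simp [h1.1, hm, Germ.not_below_of_eventually this]
    · have : ∀ᶠ w in x.filter, w < y := by
        filter_upwards [hlim.eventually h1.2, h.eventually] with w hw hwI
        exact (ha.lt_iff_gt hy hwI).1 hw
      simp [h1.1, hm, Germ.below_of_eventually this]

/-- The set `f_k(I_k)` is an interval. If two germs of the lap landed on different sides of `y`,
then `y` would lie between two of its points. -/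
theorem fHat_below_iff_of_notMem {k : Fin (d + 1)} {x x' : Germ T.a T.b} (h : T.GermMem k x)
    (h' : T.GermMem k x') {y : Ioo T.a T.b} (hy : y ∉ T.J k) :
    (T.fHat x).Below y ↔ (T.fHat x').Below y := by
  have aux : ∀ {x x' : Germ T.a T.b}, T.GermMem k x → T.GermMem k x' → (T.fHat x).Below y →
      (T.fHat x').Below y := by
    intro x x' h h' hb
    obtain ⟨w, hwI, hw⟩ : ∃ w ∈ T.I k, T.f k w < y := by
      rcases (T.fHat x).below_cases y with h1 | h1
      · obtain ⟨w, hw⟩ := ((h.tendsto.eventually h1.2).and h.eventually).exists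
        exact ⟨w, hw.2, hw.1⟩
      · exact absurd hb h1.1
    by_contra hb'
    obtain ⟨w', hwI', hw'⟩ : ∃ w ∈ T.I k, (y : EReal) < T.f k w := by
      rcases (T.fHat x').below_cases y with h1 | h1
      · exact absurd h1.1 hb'
      · obtain ⟨w, hw⟩ := ((h'.tendsto.eventually h1.2).and h'.eventually).exists
        exact ⟨w, hw.2, hw.1⟩
    refine hy ((T.J_ordConnected k).out (x := ⟨_, T.f_mem hwI⟩) (y := ⟨_, T.f_mem hwI'⟩)
      ⟨⟨w, T.I_subset k hwI⟩, hwI, rfl⟩ ⟨⟨w', T.I_subset k hwI'⟩, hwI', rfl⟩ ⟨hw.le, hw'.le⟩)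
  exact ⟨aux h h', aux h' h⟩

theorem s_mul_self (k : Fin (d + 1)) : T.s k * T.s k = 1 := by
  unfold s; split_ifs <;> norm_num

/-- The symmetric values `±1/2` make the step odd under reversal of order, so an
orientation-reversing branch only produces a sign. -/
theorem step_fHat_apply {k : Fin (d + 1)} {x : Germ T.a T.b} (h : T.GermMem k x)
    {u y : Ioo T.a T.b} (hu : (u : EReal) ∈ T.I k) (huy : T.f k u = y) :
    (T.fHat x).step y = T.s k * x.step u := by
  have hb := T.fHat_below_iff h hu
  rw [huy] at hb
  rw [Germ.step_apply, Germ.step_apply, s]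
  by_cases h1 : x.Below u <;> by_cases h2 : StrictMonoOn (T.f k) (T.I k) <;>
    simp [hb, h1, h2] <;> norm_num

/-! ### The transfer operator on the step functions of germs -/

theorem ruelleStep_apply (φ : Step T.a T.b) (y : Ioo T.a T.b) :
    (T.ruelleStep φ) y = ∑ k, T.branchFun k φ.toFun y := by
  have : ∀ s : Finset (Fin (d + 1)),
      ((∑ k ∈ s, T.branchStep k) φ).toFun y = ∑ k ∈ s, T.branchFun k φ.toFun y := by
    classical
    intro s
    induction s using Finset.induction_on with
    | empty => simp [Step.zero_apply]
    | insert k s hk ih =>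
      rw [Finset.sum_insert hk, Finset.sum_insert hk, LinearMap.add_apply, Step.add_apply, ih,
        branchStep_apply]
  exact this _

theorem branchFun_eq_zero {k : Fin (d + 1)} {φ : Ioo T.a T.b → ℂ}
    (h : ∀ u : Ioo T.a T.b, (u : EReal) ∈ T.I k → φ u = 0) (y : Ioo T.a T.b) :
    T.branchFun k φ y = 0 := by
  by_cases hy : y ∈ T.J k
  · obtain ⟨u, hu, e⟩ := hy
    rw [T.branchFun_eq φ hu e, h u hu, mul_zero]
  · exact T.branchFun_of_notMem φ hy

theorem ruelleStep_eq_zero {φ : Step T.a T.b}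
    (h : ∀ k, ∀ u : Ioo T.a T.b, (u : EReal) ∈ T.I k → φ u = 0) : T.ruelleStep φ = 0 := by
  refine Step.ext fun y => ?_
  rw [ruelleStep_apply, Step.zero_apply]
  exact Finset.sum_eq_zero fun k _ => T.branchFun_eq_zero (h k) y

theorem Step_sub_apply {a b : EReal} (φ ψ : Step a b) (x : Ioo a b) :
    (φ - ψ).toFun x = φ x - ψ x := rfl

/-- A difference of steps at two germs of one lap vanishes on all other laps, so a single branch
contributes. Outside the image of that branch the two image steps agree and cancel. A single step
would not satisfy this relation in general; the differences do. -/
theorem ruelleStep_step_sub {k : Fin (d + 1)} {x x' : Germ T.a T.b} (h : T.GermMem k x)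
    (h' : T.GermMem k x') :
    T.ruelleStep (x.step - x'.step) =
      ((T.s k * T.g k : ℝ) : ℂ) • ((T.fHat x).step - (T.fHat x').step) := by
  refine Step.ext fun y => ?_
  rw [ruelleStep_apply, Finset.sum_eq_single k, Step.smul_apply, Step_sub_apply]
  · by_cases hy : y ∈ T.J k
    · obtain ⟨u, hu, e⟩ := hy
      rw [T.branchFun_eq _ hu e, Step_sub_apply, T.step_fHat_apply h hu e, T.step_fHat_apply h' hu e]
      have : (T.s k : ℂ) * T.s k = 1 := by exact_mod_cast T.s_mul_self k
      push_cast
      linear_combination (-(T.g k : ℂ) * (x.step u - x'.step u)) * this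
    · rw [T.branchFun_of_notMem _ hy, Germ.step_congr (T.fHat_below_iff_of_notMem h h' hy), sub_self,
        mul_zero]
  · intro j _ hj
    refine T.branchFun_eq_zero (fun u hu => ?_) y
    rw [Step_sub_apply, Germ.step_apply, Germ.step_apply]
    rcases lt_or_gt_of_ne hj with hj | hj
    · rw [if_neg (h.not_below hj hu), if_neg (h'.not_below hj hu), sub_self]
    · rw [if_pos (h.below hj hu), if_pos (h'.below hj hu), sub_self]
  · simp

theorem germMem_cPlus (k : Fin (d + 1)) : T.GermMem k (T.cPlus k) :=
  ⟨le_rfl, T.c_strictMono (Fin.castSucc_lt_succ)⟩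

theorem germMem_cMinus (k : Fin (d + 1)) : T.GermMem k (T.cMinus k) :=
  ⟨T.c_strictMono (Fin.castSucc_lt_succ), le_rfl⟩

theorem step_boundary : (T.cPlus 0).step + (T.cMinus (Fin.last d)).step = 0 := by
  refine Step.ext fun y => ?_
  have h1 : (T.cPlus 0).Below y := y.2.1
  have h2 : ¬ (T.cMinus (Fin.last d)).Below y := not_le.2 y.2.2
  rw [Step.add_apply, Germ.step_apply, Germ.step_apply, if_pos h1, if_neg h2, Step.zero_apply]
  norm_num

/-- The two steps differ only at the cutting point itself, which belongs to no open interval `I_k`.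
-/
theorem ruelleStep_step_cut (i : Fin d) :
    T.ruelleStep ((T.cPlus i.succ).step - (T.cMinus i.castSucc).step) = 0 := by
  refine T.ruelleStep_eq_zero fun k u hu => ?_
  have : (T.cPlus i.succ).Below u ↔ (T.cMinus i.castSucc).Below u := by
    change T.c i.succ.castSucc < u ↔ T.c i.castSucc.succ ≤ u
    rw [← Fin.succ_castSucc, le_iff_lt_or_eq]
    refine ⟨Or.inl, fun h => h.resolve_right fun h => ?_⟩
    rw [← h] at hu
    have h1 := T.c_strictMono.lt_iff_lt.1 hu.1
    have h2 := T.c_strictMono.lt_iff_lt.1 hu.2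
    rw [Fin.lt_def] at h1 h2
    simp at h1 h2
    omega
  rw [Step_sub_apply, Germ.step_congr this, sub_self]

end System

namespace System

variable {d : ℕ} (T : System d)

/-! ### Cylinders and the partition function -/

/-- The composition of the branches along a word. -/
def wordMap : List (Fin (d + 1)) → EReal → EReal
  | [] => id
  | k :: w => wordMap w ∘ T.f k

/-- The image of a cylinder under the composition of branches. -/
def wordImage (w : List (Fin (d + 1))) : Set (Ioo T.a T.b) :=
  {y | ∃ x ∈ T.cylinder w, T.wordMap w x = y}

/-- The weight of a word. -/
def wordWeight (w : List (Fin (d + 1))) : ℝ := (w.map T.g).prod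

/-- The composition of the branch operators along a word. -/
def wordStep : List (Fin (d + 1)) → Step T.a T.b →ₗ[ℂ] Step T.a T.b
  | [] => LinearMap.id
  | k :: w => wordStep w ∘ₗ T.branchStep k

theorem cylinder_subset (w : List (Fin (d + 1))) : T.cylinder w ⊆ Ioo T.a T.b := by
  cases w with
  | nil => exact subset_rfl
  | cons k w => exact inter_subset_left.trans (T.I_subset k)

theorem wordMap_mem {w : List (Fin (d + 1))} {x : EReal} (hx : x ∈ T.cylinder w) :
    T.wordMap w x ∈ Ioo T.a T.b := by
  induction w generalizing x with
  | nil => exact hx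
  | cons k w ih => exact ih hx.2

theorem wordMap_monotone (w : List (Fin (d + 1))) :
    StrictMonoOn (T.wordMap w) (T.cylinder w) ∨ StrictAntiOn (T.wordMap w) (T.cylinder w) := by
  induction w with
  | nil => exact Or.inl (strictMono_id.strictMonoOn _)
  | cons k w ih =>
    have hm : MapsTo (T.f k) (T.cylinder (k :: w)) (T.cylinder w) := fun x hx => hx.2
    have hs : T.cylinder (k :: w) ⊆ T.I k := inter_subset_left
    rcases ih with h | h <;> rcases T.f_monotone k with h' | h'
    · exact Or.inl (h.comp (h'.mono hs) hm)
    · exact Or.inr (h.comp_strictAntiOn (h'.mono hs) hm)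
    · exact Or.inr (h.comp_strictMonoOn (h'.mono hs) hm)
    · exact Or.inl (h.comp (h'.mono hs) hm)

theorem wordStep_apply {w : List (Fin (d + 1))} (φ : Step T.a T.b) {x y : Ioo T.a T.b}
    (hx : (x : EReal) ∈ T.cylinder w) (hxy : T.wordMap w x = y) :
    (T.wordStep w φ) y = T.wordWeight w * φ x := by
  induction w generalizing φ x with
  | nil =>
    have : x = y := Subtype.ext hxy
    simp [wordStep, wordWeight, this]
  | cons k w ih =>
    have h1 := T.f_mem hx.1
    have := ih (T.branchStep k φ) (x := ⟨T.f k x, h1⟩) hx.2 hxy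
    rw [branchStep_apply, T.branchFun_eq (x := x) _ hx.1 rfl] at this
    refine this.trans ?_
    simp only [wordWeight, List.map_cons, List.prod_cons]
    push_cast
    ring

theorem wordStep_of_notMem {w : List (Fin (d + 1))} (φ : Step T.a T.b) {y : Ioo T.a T.b}
    (hy : y ∉ T.wordImage w) : (T.wordStep w φ) y = 0 := by
  induction w generalizing φ with
  | nil => exact absurd ⟨y, y.2, rfl⟩ hy
  | cons k w ih =>
    change (T.wordStep w (T.branchStep k φ)) y = 0
    by_cases hw : y ∈ T.wordImage w
    · obtain ⟨z, hz, hzy⟩ := hw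
      rw [T.wordStep_apply (x := ⟨z, T.cylinder_subset w hz⟩) _ hz hzy, branchStep_apply,
        branchFun_of_notMem, mul_zero]
      rintro ⟨x, hx, hxz⟩
      refine hy ⟨x, ⟨hx, ?_⟩, ?_⟩
      · change T.f k x ∈ T.cylinder w
        rw [hxz]; exact hz
      · change T.wordMap w (T.f k x) = y
        rw [hxz]; exact hzy
    · exact ih _ hw

theorem wordImage_nonempty {w : List (Fin (d + 1))} :
    (T.wordImage w).Nonempty ↔ (T.cylinder w).Nonempty :=
  ⟨fun ⟨_, x, hx, _⟩ => ⟨x, hx⟩, fun ⟨x, hx⟩ => ⟨⟨_, T.wordMap_mem hx⟩, x, hx, rfl⟩⟩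

/-- Cylinders are defined by prepending a letter, but their images under iterates evolve by
appending one. The induction in `exists_germs_of_wordImage` runs on the last letter. -/
theorem cylinder_concat (w : List (Fin (d + 1))) (k : Fin (d + 1)) (x : EReal) :
    x ∈ T.cylinder (w ++ [k]) ↔ x ∈ T.cylinder w ∧ T.wordMap w x ∈ T.I k := by
  induction w generalizing x with
  | nil =>
    change x ∈ T.I k ∧ T.f k x ∈ Ioo T.a T.b ↔ x ∈ Ioo T.a T.b ∧ x ∈ T.I k
    exact ⟨fun h => ⟨T.I_subset k h.1, h.1⟩, fun h => ⟨h.2, T.f_mem h.2⟩⟩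
  | cons j w ih =>
    change x ∈ T.I j ∧ T.f j x ∈ T.cylinder (w ++ [k]) ↔
      (x ∈ T.I j ∧ T.f j x ∈ T.cylinder w) ∧ T.wordMap w (T.f j x) ∈ T.I k
    rw [ih, and_assoc]

theorem wordMap_concat (w : List (Fin (d + 1))) (k : Fin (d + 1)) (x : EReal) :
    T.wordMap (w ++ [k]) x = T.f k (T.wordMap w x) := by
  induction w generalizing x with
  | nil => rfl
  | cons j w ih => exact ih (T.f j x)

theorem mem_wordImage_concat {w : List (Fin (d + 1))} {k : Fin (d + 1)} {y : Ioo T.a T.b} :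
    y ∈ T.wordImage (w ++ [k]) ↔ ∃ z ∈ T.wordImage w, (z : EReal) ∈ T.I k ∧ T.f k z = y := by
  constructor
  · rintro ⟨x, hx, hxy⟩
    rw [cylinder_concat] at hx
    rw [wordMap_concat] at hxy
    exact ⟨⟨_, T.wordMap_mem hx.1⟩, ⟨x, hx.1, rfl⟩, hx.2, hxy⟩
  · rintro ⟨z, ⟨x, hx, hxz⟩, hz, hzy⟩
    refine ⟨x, (T.cylinder_concat w k x).2 ⟨hx, by rw [hxz]; exact hz⟩, ?_⟩
    rw [wordMap_concat, hxz, hzy]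

/-! ### The images of the cylinders are cut out by the orbits of the critical germs -/

open Classical in
/-- The germs `c_k⁺`, `c_{k+1}⁻` and their first `n` images. -/
def orbitGerms : ℕ → Finset (Germ T.a T.b)
  | 0 => Finset.univ.image T.cPlus ∪ Finset.univ.image T.cMinus
  | n + 1 => orbitGerms 0 ∪ (orbitGerms n).image T.fHat

theorem orbitGerms_zero_subset (n : ℕ) : T.orbitGerms 0 ⊆ T.orbitGerms n := by
  classical
  cases n with
  | zero => exact subset_rfl
  | succ n =>
    conv_rhs => rw [orbitGerms]
    exact Finset.subset_union_left

theorem fHat_mem_orbitGerms {n : ℕ} {x : Germ T.a T.b} (hx : x ∈ T.orbitGerms n) :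
    T.fHat x ∈ T.orbitGerms (n + 1) := by
  classical
  rw [orbitGerms]
  exact Finset.mem_union_right _ (Finset.mem_image_of_mem _ hx)

theorem cPlus_mem_orbitGerms (k : Fin (d + 1)) (n : ℕ) : T.cPlus k ∈ T.orbitGerms n := by
  classical
  refine T.orbitGerms_zero_subset n ?_
  rw [orbitGerms]
  exact Finset.mem_union_left _ (Finset.mem_image_of_mem _ (Finset.mem_univ _))

theorem cMinus_mem_orbitGerms (k : Fin (d + 1)) (n : ℕ) : T.cMinus k ∈ T.orbitGerms n := by
  classical
  refine T.orbitGerms_zero_subset n ?_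
  rw [orbitGerms]
  exact Finset.mem_union_right _ (Finset.mem_image_of_mem _ (Finset.mem_univ _))

theorem card_orbitGerms_le (n : ℕ) : (T.orbitGerms n).card ≤ 2 * (d + 1) * (n + 1) := by
  classical
  have h0 : (T.orbitGerms 0).card ≤ 2 * (d + 1) := by
    rw [orbitGerms]
    refine (Finset.card_union_le _ _).trans ?_
    have h1 := Finset.card_image_le (s := Finset.univ) (f := T.cPlus)
    have h2 := Finset.card_image_le (s := Finset.univ) (f := T.cMinus)
    rw [Finset.card_univ, Fintype.card_fin] at h1 h2
    omega
  induction n with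
  | zero => simpa using h0
  | succ n ih =>
    rw [orbitGerms]
    refine (Finset.card_union_le _ _).trans ?_
    have h1 := Finset.card_image_le (s := T.orbitGerms n) (f := T.fHat)
    have : 2 * (d + 1) * (n + 1 + 1) = 2 * (d + 1) + 2 * (d + 1) * (n + 1) := by ring
    omega

/-- A germ to the left of lap `k` is replaced by `c_k⁺` and one to the right by `c_{k+1}⁻`. Seen
from inside the lap nothing changes, and the replacements are critical germs, hence stay in the
finite orbit set. -/
theorem exists_clamp (k : Fin (d + 1)) {n : ℕ} {x : Germ T.a T.b} (hx : x ∈ T.orbitGerms n) :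
    ∃ x' ∈ T.orbitGerms n, T.GermMem k x' ∧ ∀ u ∈ T.I k, (x'.Below u ↔ x.Below u) := by
  obtain ⟨j, hj⟩ := T.exists_germMem x
  rcases lt_trichotomy j k with h | rfl | h
  · refine ⟨T.cPlus k, T.cPlus_mem_orbitGerms k n, T.germMem_cPlus k, fun u hu => ?_⟩
    exact iff_of_true hu.1 (hj.below h hu)
  · exact ⟨x, hx, hj, fun _ _ => Iff.rfl⟩
  · refine ⟨T.cMinus k, T.cMinus_mem_orbitGerms k n, T.germMem_cMinus k, fun u hu => ?_⟩
    exact iff_of_false (not_le.2 hu.2) (hj.not_below h hu)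

/-- Appending a letter cuts the image interval at the ends of a lap and then applies `f̂` to its two
end germs. Membership is stated as an exclusive or, so the end germs need not be ordered and
orientation-reversing branches need no separate treatment. -/
theorem exists_germs_of_wordImage (w : List (Fin (d + 1))) :
    ∃ x ∈ T.orbitGerms w.length, ∃ x' ∈ T.orbitGerms w.length,
      ∀ y : Ioo T.a T.b, y ∈ T.wordImage w ↔ ¬ (x.Below y ↔ x'.Below y) := by
  induction w using List.reverseRecOn with
  | nil =>
    refine ⟨T.cPlus 0, T.cPlus_mem_orbitGerms _ _, T.cMinus (Fin.last d),
      T.cMinus_mem_orbitGerms _ _, fun y => ?_⟩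
    have h1 : (T.cPlus 0).Below y := y.2.1
    have h2 : ¬ (T.cMinus (Fin.last d)).Below y := not_le.2 y.2.2
    simp only [h1, h2, iff_false, not_true, not_false_iff, iff_true]
    exact ⟨y, y.2, rfl⟩
  | append_singleton w k ih =>
    obtain ⟨x, hx, x', hx', h⟩ := ih
    obtain ⟨z, hz, hzk, hzx⟩ := T.exists_clamp k hx
    obtain ⟨z', hz', hzk', hzx'⟩ := T.exists_clamp k hx'
    rw [List.length_append, List.length_singleton]
    refine ⟨_, T.fHat_mem_orbitGerms hz, _, T.fHat_mem_orbitGerms hz', fun y => ?_⟩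
    by_cases hy : y ∈ T.J k
    · obtain ⟨u, hu, huy⟩ := hy
      have e1 := T.fHat_below_iff hzk hu
      have e2 := T.fHat_below_iff hzk' hu
      rw [huy, hzx u hu] at e1
      rw [huy, hzx' u hu] at e2
      have e3 : y ∈ T.wordImage (w ++ [k]) ↔ u ∈ T.wordImage w := by
        rw [mem_wordImage_concat]
        constructor
        · rintro ⟨v, hv, hvI, hvy⟩
          have : v = u := Subtype.ext (T.f_injOn k hvI hu (hvy.trans huy.symm))
          rwa [← this]
        · exact fun hu' => ⟨u, hu', hu, huy⟩
      rw [e3, h u, e1, e2]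
      by_cases hm : StrictMonoOn (T.f k) (T.I k) <;> simp [hm, not_iff_not]
    · have e := T.fHat_below_iff_of_notMem hzk hzk' hy
      have : y ∉ T.wordImage (w ++ [k]) := by
        rw [mem_wordImage_concat]
        rintro ⟨v, -, hvI, hvy⟩
        exact hy ⟨v, hvI, hvy⟩
      simp only [this, e, not_true]

theorem wordImage_ordConnected (w : List (Fin (d + 1))) : (T.wordImage w).OrdConnected := by
  obtain ⟨x, -, x', -, h⟩ := T.exists_germs_of_wordImage w
  refine ⟨fun u hu v hv y hy => ?_⟩
  rw [h] at hu hv ⊢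
  have h1 : ∀ z : Germ T.a T.b, z.Below u → z.Below y := fun z hz => hz.mono hy.1
  have h2 : ∀ z : Germ T.a T.b, z.Below y → z.Below v := fun z hz => hz.mono hy.2
  have := h1 x
  have := h1 x'
  have := h2 x
  have := h2 x'
  tauto

end System

/-! ### Norm of a weighted composition with an inverse branch -/

/-- With `R = |c| ‖φ‖`, the constant `5` collects `R` for the variation inside `J`, `2 R` for the
two ends of `J`, and `2 R` for the boundary value. Applied once to a whole word, the estimate does
not produce a factor `5ⁿ`. -/
theorem Step.norm_le_of_comp {a b : EReal} [Fact (a < b)] {φ ψ : Step a b} {J : Set (Ioo a b)}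
    (hJ : J.OrdConnected) (h0 : ∀ y ∉ J, ψ y = 0) (c : ℝ) (r : Ioo a b → Ioo a b)
    (hr : MonotoneOn r J ∨ AntitoneOn r J) (h1 : ∀ y ∈ J, ψ y = c * φ (r y)) :
    ‖ψ‖ ≤ 5 * |c| * ‖φ‖ := by
  have hsup : ∀ y, ‖ψ y‖ ≤ |c| * ‖φ‖ := by
    intro y
    by_cases hy : y ∈ J
    · rw [h1 y hy, norm_mul, Complex.norm_real, Real.norm_eq_abs]
      exact mul_le_mul_of_nonneg_left (φ.norm_apply_le _) (abs_nonneg _)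
    · rw [h0 y hy, norm_zero]
      exact mul_nonneg (abs_nonneg _) (norm_nonneg _)
  set R := |c| * ‖φ‖ with hR
  have hR0 : 0 ≤ R := mul_nonneg (abs_nonneg _) (norm_nonneg _)
  have hbd := ψ.norm_boundary_le hsup
  have hJv : eVariationOn ψ.toFun J ≤ ‖(c : ℂ)‖ₑ * eVariationOn φ.toFun univ := by
    have e : EqOn ψ.toFun ((fun x => (c : ℂ) * φ.toFun x) ∘ r) J := fun y hy => h1 y hy
    rw [eVariationOn.eq_of_eqOn e, ← eVariationOn_mul]
    rcases hr with m | m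
    · exact eVariationOn.comp_le_of_monotoneOn _ _ m (mapsTo_univ _ _)
    · exact eVariationOn.comp_le_of_antitoneOn _ _ m (mapsTo_univ _ _)
  have hv : eVariationOn ψ.toFun univ ≤
      ‖(c : ℂ)‖ₑ * eVariationOn φ.toFun univ + ENNReal.ofReal R * 2 := by
    refine (System.eVariationOn_le_of_zero _ J hJ h0 (ENNReal.ofReal R) fun y => ?_).trans
      (add_le_add hJv le_rfl)
    rw [← ofReal_norm]
    exact ENNReal.ofReal_le_ofReal (hsup y)
  have hv' : (eVariationOn ψ.toFun univ).toReal ≤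
      |c| * (eVariationOn φ.toFun univ).toReal + R * 2 := by
    have n1 : ‖(c : ℂ)‖ₑ * eVariationOn φ.toFun univ ≠ ⊤ :=
      ENNReal.mul_ne_top enorm_ne_top φ.boundedVariation
    have n2 : ENNReal.ofReal R * 2 ≠ ⊤ := ENNReal.mul_ne_top ENNReal.ofReal_ne_top (by simp)
    refine (ENNReal.toReal_mono (ENNReal.add_ne_top.2 ⟨n1, n2⟩) hv).trans (le_of_eq ?_)
    rw [ENNReal.toReal_add n1 n2, ENNReal.toReal_mul, ENNReal.toReal_mul, toReal_enorm,
      ENNReal.toReal_ofReal hR0, Complex.norm_real, Real.norm_eq_abs]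
    simp
  have hvR : |c| * (eVariationOn φ.toFun univ).toReal ≤ R := by
    refine mul_le_mul_of_nonneg_left ?_ (abs_nonneg _)
    rw [Step.norm_def]
    linarith [norm_nonneg (boundary φ.toFun)]
  have : (5 * |c|) * ‖φ‖ = 5 * R := by rw [hR]; ring
  rw [this, Step.norm_def]
  linarith

namespace System

variable {d : ℕ} (T : System d)

theorem norm_wordStep_le (w : List (Fin (d + 1))) (φ : Step T.a T.b) :
    ‖T.wordStep w φ‖ ≤ 5 * |T.wordWeight w| * ‖φ‖ := by
  classical
  have hr : ∀ y ∈ T.wordImage w, ∃ x : Ioo T.a T.b, (x : EReal) ∈ T.cylinder w ∧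
      T.wordMap w x = y := fun y ⟨x, hx, e⟩ => ⟨⟨x, T.cylinder_subset w hx⟩, hx, e⟩
  choose! r hr1 hr2 using hr
  refine Step.norm_le_of_comp (T.wordImage_ordConnected w) (fun y hy => T.wordStep_of_notMem φ hy)
    _ r ?_ fun y hy => T.wordStep_apply φ (hr1 y hy) (hr2 y hy)
  rcases T.wordMap_monotone w with h | h
  · left
    intro y hy z hz hyz
    refine (h.le_iff_le (hr1 y hy) (hr1 z hz)).1 ?_
    rw [hr2 y hy, hr2 z hz]; exact hyz
  · right
    intro y hy z hz hyz
    refine (h.le_iff_ge (hr1 y hy) (hr1 z hz)).1 ?_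
    rw [hr2 y hy, hr2 z hz]; exact hyz

theorem ruelleStep_pow_apply (n : ℕ) (φ : Step T.a T.b) :
    (T.ruelleStep ^ n) φ = ∑ w : Fin n → Fin (d + 1), T.wordStep (List.ofFn w) φ := by
  induction n generalizing φ with
  | zero => simp [wordStep]
  | succ n ih =>
    rw [pow_succ, Module.End.mul_apply, ih, ← (Fin.consEquiv fun _ => Fin (d + 1)).sum_comp,
      Fintype.sum_prod_type_right]
    refine Finset.sum_congr rfl fun w _ => ?_
    rw [ruelleStep, LinearMap.sum_apply, map_sum]
    refine Finset.sum_congr rfl fun k _ => ?_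
    simp [Fin.consEquiv, List.ofFn_succ, wordStep]

end System

/-! ### Comparison of the partition function with the iterates of `L` -/

namespace System

variable {d : ℕ} (T : System d)

theorem wordWeight_ofFn {n : ℕ} (w : Fin n → Fin (d + 1)) :
    T.wordWeight (List.ofFn w) = ∏ i, T.g (w i) := by
  rw [wordWeight, List.map_ofFn, List.prod_ofFn]
  rfl

theorem Step_sum_apply {a b : EReal} {ι : Type*} (s : Finset ι) (φ : ι → Step a b) (y : Ioo a b) :
    (∑ i ∈ s, φ i).toFun y = ∑ i ∈ s, φ i y := by
  classical
  induction s using Finset.induction_on with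
  | empty => simp [Step.zero_apply]
  | insert i s hi ih => rw [Finset.sum_insert hi, Finset.sum_insert hi, Step.add_apply, ih]

open Classical in
theorem norm_ruelleStep_pow_le (hg : ∀ k, 0 ≤ T.g k) (n : ℕ) (φ : Step T.a T.b) :
    ‖(T.ruelleStep ^ n) φ‖ ≤ 5 * T.Omega n * ‖φ‖ := by
  rw [ruelleStep_pow_apply, Omega, Finset.mul_sum, Finset.sum_mul, Finset.sum_filter]
  refine (norm_sum_le _ _).trans (Finset.sum_le_sum fun w _ => ?_)
  split_ifs with hw
  · have := T.norm_wordStep_le (List.ofFn w) φ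
    rwa [wordWeight_ofFn, abs_of_nonneg (Finset.prod_nonneg fun i _ => hg _)] at this
  · have : T.wordStep (List.ofFn w) φ = 0 := by
      refine Step.ext fun y => T.wordStep_of_notMem φ fun hy => hw ?_
      exact T.wordImage_nonempty.1 ⟨y, hy⟩
    rw [this, norm_zero]

open Classical in
theorem ruelleStep_pow_one_apply (n : ℕ) (y : Ioo T.a T.b) :
    ((T.ruelleStep ^ n) (Step.one T.a T.b)) y =
      ((∑ w : Fin n → Fin (d + 1) with y ∈ T.wordImage (List.ofFn w), ∏ i, T.g (w i) : ℝ) : ℂ) := by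
  rw [ruelleStep_pow_apply, Step_sum_apply, Finset.sum_filter, Complex.ofReal_sum]
  refine Finset.sum_congr rfl fun w _ => ?_
  split_ifs with hy
  · obtain ⟨x, hx, hxy⟩ := hy
    rw [T.wordStep_apply (x := ⟨x, T.cylinder_subset _ hx⟩) _ hx hxy, wordWeight_ofFn]
    exact mul_one _
  · rw [T.wordStep_of_notMem _ hy, Complex.ofReal_zero]

theorem Omega_nonneg (hg : ∀ k, 0 ≤ T.g k) (n : ℕ) : 0 ≤ T.Omega n :=
  Finset.sum_nonneg fun _ _ => Finset.prod_nonneg fun _ _ => hg _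

theorem bddAbove_supNorm (n : ℕ) :
    BddAbove (range fun y : Ioo T.a T.b => ‖((T.ruelleStep ^ n) (Step.one T.a T.b)) y‖) :=
  ⟨_, by rintro _ ⟨y, rfl⟩; exact Step.norm_apply_le _ y⟩

theorem supNormIterOne_nonneg (n : ℕ) : 0 ≤ T.supNormIterOne n :=
  Real.iSup_nonneg fun _ => norm_nonneg _

open Classical in
theorem sum_le_supNorm (n : ℕ) (y : Ioo T.a T.b) :
    ∑ w : Fin n → Fin (d + 1) with y ∈ T.wordImage (List.ofFn w), ∏ i, T.g (w i) ≤
      T.supNormIterOne n := by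
  refine le_trans ?_ (le_ciSup (T.bddAbove_supNorm n) y)
  rw [ruelleStep_pow_one_apply, Complex.norm_real]
  exact le_abs_self _

/-- Few points meet the images of all cylinders. -/
theorem exists_hitting_set (n : ℕ) : ∃ S : Finset (Ioo T.a T.b),
    S.card ≤ (2 * (d + 1) * (n + 1)) ^ 2 ∧
    ∀ w : Fin n → Fin (d + 1), w ∈ T.Z n → ∃ y ∈ S, y ∈ T.wordImage (List.ofFn w) := by
  classical
  have : Nonempty (Ioo T.a T.b) := nonempty_Ioo_subtype (Fact.out : T.a < T.b)
  -- One point per pair of orbit germs suffices, because the pair alone determines the image of the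
  -- cylinder.
  let pt : Germ T.a T.b × Germ T.a T.b → Ioo T.a T.b := fun p =>
    if h : ∃ y : Ioo T.a T.b, ¬ (p.1.Below y ↔ p.2.Below y) then h.choose else Classical.arbitrary _
  refine ⟨(T.orbitGerms n ×ˢ T.orbitGerms n).image pt, ?_, fun w hw => ?_⟩
  · refine Finset.card_image_le.trans ?_
    rw [Finset.card_product, sq]
    exact Nat.mul_le_mul (T.card_orbitGerms_le n) (T.card_orbitGerms_le n)
  · obtain ⟨x, hx, x', hx', h⟩ := T.exists_germs_of_wordImage (List.ofFn w)
    rw [List.length_ofFn] at hx hx'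
    obtain ⟨y, hy⟩ := T.wordImage_nonempty.2 hw
    have hex : ∃ y : Ioo T.a T.b, ¬ (x.Below y ↔ x'.Below y) := ⟨y, (h y).1 hy⟩
    refine ⟨pt (x, x'), Finset.mem_image_of_mem _ (Finset.mk_mem_product hx hx'), ?_⟩
    rw [h, show pt (x, x') = hex.choose from dif_pos hex]
    exact hex.choose_spec

/-- Double counting: the weight of each admissible word is counted at some point of the hitting set,
and the weights counted at one point `y` add up to `Lⁿ 1 (y)`. Nonnegativity of the weights allows
overcounting. -/
theorem Omega_le (hg : ∀ k, 0 ≤ T.g k) (n : ℕ) :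
    T.Omega n ≤ (2 * (d + 1) * (n + 1)) ^ 2 * T.supNormIterOne n := by
  classical
  obtain ⟨S, hS, hit⟩ := T.exists_hitting_set n
  have hp : ∀ w : Fin n → Fin (d + 1), 0 ≤ ∏ i, T.g (w i) :=
    fun w => Finset.prod_nonneg fun _ _ => hg _
  calc T.Omega n ≤ ∑ w : Fin n → Fin (d + 1),
        ∑ y ∈ S, if y ∈ T.wordImage (List.ofFn w) then ∏ i, T.g (w i) else 0 := by
        rw [Omega, Finset.sum_filter]
        refine Finset.sum_le_sum fun w _ => ?_
        split_ifs with hw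
        · obtain ⟨y, hyS, hy⟩ := hit w hw
          refine le_trans (le_of_eq ?_) (Finset.single_le_sum (fun z _ => ?_) hyS)
          · rw [if_pos hy]
          · split_ifs
            · exact hp w
            · exact le_rfl
        · exact Finset.sum_nonneg fun z _ => by
            split_ifs
            · exact hp w
            · exact le_rfl
    _ = ∑ y ∈ S, ∑ w : Fin n → Fin (d + 1) with y ∈ T.wordImage (List.ofFn w), ∏ i, T.g (w i) := by
        rw [Finset.sum_comm]
        exact Finset.sum_congr rfl fun y _ => (Finset.sum_filter _ _).symm
    _ ≤ ∑ y ∈ S, T.supNormIterOne n := Finset.sum_le_sum fun y _ => T.sum_le_supNorm n y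
    _ = S.card * T.supNormIterOne n := by rw [Finset.sum_const, nsmul_eq_mul]
    _ ≤ _ := by
        refine mul_le_mul_of_nonneg_right ?_ (T.supNormIterOne_nonneg n)
        exact_mod_cast hS

/-! ### The operator on the completion -/

theorem ruelle_pow_coe (n : ℕ) (φ : Step T.a T.b) :
    (T.ruelle ^ n) (φ : SBV T.a T.b) = ((T.ruelleStep ^ n) φ : Step T.a T.b) := by
  induction n generalizing φ with
  | zero => rfl
  | succ n ih =>
    rw [pow_succ, pow_succ, Module.End.mul_apply, ← ih, ← ruelle_coe]
    rfl

theorem norm_ruelle_pow_le (hg : ∀ k, 0 ≤ T.g k) (n : ℕ) : ‖T.ruelle ^ n‖ ≤ 5 * T.Omega n := by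
  have h0 : 0 ≤ 5 * T.Omega n := mul_nonneg (by norm_num) (T.Omega_nonneg hg n)
  refine ContinuousLinearMap.opNorm_le_bound _ h0 fun u => ?_
  refine UniformSpace.Completion.induction_on u ?_ fun φ => ?_
  · exact isClosed_le (by fun_prop) (by fun_prop)
  · rw [ruelle_pow_coe, UniformSpace.Completion.norm_coe, UniformSpace.Completion.norm_coe]
    exact T.norm_ruelleStep_pow_le hg n φ

theorem norm_one_le : ‖Step.one T.a T.b‖ ≤ 2 := by
  have h1 : ‖boundary (Step.one T.a T.b).toFun‖ ≤ 2 * 1 :=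
    (Step.one T.a T.b).norm_boundary_le fun y => le_of_eq norm_one
  have h2 : eVariationOn (Step.one T.a T.b).toFun univ = 0 :=
    eVariationOn.constant_on (by rintro _ ⟨u, -, rfl⟩ _ ⟨v, -, rfl⟩; rfl)
  rw [Step.norm_def, h2, ENNReal.toReal_zero, zero_add]
  linarith

theorem supNormIterOne_le (n : ℕ) : T.supNormIterOne n ≤ 2 * ‖T.ruelle ^ n‖ := by
  have : Nonempty (Ioo T.a T.b) := nonempty_Ioo_subtype (Fact.out : T.a < T.b)
  refine ciSup_le fun y => (Step.norm_apply_le _ y).trans ?_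
  rw [← UniformSpace.Completion.norm_coe, ← ruelle_pow_coe, mul_comm]
  refine ((T.ruelle ^ n).le_opNorm _).trans (mul_le_mul_of_nonneg_left ?_ (norm_nonneg _))
  rw [UniformSpace.Completion.norm_coe]
  exact T.norm_one_le

theorem one_ne_zero : (Step.one T.a T.b) ≠ 0 := by
  obtain ⟨y⟩ : Nonempty (Ioo T.a T.b) := nonempty_Ioo_subtype (Fact.out : T.a < T.b)
  intro h
  have : (Step.one T.a T.b) y = (0 : Step T.a T.b) y := by rw [h]
  exact _root_.one_ne_zero (α := ℂ) this

instance : Nontrivial (SBV T.a T.b) :=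
  ⟨(Step.one T.a T.b : Step T.a T.b), 0, fun h => T.one_ne_zero (by
    have : ‖((Step.one T.a T.b : Step T.a T.b) : SBV T.a T.b)‖ = 0 := by rw [h, norm_zero]
    rwa [UniformSpace.Completion.norm_coe, norm_eq_zero] at this)⟩

/-- The cycle `‖Lⁿ 1‖_∞ ≤ 2 ‖Lⁿ‖ ≤ 10 Ω_n ≤ 10 (2(d+1)(n+1))² ‖Lⁿ 1‖_∞` makes the three sequences
comparable up to polynomial factors, and Gelfand's formula applies to the middle one. -/
theorem tendsto_supNorm (hg : ∀ k, 0 ≤ T.g k) :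
    Tendsto (fun n : ℕ => T.supNormIterOne n ^ (1 / (n : ℝ))) atTop (𝓝 T.spRadius) := by
  refine tendsto_rpow_of_comparable (C := 5 * (2 * (d + 1)) ^ 2) (by positivity)
    (fun n => norm_nonneg _) T.supNormIterOne_nonneg (fun n => ?_) (fun n => ?_)
    (tendsto_norm_pow_rpow T.ruelle)
  · refine (T.supNormIterOne_le n).trans (mul_le_mul_of_nonneg_right ?_ (norm_nonneg _))
    have h1 : (0:ℝ) ≤ n := n.cast_nonneg
    have h2 : (0:ℝ) ≤ d := d.cast_nonneg
    have h3 : (1:ℝ) ≤ ((d:ℝ) + 1) ^ 2 := by nlinarith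
    have h4 : (1:ℝ) ≤ ((n:ℝ) + 1) ^ 2 := by nlinarith
    nlinarith
  · refine (T.norm_ruelle_pow_le hg n).trans ?_
    have := T.Omega_le hg n
    calc 5 * T.Omega n ≤ 5 * ((2 * (d + 1) * (n + 1)) ^ 2 * T.supNormIterOne n) := by linarith
      _ = _ := by ring

theorem tendsto_Omega (hg : ∀ k, 0 ≤ T.g k) :
    Tendsto (fun n : ℕ => T.Omega n ^ (1 / (n : ℝ))) atTop (𝓝 T.spRadius) := by
  refine tendsto_rpow_of_comparable (C := 5 * (2 * (d + 1)) ^ 2) (by positivity)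
    T.supNormIterOne_nonneg (T.Omega_nonneg hg) (fun n => ?_) (fun n => ?_) (T.tendsto_supNorm hg)
  · have h0 := T.supNormIterOne_nonneg n
    have h1 : 0 ≤ ((2 * ((d:ℝ) + 1) * (n + 1)) ^ 2) * T.supNormIterOne n := by positivity
    calc T.Omega n ≤ _ := T.Omega_le hg n
      _ ≤ 5 * ((2 * (d + 1) * (n + 1)) ^ 2 * T.supNormIterOne n) := by linarith
      _ = _ := by ring
  · have h1 := T.supNormIterOne_le n
    have h2 := T.norm_ruelle_pow_le hg n
    have h3 : T.supNormIterOne n ≤ 10 * T.Omega n := by linarith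
    refine h3.trans (mul_le_mul_of_nonneg_right ?_ (T.Omega_nonneg hg n))
    have h1 : (0:ℝ) ≤ n := n.cast_nonneg
    have h2 : (0:ℝ) ≤ d := d.cast_nonneg
    have h3 : (1:ℝ) ≤ ((d:ℝ) + 1) ^ 2 := by nlinarith
    have h4 : (1:ℝ) ≤ ((n:ℝ) + 1) ^ 2 := by nlinarith
    nlinarith

/-! ### Topological entropy -/

/-- Points close to a germ follow its itinerary for `n` steps. Hence `Z n` is never empty, whatever
the system. -/
theorem eventually_mem_cylinder (n : ℕ) (x : Germ T.a T.b) :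
    ∀ᶠ u in x.filter, u ∈ T.cylinder (List.ofFn fun i : Fin n => T.idx (T.fHat^[i] x)) := by
  induction n generalizing x with
  | zero => exact (GermMem.eventually (T.idx_spec x)).mono fun u hu => T.I_subset _ hu
  | succ n ih =>
    have h1 := (T.tendsto_fHat x).eventually (ih (T.fHat x))
    filter_upwards [GermMem.eventually (T.idx_spec x), h1] with u hu h2
    rw [List.ofFn_succ]
    exact ⟨hu, h2⟩

theorem Z_nonempty (n : ℕ) : (T.Z n).Nonempty := by
  obtain ⟨u, hu⟩ := (T.eventually_mem_cylinder n (T.cPlus 0)).exists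
  exact ⟨_, u, hu⟩

theorem Omega_eq_ncard (hg : ∀ k, T.g k = 1) (n : ℕ) : T.Omega n = (T.Z n).ncard := by
  classical
  rw [Omega, Set.ncard_eq_toFinset_card' (T.Z n)]
  simp only [hg, Finset.prod_const_one, Finset.sum_const, nsmul_eq_mul, mul_one]
  congr 2
  ext w
  simp

theorem entropy (hg : ∀ k, T.g k = 1) :
    Tendsto (fun n : ℕ => ((T.Z n).ncard : ℝ) ^ (1 / (n : ℝ))) atTop
      (𝓝 (Real.exp T.topEntropy)) ∧ T.spRadius = Real.exp T.topEntropy := by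
  have h := T.tendsto_Omega fun k => by rw [hg]; exact zero_le_one
  simp only [T.Omega_eq_ncard hg] at h
  -- Positivity of the limit is needed for `Real.exp` to undo `Real.log`, whose value at `0` is only
  -- a convention.
  have h1 : 1 ≤ T.spRadius := by
    refine ge_of_tendsto h (Eventually.of_forall fun n => Real.one_le_rpow ?_ (by positivity))
    exact_mod_cast (Set.ncard_pos (Set.toFinite _)).2 (T.Z_nonempty n)
  have h2 : T.spRadius = Real.exp T.topEntropy := by
    rw [topEntropy, h.limUnder_eq, Real.exp_log (by linarith)]
  exact ⟨h2 ▸ h, h2⟩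

end System

/-! ### Jumps of step functions -/

namespace Germ

variable {a b : EReal}

/-- The filter of a germ, on the points of `(a,b)`. -/
def pointFilter (x : Germ a b) : Filter (Ioo a b) := comap Subtype.val x.filter

theorem eventually_mem_Ioo (x : Germ a b) : ∀ᶠ w in x.filter, w ∈ Ioo a b := by
  rcases x with ⟨x, hx⟩ | ⟨x, hx⟩
  · filter_upwards [Ioo_mem_nhdsGT hx.2] with w hw using ⟨hx.1.trans_lt hw.1, hw.2⟩
  · filter_upwards [Ioo_mem_nhdsLT hx.1] with w hw using ⟨hw.1, hw.2.trans_le hx.2⟩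

instance (x : Germ a b) : x.pointFilter.NeBot := by
  refine NeBot.comap_of_range_mem inferInstance ?_
  rw [Subtype.range_coe]
  exact x.eventually_mem_Ioo

theorem eventually_pointFilter {x : Germ a b} {p : EReal → Prop} (h : ∀ᶠ w in x.filter, p w) :
    ∀ᶠ u : Ioo a b in x.pointFilter, p u := tendsto_comap.eventually h

theorem exists_eq_step (x : Germ a b) (φ : Step a b) : ∃ l, ∀ᶠ u in x.pointFilter, φ u = l := by
  obtain ⟨C, hC, hφ⟩ := φ.2
  rcases x with ⟨x, hx⟩ | ⟨x, hx⟩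
  · have h1 : ∀ᶠ w : EReal in 𝓝[>] x, ∀ c ∈ C, (c : EReal) ≤ x ∨ w < c := by
      rw [eventually_all_finite hC]
      intro c _
      rcases le_or_gt (c : EReal) x with h | h
      · exact Eventually.of_forall fun _ => Or.inl h
      · filter_upwards [mem_nhdsWithin_of_mem_nhds (Iio_mem_nhds h)] with w hw using Or.inr hw
    have : (𝓝[>] x).NeBot := nhdsGT_neBot_of_exists_gt ⟨b, hx.2⟩
    obtain ⟨w, hw, hwI⟩ := (h1.and (Ioo_mem_nhdsGT hx.2)).exists
    have hw' : w ∈ Ioo a b := ⟨hx.1.trans_lt hwI.1, hwI.2⟩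
    refine ⟨φ ⟨w, hw'⟩, ?_⟩
    have h2 : ∀ᶠ v in 𝓝[>] x, v ∈ Ioo x w := Ioo_mem_nhdsGT hwI.1
    filter_upwards [eventually_pointFilter (x := .plus x hx) h2] with u hu
    refine hφ _ _ (disjoint_left.2 fun c hc hcC => ?_)
    rw [uIcc_of_le (show u ≤ ⟨w, hw'⟩ from hu.2.le)] at hc
    rcases hw c hcC with h | h
    · exact absurd (show (u : EReal) ≤ c from hc.1) (not_le.2 (h.trans_lt hu.1))
    · exact absurd (show (c : EReal) ≤ w from hc.2) (not_le.2 h)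
  · have h1 : ∀ᶠ w : EReal in 𝓝[<] x, ∀ c ∈ C, x ≤ (c : EReal) ∨ c < w := by
      rw [eventually_all_finite hC]
      intro c _
      rcases le_or_gt x (c : EReal) with h | h
      · exact Eventually.of_forall fun _ => Or.inl h
      · filter_upwards [mem_nhdsWithin_of_mem_nhds (Ioi_mem_nhds h)] with w hw using Or.inr hw
    have : (𝓝[<] x).NeBot := nhdsLT_neBot_of_exists_lt ⟨a, hx.1⟩
    obtain ⟨w, hw, hwI⟩ := (h1.and (Ioo_mem_nhdsLT hx.1)).exists
    have hw' : w ∈ Ioo a b := ⟨hwI.1, hwI.2.trans_le hx.2⟩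
    refine ⟨φ ⟨w, hw'⟩, ?_⟩
    have h2 : ∀ᶠ v in 𝓝[<] x, v ∈ Ioo w x := Ioo_mem_nhdsLT hwI.2
    filter_upwards [eventually_pointFilter (x := .minus x hx) h2] with u hu
    refine hφ _ _ (disjoint_left.2 fun c hc hcC => ?_)
    rw [uIcc_of_ge (show ⟨w, hw'⟩ ≤ u from hu.1.le)] at hc
    rcases hw c hcC with h | h
    · exact absurd (show (c : EReal) ≤ u from hc.2) (not_le.2 (hu.2.trans_le h))
    · exact absurd (show w ≤ (c : EReal) from hc.1) (not_le.2 h)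

/-- The value of a step function at a germ. -/
def val (x : Germ a b) (φ : Step a b) : ℂ := (x.exists_eq_step φ).choose

theorem val_spec (x : Germ a b) (φ : Step a b) : ∀ᶠ u in x.pointFilter, φ u = x.val φ :=
  (x.exists_eq_step φ).choose_spec

theorem val_eq {x : Germ a b} {φ : Step a b} {l : ℂ} (h : ∀ᶠ u in x.pointFilter, φ u = l) :
    x.val φ = l := by
  obtain ⟨u, h1, h2⟩ := (h.and (x.val_spec φ)).exists
  rw [← h1, h2]

theorem val_add (x : Germ a b) (φ ψ : Step a b) : x.val (φ + ψ) = x.val φ + x.val ψ := by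
  refine val_eq ?_
  filter_upwards [x.val_spec φ, x.val_spec ψ] with u h1 h2
  rw [Step.add_apply, h1, h2]

theorem val_smul (x : Germ a b) (c : ℂ) (φ : Step a b) : x.val (c • φ) = c * x.val φ := by
  refine val_eq ?_
  filter_upwards [x.val_spec φ] with u h1
  rw [Step.smul_apply, h1]

open Classical in
/-- The jump of a step function between a germ and its base point; the boundary value is recorded
at the germ `a⁺`. -/
def jump (φ : Step a b) : Germ a b → ℂ
  | .plus u hu => if h : a < u then (Germ.plus u hu).val φ - φ ⟨u, mem_Ioo.2 ⟨h, hu.2⟩⟩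
    else boundary φ.toFun
  | .minus u hu => if h : u < b then φ ⟨u, mem_Ioo.2 ⟨hu.1, h⟩⟩ - (Germ.minus u hu).val φ else 0

theorem jump_plus (φ : Step a b) (u : Ioo a b) (h : (u : EReal) ∈ Ico a b) :
    jump φ (.plus u h) = (Germ.plus (u : EReal) h).val φ - φ u := dif_pos u.2.1

theorem jump_minus (φ : Step a b) (u : Ioo a b) (h : (u : EReal) ∈ Ioc a b) :
    jump φ (.minus u h) = φ u - (Germ.minus (u : EReal) h).val φ := dif_pos u.2.2

theorem step_of_below {x : Germ a b} {u : EReal} (hu : u ∈ Ioo a b) (h : x.Below u) :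
    x.step ⟨u, hu⟩ = 1 / 2 := by
  classical
  rw [step_apply, if_pos h]

theorem step_of_not_below {x : Germ a b} {u : EReal} (hu : u ∈ Ioo a b) (h : ¬ x.Below u) :
    x.step ⟨u, hu⟩ = -1 / 2 := by
  classical
  rw [step_apply, if_neg h]

theorem val_step_of_below {x z : Germ a b} (h : ∀ᶠ w in z.filter, x.Below w) :
    z.val x.step = 1 / 2 := by
  classical
  refine val_eq ?_
  filter_upwards [eventually_pointFilter h] with u hu
  rw [step_apply, if_pos hu]

theorem val_step_of_not_below {x z : Germ a b} (h : ∀ᶠ w in z.filter, ¬ x.Below w) :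
    z.val x.step = -1 / 2 := by
  classical
  refine val_eq ?_
  filter_upwards [eventually_pointFilter h] with u hu
  rw [step_apply, if_neg hu]

variable [Fact (a < b)]

theorem jump_add (φ ψ : Step a b) (x : Germ a b) : jump (φ + ψ) x = jump φ x + jump ψ x := by
  rcases x with ⟨u, hu⟩ | ⟨u, hu⟩
  · rw [jump, jump, jump]
    split_ifs
    · rw [val_add, Step.add_apply]; ring
    · exact boundary_add φ ψ
  · rw [jump, jump, jump]
    split_ifs
    · rw [val_add, Step.add_apply]; ring
    · rw [add_zero]

theorem jump_smul (c : ℂ) (φ : Step a b) (x : Germ a b) : jump (c • φ) x = c * jump φ x := by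
  rcases x with ⟨u, hu⟩ | ⟨u, hu⟩
  · rw [jump, jump]
    split_ifs
    · rw [val_smul, Step.smul_apply]; ring
    · exact boundary_smul c φ
  · rw [jump, jump]
    split_ifs
    · rw [val_smul, Step.smul_apply]; ring
    · rw [mul_zero]

/-- The jumps as a linear map. -/
def jumpMap : Step a b →ₗ[ℂ] (Germ a b → ℂ) where
  toFun := jump
  map_add' φ ψ := funext fun x => jump_add φ ψ x
  map_smul' c φ := funext fun x => jump_smul c φ x

/-- The germ `a⁺`. -/
def left : Germ a b := .plus a ⟨le_rfl, Fact.out⟩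

/-- The germ `b⁻`. -/
def right : Germ a b := .minus b ⟨Fact.out, le_rfl⟩

theorem jump_right (φ : Step a b) : jump φ right = 0 := dif_neg (lt_irrefl b)

theorem jump_left (φ : Step a b) : jump φ left = boundary φ.toFun := dif_neg (lt_irrefl a)

theorem boundary_const {φ : Step a b} {c : ℂ} (h : ∀ u, φ u = c) : boundary φ.toFun = 2 * c := by
  rw [boundary, leftValue_eq (Eventually.of_forall h), rightValue_eq (Eventually.of_forall h)]
  ring

open Classical in
theorem jump_const {φ : Step a b} {c : ℂ} (h : ∀ u, φ u = c) (x : Germ a b) :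
    jump φ x = if x = left then 2 * c else 0 := by
  have hv : x.val φ = c := val_eq (Eventually.of_forall h)
  rcases x with ⟨u, hu⟩ | ⟨u, hu⟩
  · rw [jump]
    split_ifs with h1 h2 h2
    · have : u = a := by injection h2
      exact absurd h1 (by simp [this])
    · rw [hv, h, sub_self]
    · exact boundary_const h
    · exact absurd (by rw [left]; congr 1; exact le_antisymm (not_lt.1 h1) hu.1) h2
  · rw [if_neg (by rw [left]; exact fun h => by injection h), jump]
    split_ifs
    · rw [hv, h, sub_self]
    · rfl

theorem boundary_step {x : Germ a b} {u v : Ioo a b} (hu : ¬ x.Below u) (hv : x.Below v) :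
    boundary x.step.toFun = 0 := by
  classical
  have h1 : ∀ᶠ w in atBot, x.step.toFun w = -1 / 2 := by
    filter_upwards [eventually_le_atBot u] with w hw
    rw [step_apply, if_neg fun h => hu (h.mono hw)]
  have h2 : ∀ᶠ w in atTop, x.step.toFun w = 1 / 2 := by
    filter_upwards [eventually_ge_atTop v] with w hw
    rw [step_apply, if_pos (hv.mono hw)]
  rw [boundary, leftValue_eq h1, rightValue_eq h2]
  norm_num

theorem exists_not_below_below {x : Germ a b} (hl : x ≠ left) (hr : x ≠ right) :
    ∃ u v : Ioo a b, ¬ x.Below u ∧ x.Below v := by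
  have hb : x.base ∈ Ioo a b := by
    rcases x with ⟨x, hx⟩ | ⟨x, hx⟩
    · exact ⟨lt_of_le_of_ne hx.1 fun h => hl (by rw [left]; congr 1; exact h.symm), hx.2⟩
    · exact ⟨hx.1, lt_of_le_of_ne hx.2 fun h => hr (by rw [right]; congr 1)⟩
  obtain ⟨u, hu⟩ := exists_between hb.1
  obtain ⟨v, hv⟩ := exists_between hb.2
  refine ⟨⟨u, hu.1, hu.2.trans hb.2⟩, ⟨v, hb.1.trans hv.1, hv.2⟩, ?_, ?_⟩
  · rcases x with ⟨x, hx⟩ | ⟨x, hx⟩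
    · exact not_lt.2 hu.2.le
    · exact not_le.2 hu.2
  · rcases x with ⟨x, hx⟩ | ⟨x, hx⟩
    · exact hv.1
    · exact hv.1.le

open Classical in
-- Steps at inner germs have boundary value `-1/2 + 1/2 = 0`, so they jump only at their own germ.
-- The step at `a⁺` is the constant `1/2`, whose boundary value `1` is recorded there. The germ `b⁻`
-- is excluded: its step is the constant `-1/2`.
theorem jump_step {x : Germ a b} (hr : x ≠ right) (z : Germ a b) :
    jump x.step z = if z = x then 1 else 0 := by
  by_cases hl : x = left
  · subst hl
    have : ∀ u : Ioo a b, (left : Germ a b).step u = 1 / 2 := fun u => by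
      rw [step_apply]; exact if_pos u.2.1
    rw [jump_const this]
    norm_num
  obtain ⟨u₀, v₀, hu₀, hv₀⟩ := exists_not_below_below hl hr
  have hbd := boundary_step hu₀ hv₀
  have gt : ∀ u : EReal, ∀ᶠ w in 𝓝[>] u, u < w := fun u => self_mem_nhdsWithin
  have lt : ∀ u : EReal, ∀ᶠ w in 𝓝[<] u, w < u := fun u => self_mem_nhdsWithin
  have gt' : ∀ {u x : EReal}, u < x → ∀ᶠ w in 𝓝[>] u, w < x := fun h =>
    mem_nhdsWithin_of_mem_nhds (Iio_mem_nhds h)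
  have lt' : ∀ {u x : EReal}, x < u → ∀ᶠ w in 𝓝[<] u, x < w := fun h =>
    mem_nhdsWithin_of_mem_nhds (Ioi_mem_nhds h)
  rcases z with ⟨u, hu⟩ | ⟨u, hu⟩
  · rw [jump]
    split_ifs with h1 h2 h2
    · subst h2
      rw [val_step_of_below (x := .plus u hu) (z := .plus u hu)
        (gt u),
        step_of_not_below (x := .plus u hu) _ (show ¬ u < u from lt_irrefl u)]
      norm_num
    · rcases x with ⟨x, hx⟩ | ⟨x, hx⟩
      · rcases lt_trichotomy x u with h | rfl | h
        · rw [val_step_of_below (x := .plus x hx) (z := .plus u hu)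
            ((gt u).mono fun w hw => h.trans hw),
            step_of_below (x := .plus x hx) _ (show x < u from h)]
          norm_num
        · exact absurd rfl h2
        · rw [val_step_of_not_below (x := .plus x hx) (z := .plus u hu)
            ((gt' h).mono fun w hw => not_lt.2 (le_of_lt hw)),
            step_of_not_below (x := .plus x hx) _ (show ¬ x < u from not_lt.2 h.le)]
          norm_num
      · rcases le_or_gt x u with h | h
        · rw [val_step_of_below (x := .minus x hx) (z := .plus u hu)
            ((gt u).mono fun w hw => h.trans (le_of_lt hw)),
            step_of_below (x := .minus x hx) _ (show x ≤ u from h)]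
          norm_num
        · rw [val_step_of_not_below (x := .minus x hx) (z := .plus u hu)
            ((gt' h).mono fun w hw => not_le.2 hw),
            step_of_not_below (x := .minus x hx) _ (show ¬ x ≤ u from not_le.2 h)]
          norm_num
    · subst h2
      exact absurd (by rw [left]; congr 1; exact le_antisymm (not_lt.1 h1) hu.1) hl
    · exact hbd
  · rw [jump]
    split_ifs with h1 h2 h2
    · subst h2
      rw [val_step_of_not_below (x := .minus u hu) (z := .minus u hu)
        ((lt u).mono fun w hw => not_le.2 hw),
        step_of_below (x := .minus u hu) _ (show u ≤ u from le_rfl)]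
      norm_num
    · rcases x with ⟨x, hx⟩ | ⟨x, hx⟩
      · rcases lt_or_ge x u with h | h
        · rw [val_step_of_below (x := .plus x hx) (z := .minus u hu)
            (lt' h),
            step_of_below (x := .plus x hx) _ (show x < u from h)]
          norm_num
        · rw [val_step_of_not_below (x := .plus x hx) (z := .minus u hu)
            ((lt u).mono fun w hw => not_lt.2 ((le_of_lt hw).trans h)),
            step_of_not_below (x := .plus x hx) _ (show ¬ x < u from not_lt.2 h)]
          norm_num
      · rcases lt_trichotomy x u with h | rfl | h
        · rw [val_step_of_below (x := .minus x hx) (z := .minus u hu)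
            ((lt' h).mono fun w hw => le_of_lt hw),
            step_of_below (x := .minus x hx) _ (show x ≤ u from h.le)]
          norm_num
        · exact absurd rfl h2
        · rw [val_step_of_not_below (x := .minus x hx) (z := .minus u hu)
            ((lt u).mono fun w hw => not_le.2 (lt_trans hw h)),
            step_of_not_below (x := .minus x hx) _ (show ¬ x ≤ u from not_le.2 h)]
          norm_num
    · subst h2
      exact absurd (by rw [right]; congr 1; exact le_antisymm hu.2 (not_lt.1 h1)) hr
    · rfl

theorem step_left_add_step_right : (left : Germ a b).step + (right : Germ a b).step = 0 := by
  classical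
  refine Step.ext fun y => ?_
  have h1 : (left : Germ a b).Below y := y.2.1
  have h2 : ¬ (right : Germ a b).Below y := not_le.2 y.2.2
  rw [Step.add_apply, step_apply, step_apply, if_pos h1, if_neg h2, Step.zero_apply]
  norm_num

/-- A step function without jumps vanishes. -/
theorem eq_zero_of_jump {φ : Step a b} (h : ∀ x, jump φ x = 0) : φ = 0 := by
  -- Without jumps at `u⁺` and `u⁻` the function is constant near each `u`, hence constant on the
  -- connected interval. The boundary value, recorded at `a⁺`, is twice that constant.
  have hloc : IsLocallyConstant φ.toFun := by
    rw [IsLocallyConstant.iff_eventually_eq]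
    intro u
    have hp := sub_eq_zero.1 ((jump_plus φ u ⟨u.2.1.le, u.2.2⟩).symm.trans (h _))
    have hm := sub_eq_zero.1 ((jump_minus φ u ⟨u.2.1, u.2.2.le⟩).symm.trans (h _))
    have h1 := (Germ.plus (u : EReal) ⟨u.2.1.le, u.2.2⟩ : Germ a b).val_spec φ
    have h2 := (Germ.minus (u : EReal) ⟨u.2.1, u.2.2.le⟩ : Germ a b).val_spec φ
    rw [hp, pointFilter, eventually_comap] at h1
    rw [← hm, pointFilter, eventually_comap] at h2
    rw [nhds_subtype_eq_comap, eventually_comap]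
    have h3 : ∀ᶠ w in 𝓝[≠] (u : EReal), ∀ v : Ioo a b, (v : EReal) = w → φ v = φ u := by
      rw [← nhdsLT_sup_nhdsGT, eventually_sup]
      exact ⟨h2, h1⟩
    rw [eventually_nhdsWithin_iff] at h3
    filter_upwards [h3] with w hw v hv
    rcases eq_or_ne w u with e | e
    · rw [Subtype.ext (hv.trans e)]
    · exact hw e v hv
  have : PreconnectedSpace (Ioo a b) := Subtype.preconnectedSpace isPreconnected_Ioo
  obtain ⟨u⟩ : Nonempty (Ioo a b) := nonempty_Ioo_subtype (Fact.out : a < b)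
  have hc : ∀ v, φ v = φ u := fun v => hloc.apply_eq_of_preconnectedSpace v u
  have h0 := h left
  rw [jump_left, boundary_const hc] at h0
  refine Step.ext fun v => ?_
  rw [hc v, Step.zero_apply]
  simpa using h0

end Germ

/-! ### Expansion of step functions in germs -/

namespace Germ

variable {a b : EReal}

/-- The germ `u⁺` of an inner point. -/
def plusAt (u : Ioo a b) : Germ a b := .plus u ⟨u.2.1.le, u.2.2⟩

/-- The germ `u⁻` of an inner point. -/
def minusAt (u : Ioo a b) : Germ a b := .minus u ⟨u.2.1, u.2.2.le⟩

theorem plusAt_injective : Function.Injective (plusAt : Ioo a b → Germ a b) := fun _ _ h =>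
  Subtype.ext (congrArg base h)

theorem minusAt_injective : Function.Injective (minusAt : Ioo a b → Germ a b) := fun _ _ h =>
  Subtype.ext (congrArg base h)

theorem jump_plusAt (φ : Step a b) (u : Ioo a b) : jump φ (plusAt u) = (plusAt u).val φ - φ u :=
  jump_plus φ u _

theorem jump_minusAt (φ : Step a b) (u : Ioo a b) : jump φ (minusAt u) = φ u - (minusAt u).val φ :=
  jump_minus φ u _

theorem eventually_plusAt {u v : Ioo a b} (h : u < v) :
    ∀ᶠ w in (plusAt u).pointFilter, u < w ∧ w < v := by
  have : ∀ᶠ w in (plusAt u).filter, w ∈ Ioo (u : EReal) v := Ioo_mem_nhdsGT h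
  exact eventually_pointFilter this

theorem eventually_minusAt {u v : Ioo a b} (h : v < u) :
    ∀ᶠ w in (minusAt u).pointFilter, v < w ∧ w < u := by
  have : ∀ᶠ w in (minusAt u).filter, w ∈ Ioo (v : EReal) u := Ioo_mem_nhdsLT h
  exact eventually_pointFilter this

/-- Induction on the largest point `m`. Points `l < m < r` at which `φ` already takes its one-sided
values at `m` turn both jumps into variations over `[l, m]` and `[m, r]`. With `l` above the
remaining points, these intervals follow `(-∞, l]` and the variations add. -/
theorem sum_jump_le_Iic (φ : Step a b) (s : Finset (Ioo a b)) :
    ∀ v, (∀ u ∈ s, u < v) →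
      ∑ u ∈ s, (‖jump φ (plusAt u)‖ₑ + ‖jump φ (minusAt u)‖ₑ) ≤ eVariationOn φ.toFun (Iic v) := by
  classical
  induction s using Finset.induction_on_max with
  | empty => simp
  | insert m s hm ih =>
    intro v hv
    have hmv := hv m (Finset.mem_insert_self _ _)
    have : Nonempty (Ioo a b) := ⟨m⟩
    obtain ⟨l₀, hl₀⟩ := exists_lt m
    have hs : ∀ᶠ w in (minusAt m).pointFilter, ∀ u ∈ s, u < w := by
      rw [eventually_all_finset]
      exact fun u hu => (eventually_minusAt (hm u hu)).mono fun _ h => h.1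
    obtain ⟨l, ⟨hl, hlm⟩, hls⟩ :=
      (((minusAt m).val_spec φ).and (eventually_minusAt hl₀) |>.and hs).exists
    obtain ⟨r, hr, hmr⟩ := (((plusAt m).val_spec φ).and (eventually_plusAt hmv)).exists
    rw [Finset.sum_insert fun h => lt_irrefl m (hm m h)]
    have h1 : ‖jump φ (plusAt m)‖ₑ ≤ eVariationOn φ.toFun (Icc m r) := by
      rw [jump_plusAt, ← hr, ← edist_eq_enorm_sub]
      exact eVariationOn.edist_le _ (right_mem_Icc.2 hmr.1.le) (left_mem_Icc.2 hmr.1.le)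
    have h2 : ‖jump φ (minusAt m)‖ₑ ≤ eVariationOn φ.toFun (Icc l m) := by
      rw [jump_minusAt, ← hl, ← edist_eq_enorm_sub]
      exact eVariationOn.edist_le _ (right_mem_Icc.2 hlm.2.le) (left_mem_Icc.2 hlm.2.le)
    calc _ ≤ eVariationOn φ.toFun (Icc m r) + eVariationOn φ.toFun (Icc l m) +
          eVariationOn φ.toFun (Iic l) := add_le_add (add_le_add h1 h2) (ih l hls)
      _ = eVariationOn φ.toFun (Iic l) + (eVariationOn φ.toFun (Icc l m) +
          eVariationOn φ.toFun (Icc m r)) := by ring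
      _ ≤ eVariationOn φ.toFun (Iic l) + eVariationOn φ.toFun (Icc l m ∪ Icc m r) := by
          gcongr
          exact eVariationOn.add_le_union _ fun x hx y hy => hx.2.trans hy.1
      _ ≤ eVariationOn φ.toFun (Iic l ∪ (Icc l m ∪ Icc m r)) := by
          refine eVariationOn.add_le_union _ fun x hx y hy => le_trans hx ?_
          rcases hy with hy | hy
          · exact hy.1
          · exact hlm.2.le.trans hy.1
      _ ≤ _ := by
          refine eVariationOn.mono _ ?_
          rintro x (hx | hx | hx)
          · exact le_trans hx (hlm.2.trans hmv).le
          · exact hx.2.trans hmv.le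
          · exact hx.2.trans hmr.2.le

theorem sum_norm_jump_le [Fact (a < b)] (φ : Step a b) (s : Finset (Ioo a b)) :
    ∑ u ∈ s, (‖jump φ (plusAt u)‖ + ‖jump φ (minusAt u)‖) ≤
      (eVariationOn φ.toFun univ).toReal := by
  have : Nonempty (Ioo a b) := nonempty_Ioo_subtype (Fact.out : a < b)
  obtain ⟨v, hv⟩ : ∃ v, ∀ u ∈ s, u < v := by
    obtain ⟨m, hm⟩ := s.bddAbove
    obtain ⟨v, hv⟩ := exists_gt m
    exact ⟨v, fun u hu => (hm hu).trans_lt hv⟩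
  have h := (sum_jump_le_Iic φ s v hv).trans (eVariationOn.mono _ (subset_univ _))
  have h2 := ENNReal.toReal_mono φ.boundedVariation h
  rw [ENNReal.toReal_sum fun u _ => by simp] at h2
  refine le_of_eq_of_le (Finset.sum_congr rfl fun u _ => ?_) h2
  rw [ENNReal.toReal_add (by simp) (by simp), toReal_enorm, toReal_enorm]

variable [Fact (a < b)]

theorem eq_left_or_eq_plusAt {u : EReal} (hu : u ∈ Ico a b) :
    (.plus u hu : Germ a b) = left ∨ ∃ v, (.plus u hu : Germ a b) = plusAt v := by
  rcases hu.1.eq_or_lt with e | h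
  · subst e
    exact Or.inl rfl
  · exact Or.inr ⟨⟨u, h, hu.2⟩, rfl⟩

theorem eq_right_or_eq_minusAt {u : EReal} (hu : u ∈ Ioc a b) :
    (.minus u hu : Germ a b) = right ∨ ∃ v, (.minus u hu : Germ a b) = minusAt v := by
  rcases hu.2.eq_or_lt with e | h
  · subst e
    exact Or.inl rfl
  · exact Or.inr ⟨⟨u, hu.1, h⟩, rfl⟩

open Classical in
/-- The germs at the points of a finite set, together with `a⁺`. -/
def germsAt (C : Finset (Ioo a b)) : Finset (Germ a b) :=
  {left} ∪ (C.image plusAt ∪ C.image minusAt)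

theorem exists_jump_support (φ : Step a b) :
    ∃ C : Finset (Ioo a b), ∀ x, x ∉ germsAt C → jump φ x = 0 := by
  classical
  obtain ⟨C, hC, hφ⟩ := φ.2
  refine ⟨hC.toFinset, fun x hx => ?_⟩
  simp only [germsAt, Finset.mem_union, Finset.mem_singleton, Finset.mem_image, Finite.mem_toFinset,
    not_or, not_exists, not_and] at hx
  have : Nonempty (Ioo a b) := nonempty_Ioo_subtype (Fact.out : a < b)
  rcases x with ⟨u, hu⟩ | ⟨u, hu⟩
  · rcases eq_left_or_eq_plusAt hu with h | ⟨v, h⟩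
    · exact absurd h hx.1
    rw [h] at hx ⊢
    have hv : v ∉ C := fun hvC => hx.2.1 v hvC rfl
    rw [jump_plusAt, sub_eq_zero]
    refine val_eq ?_
    have hs : ∀ᶠ w in (plusAt v).pointFilter, ∀ c ∈ C, ¬ (v < c ∧ c ≤ w) := by
      rw [eventually_all_finite hC]
      intro c _
      rcases lt_or_ge v c with h' | h'
      · exact (eventually_plusAt h').mono fun w hw h'' => absurd h''.2 (not_le.2 hw.2)
      · exact Eventually.of_forall fun w h'' => absurd h''.1 (not_lt.2 h')
    obtain ⟨r, hr⟩ := exists_gt v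
    filter_upwards [hs, eventually_plusAt hr] with w h1 h2
    refine hφ _ _ (disjoint_left.2 fun c hc hcC => ?_)
    rw [uIcc_of_ge h2.1.le] at hc
    exact h1 c hcC ⟨lt_of_le_of_ne hc.1 fun e => hv (e ▸ hcC), hc.2⟩
  · rcases eq_right_or_eq_minusAt hu with h | ⟨v, h⟩
    · rw [h, jump_right]
    rw [h] at hx ⊢
    have hv : v ∉ C := fun hvC => hx.2.2 v hvC rfl
    rw [jump_minusAt, sub_eq_zero, eq_comm]
    refine val_eq ?_
    have hs : ∀ᶠ w in (minusAt v).pointFilter, ∀ c ∈ C, ¬ (c < v ∧ w ≤ c) := by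
      rw [eventually_all_finite hC]
      intro c _
      rcases lt_or_ge c v with h' | h'
      · exact (eventually_minusAt h').mono fun w hw h'' => absurd h''.2 (not_le.2 hw.1)
      · exact Eventually.of_forall fun w h'' => absurd h''.1 (not_lt.2 h')
    obtain ⟨r, hr⟩ := exists_lt v
    filter_upwards [hs, eventually_minusAt hr] with w h1 h2
    refine hφ _ _ (disjoint_left.2 fun c hc hcC => ?_)
    rw [uIcc_of_le h2.2.le] at hc
    exact h1 c hcC ⟨lt_of_le_of_ne hc.2 fun e => hv (e ▸ hcC), hc.1⟩

/-- This is where the norm `var φ + |∂φ|` fits: the variation controls all inner jumps, and the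
boundary value is the entry at `a⁺`. The jump map is therefore a contraction into `ℓ¹`. -/
theorem sum_germsAt_le (φ : Step a b) (C : Finset (Ioo a b)) :
    ∑ x ∈ germsAt C, ‖jump φ x‖ ≤ ‖φ‖ := by
  classical
  have hu : ∀ A B : Finset (Germ a b), ∑ x ∈ A ∪ B, ‖jump φ x‖ ≤
      ∑ x ∈ A, ‖jump φ x‖ + ∑ x ∈ B, ‖jump φ x‖ := fun A B => by
    have := Finset.sum_union_inter (s₁ := A) (s₂ := B) (f := fun x => ‖jump φ x‖)
    have := Finset.sum_nonneg fun x (_ : x ∈ A ∩ B) => norm_nonneg (jump φ x)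
    linarith
  have h1 := hu {left} (C.image plusAt ∪ C.image minusAt)
  have h2 := hu (C.image plusAt) (C.image minusAt)
  have h3 := sum_norm_jump_le φ C
  rw [Finset.sum_image plusAt_injective.injOn, Finset.sum_image minusAt_injective.injOn,
    ← Finset.sum_add_distrib] at h2
  rw [Finset.sum_singleton, jump_left] at h1
  rw [Step.norm_def, germsAt]
  linarith

/-- Both sides have the same jumps, and jumps determine a step function. A possible term at `b⁻` is
harmless since its coefficient is zero. -/
theorem eq_sum_jump_smul_step {φ : Step a b} {S : Finset (Germ a b)}
    (hS : ∀ x, x ∉ S → jump φ x = 0) : φ = ∑ x ∈ S, jump φ x • x.step := by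
  classical
  rw [← sub_eq_zero]
  refine eq_zero_of_jump fun z => ?_
  change jumpMap (φ - ∑ x ∈ S, jump φ x • x.step) z = 0
  rw [map_sub, map_sum, Pi.sub_apply, Finset.sum_apply, sub_eq_zero]
  have h1 : ∀ x ∈ S, jumpMap (jump φ x • x.step) z = if z = x then jump φ z else 0 := by
    intro x _
    rw [map_smul, Pi.smul_apply, smul_eq_mul]
    change jump φ x * jump x.step z = _
    by_cases hr : x = right
    · rw [hr, jump_right, zero_mul]
      split_ifs with h
      · rw [h, jump_right]
      · rfl
    · rw [jump_step hr]
      split_ifs with h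
      · rw [h, mul_one]
      · rw [mul_zero]
  rw [Finset.sum_congr rfl h1, Finset.sum_ite_eq]
  split_ifs with h
  · rfl
  · exact hS z h

end Germ

/-! ### The jump map from `SBV` to `ℓ¹` of the germs and its left inverse -/

section Jumps

open Kneading.Germ

variable {a b : EReal} [Fact (a < b)]

theorem memℓp_jump (φ : Step a b) : Memℓp (jump φ) 1 := by
  obtain ⟨C, hC⟩ := exists_jump_support φ
  refine memℓp_gen (summable_of_ne_finset_zero (s := germsAt C) fun x hx => ?_)
  rw [hC x hx]
  simp

/-- The jumps of a step function, as an element of `ℓ¹` of the germs. -/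
def jumpStep : Step a b →L[ℂ] L1 (Germ a b) :=
  LinearMap.mkContinuous
    { toFun := fun φ => ⟨jump φ, memℓp_jump φ⟩
      map_add' := fun φ ψ => lp.ext (funext fun x => jump_add φ ψ x)
      map_smul' := fun c φ => lp.ext (funext fun x => jump_smul c φ x) } 1 fun φ => by
    obtain ⟨C, hC⟩ := exists_jump_support φ
    have h1 := hasSum_norm_L1 (⟨jump φ, memℓp_jump φ⟩ : L1 (Germ a b))
    have h2 : HasSum (fun x => ‖jump φ x‖) (∑ x ∈ germsAt C, ‖jump φ x‖) :=
      hasSum_sum_of_ne_finset_zero fun x hx => by rw [hC x hx, norm_zero]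
    rw [one_mul]
    exact (h1.unique h2).trans_le (sum_germsAt_le φ C)

theorem jumpStep_apply (φ : Step a b) (x : Germ a b) : jumpStep φ x = jump φ x := rfl

theorem jumpStep_eq_sum {φ : Step a b} {S : Finset (Germ a b)} (hS : ∀ x, x ∉ S → jump φ x = 0) :
    jumpStep φ = ∑ x ∈ S, jump φ x • unitVec x :=
  (hasSum_smul_unitVec (jumpStep φ)).unique (hasSum_sum_of_ne_finset_zero fun x hx => by
    rw [jumpStep_apply, hS x hx, zero_smul])

theorem jumpStep_step {x : Germ a b} (hr : x ≠ right) : jumpStep x.step = unitVec x := by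
  classical
  refine lp.ext (funext fun z => ?_)
  rw [jumpStep_apply, jump_step hr, unitVec]
  split_ifs with h
  · rw [h, lp.single_apply_self]
  · rw [lp.single_apply_ne _ _ _ h]

/-- The only unit vector on which `jumps ∘ synth` is not the identity. The discrepancy is a multiple
of `δ_{a⁺} + δ_{b⁻}`, the cut vector of index `0`, and the projection removes it. -/
theorem jumpStep_step_right : jumpStep (right : Germ a b).step = -unitVec left := by
  rw [eq_neg_of_add_eq_zero_right step_left_add_step_right, map_neg, jumpStep_step]
  rw [left, right]
  exact fun h => by injection h

/-- The jump map of `SBV(a,b)` into `ℓ¹` of the germs. -/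
def jumps : SBV a b →L[ℂ] L1 (Germ a b) :=
  jumpStep.extend (UniformSpace.Completion.toComplL : Step a b →L[ℂ] SBV a b)

theorem jumps_coe (φ : Step a b) : jumps (φ : SBV a b) = jumpStep φ :=
  jumpStep.extend_eq (e := (UniformSpace.Completion.toComplL : Step a b →L[ℂ] SBV a b))
    UniformSpace.Completion.denseRange_coe (UniformSpace.Completion.isUniformInducing_coe _) φ

/-- The synthesis map, sending the unit vector at a germ to its step. -/
def synth : L1 (Germ a b) →L[ℂ] SBV a b :=
  L1.lift (fun x => (x.step : SBV a b)) ⟨3, fun x => by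
    rw [UniformSpace.Completion.norm_coe]
    exact x.norm_step_le⟩

theorem synth_unitVec (x : Germ a b) : synth (unitVec x) = (x.step : SBV a b) :=
  L1.lift_unitVec _ _ x

theorem synth_jumps (φ : SBV a b) : synth (jumps φ) = φ := by
  refine UniformSpace.Completion.induction_on φ
    (isClosed_eq (synth.continuous.comp jumps.continuous) continuous_id) fun ψ => ?_
  obtain ⟨C, hC⟩ := exists_jump_support ψ
  rw [jumps_coe, jumpStep_eq_sum hC, map_sum]
  conv_rhs => rw [eq_sum_jump_smul_step hC]
  change _ = UniformSpace.Completion.toComplL (𝕜 := ℂ) _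
  rw [map_sum]
  refine Finset.sum_congr rfl fun x _ => ?_
  rw [map_smul, map_smul, synth_unitVec]
  rfl

end Jumps

/-! ### The weighted shift on germs -/

namespace System

variable {d : ℕ} (T : System d)

/-- The weighted composition operator `δ_x ↦ (s g)(x) δ_{f̂ x}` on `ℓ¹` of the germs. -/
def shift : L1 (Germ T.a T.b) →L[ℂ] L1 (Germ T.a T.b) :=
  L1.lift (fun x => ((T.s (T.idx x) * T.g (T.idx x) : ℝ) : ℂ) • unitVec (T.fHat x))
    ⟨∑ k, |T.s k * T.g k|, fun x => by
      rw [norm_smul, norm_unitVec, mul_one, Complex.norm_real, Real.norm_eq_abs]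
      exact Finset.single_le_sum (f := fun k => |T.s k * T.g k|) (fun _ _ => abs_nonneg _)
        (Finset.mem_univ _)⟩

theorem shift_unitVec (x : Germ T.a T.b) :
    T.shift (unitVec x) = ((T.s (T.idx x) * T.g (T.idx x) : ℝ) : ℂ) • unitVec (T.fHat x) :=
  L1.lift_unitVec _ _ x

theorem shift_pow_unitVec (n : ℕ) (x : Germ T.a T.b) :
    (T.shift ^ n) (unitVec x) = ((T.sgProd n x : ℝ) : ℂ) • unitVec (T.fHat^[n] x) := by
  induction n with
  | zero => simp [sgProd]
  | succ n ih =>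
    rw [pow_succ']
    change T.shift ((T.shift ^ n) (unitVec x)) = _
    rw [ih, map_smul, shift_unitVec, smul_smul, Function.iterate_succ_apply', ← Complex.ofReal_mul, sgProd,
      sgProd, Finset.prod_range_succ]

theorem abs_sgProd (n : ℕ) (x : Germ T.a T.b) : |T.sgProd n x| = |T.gProd n x| := by
  have hs : ∀ k, |T.s k| = 1 := fun k => by
    unfold s; split_ifs <;> simp
  rw [sgProd, gProd, Finset.abs_prod, Finset.abs_prod]
  exact Finset.prod_congr rfl fun i _ => by rw [abs_mul, hs, one_mul]

/-- Through this equality, Gelfand's formula for the shift proves that the limit `ρ_∞` exists and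
identifies it with a spectral radius. -/
theorem norm_shift_pow (n : ℕ) : ‖T.shift ^ n‖ = T.gSup n := by
  have h1 : ∀ x, ‖(T.shift ^ n) (unitVec x)‖ = |T.gProd n x| := fun x => by
    rw [shift_pow_unitVec, norm_smul, norm_unitVec, mul_one, Complex.norm_real, Real.norm_eq_abs,
      abs_sgProd]
  have h2 : ∀ x, |T.gProd n x| ≤ ‖T.shift ^ n‖ := fun x => by
    rw [← h1]
    simpa [norm_unitVec] using (T.shift ^ n).le_opNorm (unitVec x)
  have : Nonempty (Germ T.a T.b) := ⟨T.cPlus 0⟩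
  refine le_antisymm ?_ (ciSup_le h2)
  refine L1.norm_le_of_unitVec _ (Real.iSup_nonneg fun _ => abs_nonneg _) fun x => ?_
  rw [h1]
  exact le_ciSup (f := fun x => |T.gProd n x|) ⟨_, by rintro _ ⟨x, rfl⟩; exact h2 x⟩ x

instance : Nontrivial (L1 (Germ T.a T.b)) :=
  nontrivial_of_ne (unitVec (T.cPlus 0)) 0 fun h => by
    have := norm_unitVec (T.cPlus 0)
    rw [h, norm_zero] at this
    exact zero_ne_one this

theorem tendsto_gSup :
    Tendsto (fun n : ℕ => T.gSup n ^ (1 / (n : ℝ))) atTop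
      (𝓝 (spectralRadius ℂ T.shift).toReal) := by
  have := tendsto_norm_pow_rpow T.shift
  simpa only [norm_shift_pow] using this

theorem rhoInf_eq : T.rhoInf = (spectralRadius ℂ T.shift).toReal := T.tendsto_gSup.limUnder_eq

/-! ### Kneading functionals and cutting vectors -/

theorem GermMem.above_iff {T : System d} {i : Fin (d + 1)} {x : Germ T.a T.b} (h : T.GermMem i x)
    (k : Fin (d + 1)) : x.Above (T.c k.castSucc) ↔ k ≤ i := by
  constructor
  · intro ha
    by_contra! hik
    have := T.castSucc_le_of_lt hik
    rcases x with ⟨x, hx⟩ | ⟨x, hx⟩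
    · exact absurd (this.trans ha) (not_le.2 h.2)
    · exact absurd (this.trans_lt ha) (not_lt.2 h.2)
  · intro hki
    have : T.c k.castSucc ≤ T.c i.castSucc :=
      T.c_strictMono.monotone (Fin.castSucc_le_castSucc_iff.2 hki)
    rcases x with ⟨x, hx⟩ | ⟨x, hx⟩
    · exact this.trans h.1
    · exact this.trans_lt h.1

theorem sigma_eq {i : Fin (d + 1)} {x : Germ T.a T.b} (h : T.GermMem i x) (k : Fin (d + 1)) :
    T.sigma k x = if k ≤ i then 1 / 2 else -1 / 2 := by
  unfold sigma
  simp only [h.above_iff]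

/-- The functional on `ℓ¹` of the germs extending `σ_{c_k}`. -/
def sigmaL (k : Fin (d + 1)) : L1 (Germ T.a T.b) →L[ℂ] ℂ :=
  L1.lift (T.sigma k) ⟨1, fun x => by
    rw [T.sigma_eq (T.idx_spec x)]
    split_ifs <;> norm_num⟩

theorem sigmaL_unitVec (k : Fin (d + 1)) (x : Germ T.a T.b) :
    T.sigmaL k (unitVec x) = T.sigma k x := L1.lift_unitVec _ _ x

/-- The vectors representing the cuts `Δ_{c_j}`. -/
def cut : Fin (d + 1) → L1 (Germ T.a T.b) :=
  Fin.cases (unitVec (T.cPlus 0) + unitVec (T.cMinus (Fin.last d)))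
    fun i : Fin d => unitVec (T.cPlus i.succ) - unitVec (T.cMinus i.castSucc)

theorem apply_cut (ψ : L1 (Germ T.a T.b) →L[ℂ] ℂ) (j : Fin (d + 1)) :
    ψ (T.cut j) = T.delta (fun x => ψ (unitVec x)) j := by
  cases j using Fin.cases with
  | zero => exact map_add ψ _ _
  | succ i => exact map_sub ψ _ _

/-- Crossing `c_j` flips `σ_{c_k}` only when `k = j`. For `j = 0` the values on the first and the
last lap cancel unless `k = 0`, where both are `1/2`; this explains the plus sign in the cut of
index `0`. -/
theorem sigmaL_cut (j k : Fin (d + 1)) :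
    T.sigmaL k (T.cut j) = (1 : Matrix (Fin (d + 1)) (Fin (d + 1)) ℂ) j k := by
  rw [apply_cut, Matrix.one_apply]
  simp only [sigmaL_unitVec]
  cases j using Fin.cases with
  | zero =>
    change T.sigma k (T.cPlus 0) + T.sigma k (T.cMinus (Fin.last d)) = _
    rw [T.sigma_eq (T.germMem_cPlus _), T.sigma_eq (T.germMem_cMinus _), if_pos (Fin.le_last k)]
    simp only [Fin.le_zero_iff, eq_comm (a := (0 : Fin (d + 1)))]
    split_ifs <;> norm_num
  | succ i =>
    change T.sigma k (T.cPlus i.succ) - T.sigma k (T.cMinus i.castSucc) = _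
    rw [T.sigma_eq (T.germMem_cPlus _), T.sigma_eq (T.germMem_cMinus _)]
    rcases lt_trichotomy k i.succ with h | h | h
    · rw [if_pos h.le, if_pos (Fin.le_castSucc_iff.2 h), if_neg h.ne', sub_self]
    · rw [if_pos h.le, if_neg (by rw [Fin.le_castSucc_iff, h]; exact lt_irrefl _), if_pos h.symm]
      norm_num
    · rw [if_neg (not_le.2 h), if_neg (by rw [Fin.le_castSucc_iff]; exact h.asymm), if_neg h.ne,
        sub_self]

open Classical in
/-- The functional on `ℓ¹` of the germs extending the indicator of `[c_k⁺, c_{k+1}⁻]`. -/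
def indicatorL (k : Fin (d + 1)) : L1 (Germ T.a T.b) →L[ℂ] ℂ :=
  L1.lift (fun x => if k = T.idx x then 1 else 0) ⟨1, fun x => by split_ifs <;> norm_num⟩

open Classical in
theorem indicatorL_unitVec (k : Fin (d + 1)) (x : Germ T.a T.b) :
    T.indicatorL k (unitVec x) = if k = T.idx x then 1 else 0 := L1.lift_unitVec _ _ x

/-- Lap indicators are combinations of the `σ`'s: `σ_{c_k} - σ_{c_{k+1}}` for a lap before the last,
and `σ_{c_d} + σ_{c_0}` for the last one, because `σ_{c_0}` is constantly `1/2`. -/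
theorem indicatorL_eq_zero {y : L1 (Germ T.a T.b)} (hy : ∀ k, T.sigmaL k y = 0)
    (k : Fin (d + 1)) : T.indicatorL k y = 0 := by
  classical
  cases k using Fin.lastCases with
  | last =>
    have : T.indicatorL (Fin.last d) = T.sigmaL (Fin.last d) + T.sigmaL 0 := by
      refine L1.ext_unitVec fun x => ?_
      rw [add_apply, indicatorL_unitVec, sigmaL_unitVec, sigmaL_unitVec,
        T.sigma_eq (T.idx_spec x), T.sigma_eq (T.idx_spec x), if_pos (Fin.zero_le _)]
      simp only [Fin.last_le_iff, eq_comm (b := T.idx x)]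
      split_ifs <;> norm_num
    rw [this, add_apply, hy, hy, add_zero]
  | cast i =>
    have : T.indicatorL i.castSucc = T.sigmaL i.castSucc - T.sigmaL i.succ := by
      refine L1.ext_unitVec fun x => ?_
      rw [sub_apply, indicatorL_unitVec, sigmaL_unitVec, sigmaL_unitVec,
        T.sigma_eq (T.idx_spec x), T.sigma_eq (T.idx_spec x)]
      have hs : i.succ ≤ T.idx x ↔ i.castSucc < T.idx x := Fin.castSucc_lt_iff_succ_le.symm
      rcases lt_trichotomy i.castSucc (T.idx x) with h | h | h
      · rw [if_neg h.ne, if_pos h.le, if_pos (hs.2 h), sub_self]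
      · rw [if_pos h, if_pos h.le, if_neg fun h' => h.not_lt (hs.1 h')]
        norm_num
      · rw [if_neg h.ne', if_neg (not_le.2 h), if_neg fun h' => h.asymm (hs.1 h'), sub_self]
    rw [this, sub_apply, hy, hy, sub_zero]

/-! ### The factorization of the transfer operator -/

/-- The defect between `L ∘ synth` and `synth ∘ N` depends only on the lap of the germ, since
differences within a lap are intertwined exactly. -/
theorem ruelle_synth_sub {k : Fin (d + 1)} {x x' : Germ T.a T.b} (h : T.GermMem k x)
    (h' : T.GermMem k x') :
    T.ruelle (synth (unitVec x)) - synth (T.shift (unitVec x)) =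
      T.ruelle (synth (unitVec x')) - synth (T.shift (unitVec x')) := by
  have key := congrArg (fun φ : Step T.a T.b => (φ : SBV T.a T.b)) (T.ruelleStep_step_sub h h')
  simp only [UniformSpace.Completion.coe_smul, UniformSpace.Completion.coe_sub, ← ruelle_coe,
    map_sub] at key
  rw [shift_unitVec, shift_unitVec, map_smul, map_smul, synth_unitVec, synth_unitVec,
    synth_unitVec, synth_unitVec, h.idx_eq, h'.idx_eq, sub_eq_sub_iff_sub_eq_sub, key, smul_sub]

/-- The defect operator is a finite sum of lap indicators times fixed vectors, so it vanishes
wherever those indicators do. -/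
theorem ruelle_synth_eq {y : L1 (Germ T.a T.b)} (hy : ∀ k, T.sigmaL k y = 0) :
    T.ruelle (synth y) = synth (T.shift y) := by
  classical
  set A : L1 (Germ T.a T.b) →L[ℂ] SBV T.a T.b := T.ruelle ∘L synth - synth ∘L T.shift with hA
  have : A = ∑ k, (T.indicatorL k).smulRight (A (unitVec (T.cPlus k))) := by
    refine L1.ext_unitVec fun x => ?_
    rw [_root_.sum_apply, Finset.sum_eq_single (T.idx x)]
    · rw [ContinuousLinearMap.smulRight_apply, indicatorL_unitVec, if_pos rfl, one_smul]
      exact T.ruelle_synth_sub (T.idx_spec x) (T.germMem_cPlus _)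
    · intro k _ hk
      rw [ContinuousLinearMap.smulRight_apply, indicatorL_unitVec, if_neg hk, zero_smul]
    · simp
  have h0 : A y = 0 := by
    rw [this, _root_.sum_apply]
    refine Finset.sum_eq_zero fun k _ => ?_
    rw [ContinuousLinearMap.smulRight_apply, T.indicatorL_eq_zero hy, zero_smul]
  exact sub_eq_zero.1 h0

theorem ruelle_synth_cut (j : Fin (d + 1)) : T.ruelle (synth (T.cut j)) = 0 := by
  cases j using Fin.cases with
  | zero =>
    change T.ruelle (synth (unitVec (T.cPlus 0) + unitVec (T.cMinus (Fin.last d)))) = 0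
    rw [map_add, synth_unitVec, synth_unitVec, ← UniformSpace.Completion.coe_add, T.step_boundary,
      UniformSpace.Completion.coe_zero, map_zero]
  | succ i =>
    change T.ruelle (synth (unitVec (T.cPlus i.succ) - unitVec (T.cMinus i.castSucc))) = 0
    rw [map_sub, synth_unitVec, synth_unitVec, ← UniformSpace.Completion.coe_sub, ruelle_coe,
      T.ruelleStep_step_cut, UniformSpace.Completion.coe_zero]

theorem sigmaL_sub_rankOp (y : L1 (Germ T.a T.b)) (k : Fin (d + 1)) :
    T.sigmaL k (y - rankOp 1 T.cut T.sigmaL y) = 0 := by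
  rw [rankOp_apply, Matrix.vecMul_one, map_sub, map_sum]
  simp [sigmaL_cut, Matrix.one_apply]

theorem cut_zero : T.cut 0 = unitVec (Germ.left : Germ T.a T.b) + unitVec Germ.right := rfl

/-- The factorization of `L` through the shift on germs. -/
def factorization : Factorization T.ruelle T.shift T.cut T.sigmaL where
  π := synth
  ι := jumps
  dual := T.sigmaL_cut
  factor x := by
    -- On the range of `1 - P` the shift may be exchanged for `L`, and subtracting the `P`-part
    -- costs nothing because `L` kills the synthesized cuts.
    rw [← T.ruelle_synth_eq (T.sigmaL_sub_rankOp _), map_sub, map_sub, synth_jumps, rankOp_apply,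
      map_sum, map_sum, Finset.sum_eq_zero, sub_zero]
    intro j _
    rw [map_smul, map_smul, ruelle_synth_cut, smul_zero]
  lift y := by
    suffices h : (1 - rankOp 1 T.cut T.sigmaL) ∘L (jumps ∘L synth) = 1 - rankOp 1 T.cut T.sigmaL from
      DFunLike.congr_fun h y
    refine L1.ext_unitVec fun x => ?_
    have hx : (jumps ∘L synth) (unitVec x) = jumpStep x.step := by
      change jumps (synth (unitVec x)) = _
      rw [synth_unitVec, jumps_coe]
    rw [ContinuousLinearMap.comp_apply, hx]
    -- For `b⁻` the two sides differ by `1 - P` applied to the cut vector of index `0`, which is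
    -- zero by duality.
    by_cases hr : x = Germ.right
    · subst hr
      rw [jumpStep_step_right, map_neg, neg_eq_iff_add_eq_zero, ← map_add, ← cut_zero]
      change T.cut 0 - rankOp 1 T.cut T.sigmaL (T.cut 0) = 0
      rw [rankOp_apply, Matrix.vecMul_one]
      simp [sigmaL_cut, Matrix.one_apply]
    · rw [jumpStep_step hr]

theorem thetaTerm_eq (k : Fin (d + 1)) (x : Germ T.a T.b) (t : ℂ) (n : ℕ) :
    T.thetaTerm k x t n = T.sigmaL k (((t • T.shift) ^ n) (unitVec x)) := by
  rw [smul_pow, _root_.smul_apply, shift_pow_unitVec, map_smul, map_smul, sigmaL_unitVec, thetaTerm,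
    smul_eq_mul, smul_eq_mul, mul_assoc]

theorem hasSum_thetaTerm {t : ℂ} (ht : ‖t‖ * T.rhoInf < 1) (k : Fin (d + 1)) (x : Germ T.a T.b) :
    HasSum (T.thetaTerm k x t) (T.sigmaL k (Ring.inverse (1 - t • T.shift) (unitVec x))) := by
  rw [rhoInf_eq] at ht
  have h := (isUnit_one_sub_smul T.shift ht).2
  have h2 := h.mapL ((T.sigmaL k) ∘L (ContinuousLinearMap.apply ℂ _ (unitVec x)))
  have e : T.thetaTerm k x t = fun n => T.sigmaL k (((t • T.shift) ^ n) (unitVec x)) :=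
    funext fun n => T.thetaTerm_eq k x t n
  rw [e]
  exact h2

/-- The kneading series is `σ_{c_k}` applied to the Neumann series of the shift at a germ, and the
vectors `cut j` represent the operation `delta`. -/
theorem kneadingMatrix_eq {t : ℂ} (ht : ‖t‖ * T.rhoInf < 1) :
    T.kneadingMatrix t = resolventMatrix T.shift T.cut T.sigmaL t := by
  ext j k
  have h := T.apply_cut (T.sigmaL k ∘L Ring.inverse (1 - t • T.shift)) j
  change T.delta (T.theta k t) j = T.sigmaL k (Ring.inverse (1 - t • T.shift) (T.cut j))
  have e : T.theta k t = fun x => T.sigmaL k (Ring.inverse (1 - t • T.shift) (unitVec x)) :=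
    funext fun x => (T.hasSum_thetaTerm ht k x).tsum_eq
  rw [e]
  exact h.symm

end System

/-! ### Positivity and the leading eigenvalue -/

section Eval

variable {a b : EReal} [Fact (a < b)]

/-- Evaluation of step functions at a point. -/
def evalStep (y : Ioo a b) : Step a b →L[ℂ] ℂ :=
  LinearMap.mkContinuous
    { toFun := fun φ => φ y
      map_add' := fun _ _ => rfl
      map_smul' := fun _ _ => rfl } 1 fun φ => by
    rw [one_mul]
    exact φ.norm_apply_le y

/-- Evaluation at a point, on `SBV(a,b)`. -/
def eval (y : Ioo a b) : SBV a b →L[ℂ] ℂ :=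
  (evalStep y).extend (UniformSpace.Completion.toComplL : Step a b →L[ℂ] SBV a b)

theorem eval_coe (y : Ioo a b) (φ : Step a b) : eval y (φ : SBV a b) = φ y :=
  (evalStep y).extend_eq (e := (UniformSpace.Completion.toComplL : Step a b →L[ℂ] SBV a b))
    UniformSpace.Completion.denseRange_coe (UniformSpace.Completion.isUniformInducing_coe _) φ

theorem norm_eval_le (y : Ioo a b) (u : SBV a b) : ‖eval y u‖ ≤ ‖u‖ := by
  refine UniformSpace.Completion.induction_on u
    (isClosed_le (eval y).continuous.norm continuous_norm) fun φ => ?_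
  rw [eval_coe, UniformSpace.Completion.norm_coe]
  exact φ.norm_apply_le y

end Eval

namespace System

variable {d : ℕ} (T : System d)

/-- Elements of the completion are not functions, so positivity of `L` is expressed through point
evaluations: a value of `L u` is a nonnegative combination of values of `u`. This is checked on step
functions and passes to limits. -/
theorem exists_eval_ruelle (hg : ∀ k, 0 ≤ T.g k) (y : Ioo T.a T.b) :
    ∃ (w : Fin (d + 1) → ℝ) (z : Fin (d + 1) → Ioo T.a T.b), (∀ k, 0 ≤ w k) ∧
      ∀ u, eval y (T.ruelle u) = ∑ k, (w k : ℂ) * eval (z k) u := by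
  have h : ∀ k, ∃ (w : ℝ) (z : Ioo T.a T.b), 0 ≤ w ∧
      ∀ φ : Ioo T.a T.b → ℂ, T.branchFun k φ y = w * φ z := by
    intro k
    by_cases hy : y ∈ T.J k
    · obtain ⟨x, hx, e⟩ := hy
      exact ⟨T.g k, x, hg k, fun φ => T.branchFun_eq φ hx e⟩
    · exact ⟨0, y, le_rfl, fun φ => by
        rw [T.branchFun_of_notMem φ hy, Complex.ofReal_zero, zero_mul]⟩
  choose w z hw hb using h
  refine ⟨w, z, hw, fun u => ?_⟩
  refine UniformSpace.Completion.induction_on u (isClosed_eq (by fun_prop) (by fun_prop)) fun φ => ?_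
  simp only [ruelle_coe, eval_coe, ruelleStep_apply, hb]

theorem ruelle_mapsTo_posCone (hg : ∀ k, 0 ≤ T.g k) :
    MapsTo T.ruelle (posCone eval) (posCone eval) := by
  intro u hu y
  obtain ⟨w, z, hw, h⟩ := T.exists_eval_ruelle hg y
  rw [h, Complex.re_sum]
  refine Finset.sum_nonneg fun k _ => ?_
  rw [Complex.re_ofReal_mul]
  exact mul_nonneg (hw k) (hu _)

theorem spRadius_mem_spectrum (hg : ∀ k, 0 ≤ T.g k) (hpos : 0 < T.spRadius) :
    (T.spRadius : ℂ) ∈ spectrum ℂ T.ruelle := by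
  have : Nonempty (Ioo T.a T.b) := nonempty_Ioo_subtype (Fact.out : T.a < T.b)
  refine spectralRadius_mem_spectrum norm_eval_le (T.ruelle_mapsTo_posCone hg)
    (e := (Step.one T.a T.b : SBV T.a T.b)) (fun y => ?_) T.supNormIterOne_nonneg
    (fun n M hM => ciSup_le fun y => ?_) (T.tendsto_supNorm hg) hpos
  · rw [eval_coe]
    exact zero_le_one
  · classical
    have := hM y
    rw [ruelle_pow_coe, eval_coe, ruelleStep_pow_one_apply, Complex.ofReal_re] at this
    rw [ruelleStep_pow_one_apply, Complex.norm_real, Real.norm_eq_abs, abs_of_nonneg]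
    · exact this
    · exact Finset.sum_nonneg fun w _ => Finset.prod_nonneg fun i _ => hg _

/-! ### Zeros of the Milnor–Thurston determinant and the spectrum of `L` -/

theorem rhoInf_nonneg : 0 ≤ T.rhoInf := by
  rw [rhoInf_eq]
  exact ENNReal.toReal_nonneg

theorem isUnit_of_dMT_ne_zero {t : ℂ} (ht : ‖t‖ * T.rhoInf < 1) (h : T.dMT t ≠ 0) :
    IsUnit (1 - t • T.ruelle) := by
  rw [dMT, T.kneadingMatrix_eq ht] at h
  rw [rhoInf_eq] at ht
  obtain ⟨h1, h2⟩ := T.factorization.inverse_spec (isUnit_one_sub_smul T.shift ht).1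
  set δ := (resolventMatrix T.shift T.cut T.sigmaL t).det
  refine ⟨⟨1 - t • T.ruelle, δ⁻¹ • T.factorization.inverse t, ?_, ?_⟩, rfl⟩
  · rw [mul_smul_comm, h1, inv_smul_smul₀ h]
  · rw [smul_mul_assoc, h2, inv_smul_smul₀ h]

theorem dMT_zero : T.dMT 0 = 1 := by
  rw [dMT, T.kneadingMatrix_eq (by simp)]
  have : resolventMatrix T.shift T.cut T.sigmaL 0 = 1 := by
    ext j k
    simp [resolventMatrix, sigmaL_cut]
  rw [this, Matrix.det_one]

/-- A zero `t` gives a nonzero vector fixed by `t L`. This is impossible where the Neumann series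
inverts `1 - t L`. -/
theorem one_le_of_dMT_eq_zero {t : ℂ} (ht : ‖t‖ * T.rhoInf < 1) (h : T.dMT t = 0) :
    1 ≤ ‖t‖ * T.spRadius := by
  have ht0 : t ≠ 0 := by
    rintro rfl
    rw [dMT_zero] at h
    exact _root_.one_ne_zero h
  rw [dMT, T.kneadingMatrix_eq ht] at h
  rw [rhoInf_eq] at ht
  obtain ⟨x, hx, e⟩ := T.factorization.exists_eigenvector (isUnit_one_sub_smul T.shift ht).1 h
  by_contra! hlt
  obtain ⟨u, hu⟩ := (isUnit_one_sub_smul T.ruelle hlt).1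
  refine hx ?_
  have h0 : (u : SBV T.a T.b →L[ℂ] SBV T.a T.b) x = 0 := by
    rw [hu]
    change x - t • T.ruelle x = 0
    rw [e, sub_self]
  calc x = ((↑u⁻¹ * ↑u : SBV T.a T.b →L[ℂ] SBV T.a T.b)) x := by rw [Units.inv_mul]; rfl
    _ = (↑u⁻¹ : SBV T.a T.b →L[ℂ] SBV T.a T.b) ((u : SBV T.a T.b →L[ℂ] SBV T.a T.b) x) := rfl
    _ = 0 := by rw [h0, map_zero]

/-- Were the determinant nonzero at `1/ρ_sp(L)`, the factorization would put `ρ_sp(L)` in the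
resolvent set, against positivity. -/
theorem dMT_inv_spRadius (hg : ∀ k, 0 ≤ T.g k) (h : T.rhoInf < T.spRadius) :
    ‖((T.spRadius : ℂ))⁻¹‖ * T.rhoInf < 1 ∧ T.dMT (T.spRadius : ℂ)⁻¹ = 0 := by
  have hpos : 0 < T.spRadius := T.rhoInf_nonneg.trans_lt h
  have hne : (T.spRadius : ℂ) ≠ 0 := Complex.ofReal_ne_zero.2 hpos.ne'
  have ht : ‖((T.spRadius : ℂ))⁻¹‖ * T.rhoInf < 1 := by
    rw [norm_inv, Complex.norm_real, Real.norm_of_nonneg hpos.le, inv_mul_lt_one₀ hpos]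
    exact h
  refine ⟨ht, ?_⟩
  by_contra hd
  have hu := T.isUnit_of_dMT_ne_zero ht hd
  refine T.spRadius_mem_spectrum hg hpos ?_
  rw [spectrum.mem_resolventSet_iff, Algebra.algebraMap_eq_smul_one]
  have : (T.spRadius : ℂ) • (1 : SBV T.a T.b →L[ℂ] SBV T.a T.b) - T.ruelle =
      Units.mk0 _ hne • (1 - (T.spRadius : ℂ)⁻¹ • T.ruelle) := by
    rw [Units.smul_mk0, smul_sub, smul_inv_smul₀ hne]
  rw [this]
  exact hu.smul _

end System

end Kneading

end

/-! ### The main theorem -/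

theorem mainTheorem2 {d : ℕ} (T : Kneading.System d) (hg : ∀ k, 0 ≤ T.g k) :
    -- the growth rates of `Ω_n` and of `‖Lⁿ 1‖_∞` exist and equal the spectral radius of `L`
    Tendsto (fun n : ℕ => T.Omega n ^ (1 / (n : ℝ))) atTop (𝓝 T.spRadius) ∧
    Tendsto (fun n : ℕ => T.supNormIterOne n ^ (1 / (n : ℝ))) atTop (𝓝 T.spRadius) ∧
    -- topological entropy, for unit weights
    ((∀ k, T.g k = 1) →
      Tendsto (fun n : ℕ => ((T.Z n).ncard : ℝ) ^ (1 / (n : ℝ))) atTop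
        (𝓝 (Real.exp T.topEntropy)) ∧
      T.spRadius = Real.exp T.topEntropy) ∧
    -- the limit defining `ρ_∞` exists, and the kneading series converge for `|t| < 1/ρ_∞`
    Tendsto (fun n : ℕ => T.gSup n ^ (1 / (n : ℝ))) atTop (𝓝 T.rhoInf) ∧
    (∀ t : ℂ, ‖t‖ * T.rhoInf < 1 → ∀ k x, Summable (T.thetaTerm k x t)) ∧
    -- the leading eigenvalue and the smallest zero of `d_MT` in its disk of definition
    (T.rhoInf < T.spRadius →
      Kneading.IsIsolatedEigenvalueOfFiniteMultiplicity T.ruelle (T.spRadius : ℂ) ∧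
      0 < 1 / T.spRadius ∧
      1 / T.spRadius * T.rhoInf < 1 ∧
      T.dMT ((1 / T.spRadius : ℝ) : ℂ) = 0 ∧
      ∀ t : ℂ, ‖t‖ * T.rhoInf < 1 → T.dMT t = 0 → 1 / T.spRadius ≤ ‖t‖) := by
  refine ⟨T.tendsto_Omega hg, T.tendsto_supNorm hg, T.entropy, ?_,
    fun t ht k x => (T.hasSum_thetaTerm ht k x).summable, fun h => ?_⟩
  · rw [T.rhoInf_eq]
    exact T.tendsto_gSup
  have hpos : 0 < T.spRadius := T.rhoInf_nonneg.trans_lt h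
  have hne : (T.spRadius : ℂ) ≠ 0 := Complex.ofReal_ne_zero.2 hpos.ne'
  obtain ⟨ht, hd⟩ := T.dMT_inv_spRadius hg h
  refine ⟨?_, by positivity, ?_, ?_, fun t ht' hd' => ?_⟩
  · rw [Kneading.System.dMT, T.kneadingMatrix_eq ht] at hd
    rw [T.rhoInf_eq] at ht
    exact T.factorization.isIsolatedEigenvalue hne ht hd
  · rwa [one_div, inv_mul_lt_one₀ hpos]
  · rwa [one_div, Complex.ofReal_inv]
  · rw [div_le_iff₀ hpos]
    exact T.one_le_of_dMT_eq_zero ht' hd'
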